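/- All series are formal power series in $q$. Write $(a;b)_n=\prod_{j=0}^{n-1}(1-ab^j)$, $(a;b)_\infty=\prod_{j\ge 0}(1-ab^j)$ and $(a_1,\dots,a_r;b)_n=(a_1;b)_n\cdots(a_r;b)_n$ (also for $n=\infty$). Define $$S_{G1}(z,q)=\frac{(q^2;q^2)_\infty}{(z,z^{-1},q,q^2;q^2)_\infty}\sum_{n\ge1}\frac{(z,z^{-1},q,q^2;q^2)_n\,q^n}{(q^2;q^2)_{2n}},$$ $$S_{G2}(z,q)=\frac{(q;q)_\infty}{(z,z^{-1};q)_\infty(-q;q^2)_\infty}\sum_{n\ge1}\frac{(z,z^{-1};q)_n(-q;q^2)_n\,q^n}{(q;q)_{2n}},$$ $$S_{F1}(z,q)=\frac{(q;q)_\infty}{(z,z^{-1},-q;q)_\infty}\sum_{n\ge1}\frac{(z,z^{-1},-q;q)_n\,q^{n(n-1)/2}}{(q;q)_{2n}},$$ $$S_{G3}(z,q)=\frac{(q;q)_\infty}{(z,z^{-1},q;q)_\infty}\sum_{n\ge1}\frac{(z,z^{-1},q;q)_n\,(-1)^nq^{n(n+1)/2}}{(q;q)_{2n}},$$ $$S_{L7}(z,q)=\frac{(-q;q)_\infty}{(z,z^{-1};q^2)_\infty}\sum_{n\ge1}\frac{(z,z^{-1};q^2)_n\,q^{2n}}{(-q;q)_{2n}},$$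 $$S_{L9}(z,q)=\frac{(q;q^2)_\infty}{(z,z^{-1};q)_\infty}\sum_{n\ge1}\frac{(z,z^{-1};q)_n\,q^{n}}{(q;q^2)_{n}},$$ $$S_{L12}(z,q)=\frac{(-q;q^2)_\infty^2}{(z,z^{-1};q^2)_\infty}\sum_{n\ge1}\frac{(z,z^{-1};q^2)_n\,q^{2n}}{(-q;q^2)_{n}(-q;q^2)_{n+1}}.$$ For each $X\in\{G1,G2,F1,G3,L7,L9,L12\}$ there are unique integers $M_X(m,n)$ ($m\in\mathbb Z$, $n\ge0$), only finitely many of them nonzero for each fixed $n$, such that $$S_X(z,q)=\sum_{n\ge0}\sum_{m\in\mathbb Z}M_X(m,n)\,z^mq^n .$$ Put $M_X(k,t,n)=\sum_{m\equiv k\ (\mathrm{mod}\ t)}M_X(m,n)$. Then for every $n\ge0$: * $M_{L7}(k,3,3n+1)$, $M_{L9}(k,3,3n+2)$, $M_{L12}(k,3,3n)$, $M_{G1}(k,3,3n)$, $M_{G2}(k,3,3n)$ and $M_{G2}(k,3,3n+2)$ each take the same value for $k=0,1,2$; * $M_{F1}(k,5,10n+9)$ and $M_{G3}(k,5,5n+3)$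 each take the same value for $k=0,1,2,3,4$. -/

import Mathlib

noncomputable section

namespace SptCrank

/-- The coefficient field `ℚ(z)`; the formal power series below are elements of `ℚ(z)⟦q⟧`. -/
abbrev K : Type := RatFunc ℚ

/-- The discrete topology on the coefficients, so that limits in `K⟦q⟧` are coefficientwise
eventual equality (the `q`-adic topology). -/
@[reducible] def discreteK : TopologicalSpace K := ⊥

/-- The variable `q`. -/
def q : PowerSeries K := PowerSeries.X

/-- The variable `z`, as a constant series. -/
def z : PowerSeries K := PowerSeries.C RatFunc.X

/-- The inverse `z⁻¹`, as a constant series. -/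
def zinv : PowerSeries K := PowerSeries.C (RatFunc.X)⁻¹

section Limits

attribute [local instance] discreteK
open scoped PowerSeries.WithPiTopology

/-- The finite product `(a; b)_n = ∏_{j < n} (1 - a b^j)`. -/
def qFin (a b : PowerSeries K) (n : ℕ) : PowerSeries K :=
  ∏ j ∈ Finset.range n, (1 - a * b ^ j)

/-- The infinite product `(a; b)_∞ = ∏_{j ≥ 0} (1 - a b^j)`, for `b` without constant term. -/
def qInf (a b : PowerSeries K) : PowerSeries K :=
  ∏' j : ℕ, (1 - a * b ^ j)

/-- The infinite sum `∑_{n ≥ 1} t n`. -/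
def sumPos (t : ℕ → PowerSeries K) : PowerSeries K :=
  ∑' n : ℕ, t (n + 1)

/-- The products `(a; b)_∞` converge when `b` has no constant term. -/
theorem multipliable_qInf (a b : PowerSeries K) (hb : PowerSeries.constantCoeff b = 0) :
    Multipliable (fun j : ℕ => 1 - a * b ^ j) := by
  have : Multipliable (fun j : ℕ => 1 + -(a * b ^ j)) := by
    apply PowerSeries.WithPiTopology.multipliable_one_add_of_tendsto_order_atTop_nhds_top
    rw [ENat.tendsto_nhds_top_iff_natCast_lt]
    intro n
    filter_upwards [Filter.eventually_gt_atTop n] with j hj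
    rw [PowerSeries.order_neg]
    calc (n : ℕ∞) < j := by exact_mod_cast hj
      _ ≤ (b ^ j).order := PowerSeries.le_order_pow_of_constantCoeff_eq_zero j hb
      _ ≤ a.order + (b ^ j).order := le_add_self
      _ ≤ (a * b ^ j).order := PowerSeries.le_order_mul _ _
  simpa only [sub_eq_add_neg] using this

/-- A series whose `n`-th term is divisible by `q ^ e n`, with `e n ≥ n - 1`, converges. -/
theorem summable_sumPos (t g : ℕ → PowerSeries K) (e : ℕ → ℕ) (he : ∀ n, n ≤ e n + 1)
    (ht : ∀ n, t n = q ^ e n * g n) : Summable (fun n : ℕ => t (n + 1)) := by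
  apply PowerSeries.WithPiTopology.summable_of_tendsto_order_atTop_nhds_top
  rw [ENat.tendsto_nhds_top_iff_natCast_lt]
  intro n
  filter_upwards [Filter.eventually_gt_atTop n] with j hj
  have hje : n < e (j + 1) := by have := he (j + 1); omega
  calc (n : ℕ∞) < (e (j + 1) : ℕ) := by exact_mod_cast hje
    _ ≤ (q ^ e (j + 1)).order :=
        PowerSeries.le_order_pow_of_constantCoeff_eq_zero _ PowerSeries.constantCoeff_X
    _ ≤ (q ^ e (j + 1)).order + (g (j + 1)).order := le_self_add
    _ ≤ (t (j + 1)).order := by rw [ht]; exact PowerSeries.le_order_mul _ _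

end Limits

/-- `S_{G1}(z,q)`. -/
def SG1 : PowerSeries K :=
  qInf (q ^ 2) (q ^ 2)
    * (qInf z (q ^ 2) * qInf zinv (q ^ 2) * qInf q (q ^ 2) * qInf (q ^ 2) (q ^ 2))⁻¹
    * sumPos fun n =>
        qFin z (q ^ 2) n * qFin zinv (q ^ 2) n * qFin q (q ^ 2) n * qFin (q ^ 2) (q ^ 2) n
          * q ^ n * (qFin (q ^ 2) (q ^ 2) (2 * n))⁻¹

/-- `S_{G2}(z,q)`. -/
def SG2 : PowerSeries K :=
  qInf q q * (qInf z q * qInf zinv q * qInf (-q) (q ^ 2))⁻¹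
    * sumPos fun n =>
        qFin z q n * qFin zinv q n * qFin (-q) (q ^ 2) n * q ^ n * (qFin q q (2 * n))⁻¹

/-- `S_{F1}(z,q)`. -/
def SF1 : PowerSeries K :=
  qInf q q * (qInf z q * qInf zinv q * qInf (-q) q)⁻¹
    * sumPos fun n =>
        qFin z q n * qFin zinv q n * qFin (-q) q n * q ^ (n * (n - 1) / 2)
          * (qFin q q (2 * n))⁻¹

/-- `S_{G3}(z,q)`. -/
def SG3 : PowerSeries K :=
  qInf q q * (qInf z q * qInf zinv q * qInf q q)⁻¹
    * sumPos fun n =>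
        qFin z q n * qFin zinv q n * qFin q q n * (-1) ^ n * q ^ (n * (n + 1) / 2)
          * (qFin q q (2 * n))⁻¹

/-- `S_{L7}(z,q)`. -/
def SL7 : PowerSeries K :=
  qInf (-q) q * (qInf z (q ^ 2) * qInf zinv (q ^ 2))⁻¹
    * sumPos fun n =>
        qFin z (q ^ 2) n * qFin zinv (q ^ 2) n * q ^ (2 * n) * (qFin (-q) q (2 * n))⁻¹

/-- `S_{L9}(z,q)`. -/
def SL9 : PowerSeries K :=
  qInf q (q ^ 2) * (qInf z q * qInf zinv q)⁻¹
    * sumPos fun n =>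
        qFin z q n * qFin zinv q n * q ^ n * (qFin q (q ^ 2) n)⁻¹

/-- `S_{L12}(z,q)`. -/
def SL12 : PowerSeries K :=
  qInf (-q) (q ^ 2) ^ 2 * (qInf z (q ^ 2) * qInf zinv (q ^ 2))⁻¹
    * sumPos fun n =>
        qFin z (q ^ 2) n * qFin zinv (q ^ 2) n * q ^ (2 * n)
          * (qFin (-q) (q ^ 2) n * qFin (-q) (q ^ 2) (n + 1))⁻¹

/-- The labels `X` of the seven spt-crank functions `S_X`. -/
inductive Label where
  | G1 | G2 | F1 | G3 | L7 | L9 | L12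

/-- The spt-crank function `S_X(z,q)`. -/
def S : Label → PowerSeries K
  | .G1 => SG1
  | .G2 => SG2
  | .F1 => SF1
  | .G3 => SG3
  | .L7 => SL7
  | .L9 => SL9
  | .L12 => SL12

/-- `f = ∑_n ∑_m M(m,n) z^m q^n`, where for each `n` only finitely many of the integers
`M(m,n)` are nonzero. -/
def IsExpansion (f : PowerSeries K) (M : ℤ → ℕ → ℤ) : Prop :=
  ∀ n : ℕ, (Function.support fun m => M m n).Finite ∧
    PowerSeries.coeff n f = ∑ᶠ m : ℤ, (M m n : K) * (RatFunc.X : K) ^ m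

/-- `M(k,t,n) = ∑_{m ≡ k (mod t)} M(m,n)`. -/
def residueSum (M : ℤ → ℕ → ℤ) (k : ℤ) (t n : ℕ) : ℤ :=
  ∑ᶠ (m : ℤ) (_ : m ≡ k [ZMOD t]), M m n

/-- The numbers `M(k,t,n)` are the same for all residues `k` modulo `t`. -/
def Equidistributed (M : ℤ → ℕ → ℤ) (t n : ℕ) : Prop :=
  ∀ k l : ℤ, residueSum M k t n = residueSum M l t n

end SptCrank

end

/-! Since `3` and `5` are prime, the residue sums of an integral Laurent polynomial modulo `t` are
equal as soon as it vanishes at a primitive `t`-th root of unity `ζ`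
(`equidistributed_of_eval_eq_zero`). So it suffices that the coefficients of `S_X(ζ, q)` vanish
along the stated progressions.

To make `z = ζ` legitimate, `S_X` is rebuilt over an arbitrary ring as `genS`: for `n ≥ 1` the
quotient `(z; Q)_n / (z; Q)_∞` is `1 / (z Q^n; Q)_∞`, which needs no division by `1 - z`. Over `ℤ[z,
z⁻¹]` this gives integers with finite support in each degree, and `map_genS` carries the result both
to `ℚ(z)`, where it is the original `S_X`, and to `ζ`.

The computation is Bailey's transform. The products `(z, z⁻¹; Q)_n / (Q; Q)_{2n}` expand in terms of
`χ_r(z) = (z^(r+1) + z^(-r)) / (1 + z)` (`symPoch_expansion`). Subtracting the case `z = 1` and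
interchanging summations (`tsum_symPoch`) turns `(z, z⁻¹; Q)_∞ S_X` into a product times `∑ b_r γ_r
(χ_r(z) - 1)`, where `b_r` is `bcoef` and `γ_r` is `conj`. The `γ_r` come from telescoping relations
between consecutive `r`. For L7, L9, L12 these are inhomogeneous and are solved by partial theta
series; for the other labels they are homogeneous and the remaining constant is found by letting `r
→ ∞`.

Modulo 3, `χ_r(ζ) - 1` vanishes unless `r ≡ 1`, and `(ζ, ζ⁻¹, Q; Q)_∞` is `3 (Q³; Q³)_∞`, so
dividing by it preserves residue classes of exponents. The missing classes are then read off
(`resSupp_genS_three`).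

Modulo 5, multiplication by the theta series `(ζ², ζ⁻², q; q)_∞` completes the denominator to a
multiple of `(q⁵; q⁵)_∞`. That theta series has exponents only in the classes `0, 1`. For G3 the
other factor has square exponents, and the class `3` is never reached. For F1 the class `4` comes
from a single product of two theta functions, and its quotient by `(q⁵; q⁵)_∞` is a series in `q¹⁰`;
hence only exponents `4` modulo `10` occur in that class. -/

namespace SptCrank
noncomputable section
open PowerSeries Filter Topology
set_option linter.unusedSectionVars false
open scoped PowerSeries.WithPiTopology

/-! ### Summability and limits in the `X`-adic topology. -/

section Convergence

variable {A : Type*} [CommRing A]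

/-- A family of power series whose members are eventually divisible by every power of `X`. -/
def IsNull {ι : Type*} (f : ι → A⟦X⟧) : Prop :=
  ∀ N : ℕ, ∀ᶠ i in cofinite, (X : A⟦X⟧) ^ N ∣ f i

theorem IsNull.mul_left {ι : Type*} {f : ι → A⟦X⟧} (hf : IsNull f) (g : ι → A⟦X⟧) :
    IsNull fun i => g i * f i :=
  fun N => (hf N).mono fun i hi => hi.mul_left (g i)

theorem IsNull.mul_right {ι : Type*} {f : ι → A⟦X⟧} (hf : IsNull f) (g : ι → A⟦X⟧) :
    IsNull fun i => f i * g i :=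
  fun N => (hf N).mono fun i hi => hi.mul_right (g i)

theorem IsNull.comp_injective {ι κ : Type*} {f : ι → A⟦X⟧} (hf : IsNull f) {g : κ → ι}
    (hg : Function.Injective g) : IsNull fun k => f (g k) :=
  fun N => hg.tendsto_cofinite.eventually (hf N)

/-- The slack `c` accommodates exponents such as `n (n - 1) / 2`, which are only bounded below by `n
- 1`. -/
theorem isNull_of_dvd {f : ℕ → A⟦X⟧} (e : ℕ → ℕ) (c : ℕ) (he : ∀ n, n ≤ e n + c)
    (h : ∀ n, (X : A⟦X⟧) ^ e n ∣ f n) : IsNull f := by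
  intro N
  rw [Nat.cofinite_eq_atTop]
  filter_upwards [eventually_ge_atTop (N + c)] with n hn
  exact (pow_dvd_pow _ (by have := he n; omega)).trans (h n)

theorem isNull_prod_of_dvd {f : ℕ × ℕ → A⟦X⟧} (c : ℕ)
    (h : ∀ p, (X : A⟦X⟧) ^ (p.1 + p.2) ∣ X ^ c * f p) : IsNull f := by
  intro N
  have : {p : ℕ × ℕ | ¬ (X : A⟦X⟧) ^ N ∣ f p} ⊆
      ((Finset.range (N + c) ×ˢ Finset.range (N + c) : Finset (ℕ × ℕ)) : Set (ℕ × ℕ)) := by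
    intro p hp
    by_contra hq
    apply hp
    have hN : N + c ≤ p.1 + p.2 := by
      simp only [Finset.coe_product, Set.mem_prod, Finset.coe_range, Set.mem_Iio] at hq
      omega
    have h2 := (pow_dvd_pow (X : A⟦X⟧) hN).trans (h p)
    rw [X_pow_dvd_iff] at h2 ⊢
    intro m hm
    have := h2 (m + c) (by omega)
    rwa [add_comm m c, coeff_X_pow_mul', if_pos (by omega), Nat.add_sub_cancel_left] at this
  exact (Finset.finite_toSet _).subset this

theorem eq_of_forall_X_pow_dvd {f g : A⟦X⟧} (h : ∀ N : ℕ, (X : A⟦X⟧) ^ N ∣ f - g) : f = g := by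
  ext n
  have := X_pow_dvd_iff.1 (h (n + 1)) n (by omega)
  rwa [map_sub, sub_eq_zero] at this

variable [TopologicalSpace A] [DiscreteTopology A]

theorem IsNull.summable {ι : Type*} {f : ι → A⟦X⟧} (hf : IsNull f) : Summable f := by
  rw [WithPiTopology.summable_iff_summable_coeff]
  intro d
  apply summable_of_hasFiniteSupport
  refine (hf (d + 1)).subset fun i hi hdvd => hi ?_
  exact X_pow_dvd_iff.1 hdvd d (by omega)

theorem coeff_tsum {ι : Type*} {f : ι → A⟦X⟧} (hf : Summable f) (d : ℕ) :
    coeff d (∑' i, f i) = ∑' i, coeff d (f i) :=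
  hf.map_tsum (coeff d).toAddMonoidHom (WithPiTopology.continuous_coeff A d)

theorem dvd_tsum {ι : Type*} {f : ι → A⟦X⟧} (hf : IsNull f) (N : ℕ)
    (h : ∀ i, (X : A⟦X⟧) ^ N ∣ f i) : (X : A⟦X⟧) ^ N ∣ ∑' i, f i := by
  rw [X_pow_dvd_iff]
  intro m hm
  rw [coeff_tsum hf.summable]
  simp [fun i => X_pow_dvd_iff.1 (h i) m hm]

theorem tendsto_iff_X_pow_dvd {f : ℕ → A⟦X⟧} {l : A⟦X⟧} :
    Tendsto f atTop (𝓝 l) ↔ ∀ N : ℕ, ∀ᶠ n in atTop, (X : A⟦X⟧) ^ N ∣ f n - l := by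
  rw [WithPiTopology.tendsto_iff_coeff_tendsto]
  simp only [nhds_discrete, tendsto_pure]
  constructor
  · intro h N
    have : ∀ᶠ n in atTop, ∀ d ∈ Finset.range N, coeff d (f n) = coeff d l :=
      (Finset.eventually_all _).2 fun d _ => h d
    filter_upwards [this] with n hn
    rw [X_pow_dvd_iff]
    intro m hm
    rw [map_sub, hn m (Finset.mem_range.2 hm), sub_self]
  · intro h d
    filter_upwards [h (d + 1)] with n hn
    have := X_pow_dvd_iff.1 hn d (by omega)
    rwa [map_sub, sub_eq_zero] at this

theorem continuous_map {B : Type*} [CommRing B] [TopologicalSpace B] [DiscreteTopology B]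
    (φ : A →+* B) : Continuous (PowerSeries.map φ) := by
  rw [continuous_iff_continuousAt]
  intro f
  rw [ContinuousAt, WithPiTopology.tendsto_iff_coeff_tendsto]
  intro d
  simp only [coeff_map]
  exact ((continuous_of_discreteTopology (f := φ)).comp
    (WithPiTopology.continuous_coeff A d)).tendsto f

/-- Telescoping of a pair of series against a convergent sequence. -/
theorem tsum_add_tsum_of_telescope {a b H : ℕ → A⟦X⟧} {h : A⟦X⟧} (ha : IsNull a) (hb : IsNull b)
    (h0 : a 0 = H 0) (hs : ∀ m, a (m + 1) + b m = H (m + 1) - H m)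
    (hH : Tendsto H atTop (𝓝 h)) : ∑' m, a m + ∑' m, b m = h := by
  have key : ∀ M, ∑ m ∈ Finset.range (M + 1), a m + ∑ m ∈ Finset.range M, b m = H M := by
    intro M
    induction M with
    | zero => simp [h0]
    | succ M ih =>
      rw [Finset.sum_range_succ a, Finset.sum_range_succ b]
      linear_combination ih + hs M
  have h1 := ((tendsto_add_atTop_iff_nat 1).2 ha.summable.hasSum.tendsto_sum_nat).add
    hb.summable.hasSum.tendsto_sum_nat
  simp only [key] at h1
  exact tendsto_nhds_unique h1 hH

/-- A double series summed by rows and by antidiagonals. -/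
theorem tsum_antidiagonal {f : ℕ × ℕ → A⟦X⟧} (hf : IsNull f) :
    ∑' n, ∑ p ∈ Finset.HasAntidiagonal.antidiagonal n, f p = ∑' r, ∑' m, f (r, m) := by
  have hs := hf.summable
  have h1 : ∑' p, f p = ∑' r, ∑' m, f (r, m) :=
    hs.tsum_prod' fun r => (hf.comp_injective (Prod.mk_right_injective r)).summable
  rw [← h1, ← Finset.HasAntidiagonal.sigmaAntidiagonalEquivProd.tsum_eq f]
  have hs2 : Summable fun x : Σ n : ℕ, Finset.HasAntidiagonal.antidiagonal n =>
      f (Finset.HasAntidiagonal.sigmaAntidiagonalEquivProd x) :=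
    Finset.HasAntidiagonal.sigmaAntidiagonalEquivProd.summable_iff.2 hs
  rw [hs2.tsum_sigma' fun n => (hasSum_fintype _).summable]
  congr 1
  ext1 n
  rw [tsum_fintype, ← Finset.sum_coe_sort]
  rfl

end Convergence

/-! ### Finite and infinite `q`-products. -/

section Pochhammer

variable {A : Type*} [CommRing A]

/-- The finite product `(a; b)_n`. -/
def poch (a b : A⟦X⟧) (n : ℕ) : A⟦X⟧ := ∏ j ∈ Finset.range n, (1 - a * b ^ j)

@[simp] theorem poch_zero (a b : A⟦X⟧) : poch a b 0 = 1 := by simp [poch]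

theorem poch_succ (a b : A⟦X⟧) (n : ℕ) : poch a b (n + 1) = poch a b n * (1 - a * b ^ n) := by
  simp [poch, Finset.prod_range_succ]

theorem map_poch {B : Type*} [CommRing B] (φ : A →+* B) (a b : A⟦X⟧) (n : ℕ) :
    PowerSeries.map φ (poch a b n) = poch (PowerSeries.map φ a) (PowerSeries.map φ b) n := by
  simp [poch, map_prod]

theorem isUnit_of_constantCoeff_eq_one {f : A⟦X⟧} (h : constantCoeff f = 1) : IsUnit f :=
  isUnit_iff_constantCoeff.2 (h ▸ isUnit_one)

theorem constantCoeff_poch {a : A⟦X⟧} (ha : X ∣ a) (b : A⟦X⟧) (n : ℕ) :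
    constantCoeff (poch a b n) = 1 := by
  simp [poch, map_prod, X_dvd_iff.1 ha]

theorem isUnit_poch {a : A⟦X⟧} (ha : X ∣ a) (b : A⟦X⟧) (n : ℕ) : IsUnit (poch a b n) :=
  isUnit_of_constantCoeff_eq_one (constantCoeff_poch ha b n)

theorem map_ringInverse {R S : Type*} [CommRing R] [CommRing S] (φ : R →+* S) {x : R}
    (hx : IsUnit x) : φ (Ring.inverse x) = Ring.inverse (φ x) := by
  obtain ⟨u, rfl⟩ := hx
  rw [Ring.inverse_unit]
  exact (Ring.inverse_unit (Units.map (φ : R →* S) u)).symm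

theorem ringInverse_eq_of_mul_eq_one {R : Type*} [CommRing R] {x y : R} (h : x * y = 1) :
    Ring.inverse x = y := by
  have hx : IsUnit x := IsUnit.of_mul_eq_one y h
  calc Ring.inverse x = Ring.inverse x * (x * y) := by rw [h, mul_one]
    _ = y := Ring.inverse_mul_cancel_left x y hx

variable [TopologicalSpace A] [DiscreteTopology A]

/-- The infinite product `(a; b)_∞`. -/
def pochInf (a b : A⟦X⟧) : A⟦X⟧ := ∏' j : ℕ, (1 - a * b ^ j)

theorem X_pow_dvd_mul_pow {b : A⟦X⟧} (hb : X ∣ b) (a : A⟦X⟧) (j : ℕ) : X ^ j ∣ a * b ^ j :=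
  (pow_dvd_pow_of_dvd hb j).mul_left a

theorem multipliable_pochInf (a : A⟦X⟧) {b : A⟦X⟧} (hb : X ∣ b) :
    Multipliable fun j : ℕ => 1 - a * b ^ j := by
  nontriviality A
  have : Multipliable (fun j : ℕ => 1 + -(a * b ^ j)) := by
    apply WithPiTopology.multipliable_one_add_of_tendsto_order_atTop_nhds_top
    rw [ENat.tendsto_nhds_top_iff_natCast_lt]
    intro n
    filter_upwards [eventually_gt_atTop n] with j hj
    rw [order_neg]
    calc (n : ℕ∞) < j := by exact_mod_cast hj
      _ ≤ (a * b ^ j).order :=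
          nat_le_order _ _ fun i hi => X_pow_dvd_iff.1 (X_pow_dvd_mul_pow hb a j) i hi
  simpa only [sub_eq_add_neg] using this

theorem tendsto_poch (a : A⟦X⟧) {b : A⟦X⟧} (hb : X ∣ b) :
    Tendsto (poch a b) atTop (𝓝 (pochInf a b)) :=
  (multipliable_pochInf a hb).hasProd.tendsto_prod_nat

theorem pochInf_eq_of_tendsto {a b l : A⟦X⟧} (hb : X ∣ b)
    (h : Tendsto (poch a b) atTop (𝓝 l)) : pochInf a b = l :=
  tendsto_nhds_unique (tendsto_poch a hb) h

theorem poch_add (a b : A⟦X⟧) (m n : ℕ) : poch a b (m + n) = poch a b m * poch (a * b ^ m) b n := by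
  simp only [poch, Finset.prod_range_add, pow_add, mul_assoc]

theorem poch_mul_pochInf (a : A⟦X⟧) {b : A⟦X⟧} (hb : X ∣ b) (n : ℕ) :
    poch a b n * pochInf (a * b ^ n) b = pochInf a b := by
  have h1 := (tendsto_poch (a * b ^ n) hb).const_mul (poch a b n)
  simp only [← poch_add] at h1
  have h2 : Tendsto (fun m => poch a b (n + m)) atTop (𝓝 (pochInf a b)) :=
    (tendsto_poch a hb).comp (tendsto_atTop_mono (fun m => Nat.le_add_left m n) tendsto_id)
  exact tendsto_nhds_unique h1 h2

theorem map_pochInf {B : Type*} [CommRing B] [TopologicalSpace B] [DiscreteTopology B]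
    (φ : A →+* B) (a : A⟦X⟧) {b : A⟦X⟧} (hb : X ∣ b) :
    PowerSeries.map φ (pochInf a b) = pochInf (PowerSeries.map φ a) (PowerSeries.map φ b) := by
  have hb' : X ∣ PowerSeries.map φ b := by simpa using map_dvd (PowerSeries.map φ) hb
  refine (pochInf_eq_of_tendsto hb' ?_).symm
  simpa only [Function.comp_def, map_poch] using
    ((continuous_map φ).tendsto _).comp (tendsto_poch a hb)

theorem constantCoeff_pochInf {a b : A⟦X⟧} (ha : X ∣ a) (hb : X ∣ b) :
    constantCoeff (pochInf a b) = 1 := by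
  have h := ((WithPiTopology.continuous_constantCoeff A).tendsto _).comp (tendsto_poch a hb)
  simp only [Function.comp_def, constantCoeff_poch ha] at h
  exact (tendsto_nhds_unique tendsto_const_nhds h).symm

theorem isUnit_pochInf {a b : A⟦X⟧} (ha : X ∣ a) (hb : X ∣ b) : IsUnit (pochInf a b) :=
  isUnit_of_constantCoeff_eq_one (constantCoeff_pochInf ha hb)

theorem pochInf_mul_pochInf_neg (a : A⟦X⟧) {b : A⟦X⟧} (hb : X ∣ b) :
    pochInf a b * pochInf (-a) b = pochInf (a ^ 2) (b ^ 2) := by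
  refine (pochInf_eq_of_tendsto (dvd_pow hb two_ne_zero) ?_).symm
  refine ((tendsto_poch a hb).mul (tendsto_poch (-a) hb)).congr fun n => ?_
  simp only [poch, ← Finset.prod_mul_distrib]
  exact Finset.prod_congr rfl fun j _ => by ring

theorem pochInf_mul_pochInf_mul (a : A⟦X⟧) {b : A⟦X⟧} (hb : X ∣ b) :
    pochInf a (b ^ 2) * pochInf (a * b) (b ^ 2) = pochInf a b := by
  have hb2 : X ∣ b ^ 2 := dvd_pow hb two_ne_zero
  have h1 := (tendsto_poch a hb2).mul (tendsto_poch (a * b) hb2)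
  have h2 : Tendsto (fun n => poch a b (2 * n)) atTop (𝓝 (pochInf a b)) :=
    (tendsto_poch a hb).comp (tendsto_id.const_mul_atTop' two_pos)
  refine tendsto_nhds_unique h1 (h2.congr fun n => ?_)
  induction n with
  | zero => simp
  | succ n ih =>
    rw [show 2 * (n + 1) = 2 * n + 1 + 1 by ring, poch_succ, poch_succ, ih, poch_succ, poch_succ]
    ring

end Pochhammer

/-! ### Finite Bailey expansion and finite Jacobi triple product. -/

section FiniteIdentities

variable {R : Type*} [CommRing R]

/-- The polynomials `(z ^ (r + 1) + z ^ (-r)) / (1 + z)` in terms of `s = z + z⁻¹`. -/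
def chi (s : R) : ℕ → R
  | 0 => 1
  | 1 => s - 1
  | (r + 2) => s * chi s (r + 1) - chi s r

/-- The sequence `i` shifted by one place and continued by `0`. -/
def shiftZero (i : ℕ → R) : ℕ → R
  | 0 => 0
  | (k + 1) => i k

/-- The coefficients `(-1) ^ r * (1 - Q ^ (2 * r + 1)) * Q ^ (r * (r - 1) / 2)`. -/
def bcoef (Q : R) (r : ℕ) : R := (-1) ^ r * (1 - Q ^ (2 * r + 1)) * Q ^ r.choose 2

/-- The products `∏_{k < n} (1 - s Q ^ k + Q ^ (2 * k))`, that is `(z, z⁻¹; Q)_n`. -/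
def symPoch (s Q : R) (n : ℕ) : R := ∏ k ∈ Finset.range n, (1 - s * Q ^ k + Q ^ (2 * k))

/-- With `i n = 1 / (Q; Q)_n`, the value `shiftZero i 0 = 0` plays the role of `1 / (Q; Q)_{-1}`.
The recurrence persists there because `1 - Q ^ 0 = 0`, so terms beyond the end of a sum vanish even
under truncated subtraction. -/
theorem shiftZero_eq {Q : R} {i : ℕ → R} (hi : ∀ n, i n = (1 - Q ^ (n + 1)) * i (n + 1)) (k : ℕ) :
    shiftZero i k = (1 - Q ^ k) * shiftZero i (k + 1) := by
  cases k with
  | zero => simp [shiftZero]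
  | succ k => exact hi k

theorem choose_succ_two (r : ℕ) : (r + 1).choose 2 = r + r.choose 2 := by
  rw [Nat.choose_succ_succ' r 1, Nat.choose_one_right]

/-- This compares the coefficients of `chi s (r + 1)` in the passage from `n = r + d` to `n + 1`.
The factor `1 - s Q ^ n + Q ^ (2 n)` shifts the index both ways through `s χ_{r+1} = χ_{r+2} + χ_r`.
-/
theorem symPoch_three_term {Q : R} {i : ℕ → R} (hi : ∀ n, i n = (1 - Q ^ (n + 1)) * i (n + 1))
    (r d : ℕ) :
    (1 - Q ^ (2 * (r + d) + 1)) * (1 - Q ^ (2 * (r + d) + 2)) * bcoef Q (r + 1)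
        * (shiftZero i (d + 1) * i (2 * r + d + 3))
      - (1 + Q ^ (2 * (r + d))) * bcoef Q (r + 1) * (shiftZero i d * i (2 * r + d + 2))
      + Q ^ (r + d) * (bcoef Q r * (shiftZero i (d + 1) * i (2 * r + d + 1))
        + bcoef Q (r + 2) * (shiftZero i (d - 1) * i (2 * r + d + 3))) = 0 := by
  have h1 := hi (2 * r + d + 2)
  have h2 := hi (2 * r + d + 1)
  rw [h2, h1]
  simp only [bcoef, choose_succ_two]
  cases d with
  | zero => simp [shiftZero]; ring
  | succ e =>
    rw [Nat.add_sub_cancel, shiftZero_eq hi e, shiftZero_eq hi (e + 1)]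
    ring

/-- Summation by parts: the interior coefficients cancel by `symPoch_three_term`, leaving only the
two terms in which multiplication by `s` crosses the cut at `r`. -/
theorem symPoch_partial_sum {Q : R} {i : ℕ → R} (hi : ∀ n, i n = (1 - Q ^ (n + 1)) * i (n + 1))
    (s : R) (n r : ℕ) (hr : r ≤ n + 1) :
    ∑ k ∈ Finset.range (r + 1),
        ((1 - Q ^ (2 * n + 1)) * (1 - Q ^ (2 * n + 2))
            * (bcoef Q k * chi s k * (shiftZero i (n + 2 - k) * i (n + k + 2)))
          - (1 - s * Q ^ n + Q ^ (2 * n))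
            * (bcoef Q k * chi s k * (shiftZero i (n + 1 - k) * i (n + k + 1))))
      = Q ^ n * (chi s (r + 1) * (bcoef Q r * (shiftZero i (n + 1 - r) * i (n + r + 1)))
          - chi s r * (bcoef Q (r + 1) * (shiftZero i (n - r) * i (n + r + 2)))) := by
  induction r with
  | zero =>
    rw [zero_add, Finset.sum_range_one]
    have h1 := hi (n + 1)
    have h2 := shiftZero_eq hi (n + 1)
    have h3 := shiftZero_eq hi n
    simp only [Nat.sub_zero, add_zero, bcoef, chi, h3, h2, h1, choose_succ_two]
    simp
    ring
  | succ r ih =>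
    obtain ⟨d, rfl⟩ : ∃ d, n = r + d := ⟨n - r, by omega⟩
    rw [Finset.sum_range_succ, ih (by omega)]
    have key := symPoch_three_term hi r d
    have e1 : r + d + 1 - r = d + 1 := by omega
    have e2 : r + d - r = d := by omega
    have e3 : r + d + 2 - (r + 1) = d + 1 := by omega
    have e4 : r + d + 1 - (r + 1) = d := by omega
    have e5 : r + d - (r + 1) = d - 1 := by omega
    have e6 : r + d + (r + 1) + 2 = 2 * r + d + 3 := by omega
    have e7 : r + d + (r + 1) + 1 = 2 * r + d + 2 := by omega
    have e8 : r + d + r + 1 = 2 * r + d + 1 := by omega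
    have e9 : r + d + r + 2 = 2 * r + d + 2 := by omega
    rw [e1, e2, e3, e4, e5, e6, e7, e8, e9]
    simp only [show r + 1 + 1 = r + 2 from rfl, chi]
    linear_combination chi s (r + 1) * key

/-- The finite expansion of `(z, z⁻¹; Q)_n / (Q; Q)_{2n}`. -/
theorem symPoch_expansion [IsDomain R] {Q : R} (hQ : ∀ n, 1 - Q ^ (n + 1) ≠ 0) {i : ℕ → R}
    (hi : ∀ n, i n = (1 - Q ^ (n + 1)) * i (n + 1)) (h0 : i 0 = 1) (s : R) (n : ℕ) :
    symPoch s Q n * i (2 * n)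
      = ∑ r ∈ Finset.range (n + 1),
          bcoef Q r * chi s r * (shiftZero i (n + 1 - r) * i (n + r + 1)) := by
  induction n with
  | zero =>
    have h1 := hi 0
    rw [h0] at h1
    simpa [symPoch, bcoef, chi, shiftZero, h0] using h1
  | succ n ih =>
    -- The cut `n + 1` lies one past the last term of level `n`. Both boundary terms there contain
    -- `shiftZero i 0 = 0`, so the recurrence in `n` is exact.
    have key := symPoch_partial_sum hi s n (n + 1) le_rfl
    rw [Nat.sub_self, show n - (n + 1) = 0 by omega, Finset.sum_sub_distrib, ← Finset.mul_sum,
      ← Finset.mul_sum, Finset.sum_range_succ (fun k => bcoef Q k * chi s k *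
        (shiftZero i (n + 1 - k) * i (n + k + 1))), ← ih, Nat.sub_self] at key
    have hz : shiftZero i 0 = 0 := rfl
    rw [hz] at key
    have hc : (1 - Q ^ (2 * n + 1)) * (1 - Q ^ (2 * n + 2)) ≠ 0 :=
      mul_ne_zero (hQ (2 * n)) (hQ (2 * n + 1))
    apply mul_left_cancel₀ hc
    have h1 := hi (2 * n)
    rw [hi (2 * n + 1)] at h1
    have e : ∀ r, n + 1 + r + 1 = n + r + 2 := fun r => by omega
    simp only [e, show n + 1 + 1 = n + 2 from rfl]
    rw [symPoch, Finset.prod_range_succ, ← symPoch, show 2 * (n + 1) = 2 * n + 2 by ring]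
    rw [h1] at key
    linear_combination -key

/-- `x ^ r + y ^ r`, except that the value at `0` is `1`. -/
def powSum (x y : R) : ℕ → R
  | 0 => 1
  | (r + 1) => x ^ (r + 1) + y ^ (r + 1)

/-- The analogue of `symPoch_three_term` for `(1 - x Q^n)(1 - y Q^n) = 1 - (x + y) Q^n + Q^(2n+1)`,
where `x y = Q` and `x ^ r + y ^ r` replaces `chi`. -/
theorem poch_mul_poch_three_term {Q : R} {i : ℕ → R}
    (hi : ∀ n, i n = (1 - Q ^ (n + 1)) * i (n + 1)) (r d : ℕ) :
    (1 - Q ^ (2 * (r + d) + 1)) * (1 - Q ^ (2 * (r + d) + 2))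
        * ((-1) ^ (r + 1) * Q ^ (r + 1).choose 2 * (shiftZero i (d + 1) * i (2 * r + d + 2)))
      - (1 + Q ^ (2 * (r + d) + 1))
        * ((-1) ^ (r + 1) * Q ^ (r + 1).choose 2 * (shiftZero i d * i (2 * r + d + 1)))
      + Q ^ (r + d) * ((-1) ^ r * Q ^ r.choose 2 * (shiftZero i (d + 1) * i (2 * r + d))
        + Q * ((-1) ^ (r + 2) * Q ^ (r + 2).choose 2
          * (shiftZero i (d - 1) * i (2 * r + d + 2)))) = 0 := by
  have h1 := hi (2 * r + d + 1)
  have h2 := hi (2 * r + d)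
  rw [h2, h1]
  simp only [choose_succ_two]
  cases d with
  | zero => simp [shiftZero]; ring
  | succ e =>
    rw [Nat.add_sub_cancel, shiftZero_eq hi e, shiftZero_eq hi (e + 1)]
    ring

/-- The boundary term has `x ^ r + y ^ r`, not `powSum x y r`: at `r = 0` the cross terms of `(x +
y)²` contribute `2 Q`, while the expansion itself counts the index `0` once. -/
theorem poch_mul_poch_partial_sum {x y Q : R} (hxy : x * y = Q) {i : ℕ → R}
    (hi : ∀ n, i n = (1 - Q ^ (n + 1)) * i (n + 1)) (n r : ℕ) (hr : r ≤ n + 1) :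
    ∑ k ∈ Finset.range (r + 1),
        ((1 - Q ^ (2 * n + 1)) * (1 - Q ^ (2 * n + 2))
            * (powSum x y k * ((-1) ^ k * Q ^ k.choose 2
              * (shiftZero i (n + 2 - k) * i (n + k + 1))))
          - (1 - x * Q ^ n) * (1 - y * Q ^ n)
            * (powSum x y k * ((-1) ^ k * Q ^ k.choose 2
              * (shiftZero i (n + 1 - k) * i (n + k)))))
      = Q ^ n * ((x ^ (r + 1) + y ^ (r + 1))
            * ((-1) ^ r * Q ^ r.choose 2 * (shiftZero i (n + 1 - r) * i (n + r)))
          - Q * (x ^ r + y ^ r) * ((-1) ^ (r + 1) * Q ^ (r + 1).choose 2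
            * (shiftZero i (n - r) * i (n + r + 1)))) := by
  induction r with
  | zero =>
    rw [zero_add, Finset.sum_range_one]
    have h1 := hi n
    have h2 := shiftZero_eq hi (n + 1)
    have h3 := shiftZero_eq hi n
    simp only [Nat.sub_zero, add_zero, powSum, h3, h2, h1, choose_succ_two]
    simp
    linear_combination (-Q ^ (2 * n) * (1 - Q ^ (n + 1)) * (1 - Q ^ (n + 1))
      * shiftZero i (n + 2) * i (n + 1)) * hxy
  | succ r ih =>
    obtain ⟨d, rfl⟩ : ∃ d, n = r + d := ⟨n - r, by omega⟩
    rw [Finset.sum_range_succ, ih (by omega)]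
    have key := poch_mul_poch_three_term hi r d
    have e1 : r + d + 1 - r = d + 1 := by omega
    have e2 : r + d - r = d := by omega
    have e3 : r + d + 2 - (r + 1) = d + 1 := by omega
    have e4 : r + d + 1 - (r + 1) = d := by omega
    have e5 : r + d - (r + 1) = d - 1 := by omega
    have e6 : r + d + (r + 1) + 1 = 2 * r + d + 2 := by omega
    have e7 : r + d + (r + 1) = 2 * r + d + 1 := by omega
    have e8 : r + d + r + 1 = 2 * r + d + 1 := by omega
    have e9 : r + d + r = 2 * r + d := by omega
    rw [e1, e2, e3, e4, e5, e6, e7, e8, e9]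
    simp only [show r + 1 + 1 = r + 2 from rfl, powSum]
    linear_combination (x ^ (r + 1) + y ^ (r + 1)) * key
      - ((-1) ^ (r + 1) * Q ^ (r + 1).choose 2 * (shiftZero i d * i (2 * r + d + 1)))
        * ((x ^ (r + 1) + y ^ (r + 1)) * Q ^ (2 * (r + d))
          - Q ^ (r + d) * (x ^ r + y ^ r)) * hxy

/-- The finite form of the Jacobi triple product. -/
theorem poch_mul_poch_expansion [IsDomain R] {x y Q : R} (hxy : x * y = Q)
    (hQ : ∀ n, 1 - Q ^ (n + 1) ≠ 0) {i : ℕ → R}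
    (hi : ∀ n, i n = (1 - Q ^ (n + 1)) * i (n + 1)) (h0 : i 0 = 1) (n : ℕ) :
    (∏ k ∈ Finset.range n, (1 - x * Q ^ k) * (1 - y * Q ^ k)) * i (2 * n)
      = ∑ r ∈ Finset.range (n + 1),
          powSum x y r * ((-1) ^ r * Q ^ r.choose 2 * (shiftZero i (n + 1 - r) * i (n + r))) := by
  induction n with
  | zero => simp [powSum, shiftZero, h0]
  | succ n ih =>
    have key := poch_mul_poch_partial_sum hxy hi n (n + 1) le_rfl
    rw [Nat.sub_self, show n - (n + 1) = 0 by omega, Finset.sum_sub_distrib, ← Finset.mul_sum,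
      ← Finset.mul_sum, Finset.sum_range_succ (fun k => powSum x y k *
        ((-1) ^ k * Q ^ k.choose 2 * (shiftZero i (n + 1 - k) * i (n + k)))), ← ih,
      Nat.sub_self] at key
    have hz : shiftZero i 0 = 0 := rfl
    rw [hz] at key
    have hc : (1 - Q ^ (2 * n + 1)) * (1 - Q ^ (2 * n + 2)) ≠ 0 :=
      mul_ne_zero (hQ (2 * n)) (hQ (2 * n + 1))
    apply mul_left_cancel₀ hc
    have h1 := hi (2 * n)
    rw [hi (2 * n + 1)] at h1
    have e : ∀ r, n + 1 + r = n + r + 1 := fun r => by omega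
    simp only [e, show n + 1 + 1 = n + 2 from rfl]
    rw [Finset.prod_range_succ, show 2 * (n + 1) = 2 * n + 2 by ring]
    rw [h1] at key
    linear_combination -key

end FiniteIdentities

/-! ### Bailey's transform, the triple product and Euler's identity. -/

section InfiniteIdentities

variable {A : Type*} [CommRing A]

/-- The reciprocals `1 / (Q; Q)_n`. -/
def ipoch (Q : A⟦X⟧) (n : ℕ) : A⟦X⟧ := Ring.inverse (poch Q Q n)

theorem isUnit_one_sub_pow {Q : A⟦X⟧} (hQ : X ∣ Q) (n : ℕ) : IsUnit (1 - Q ^ (n + 1)) :=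
  isUnit_of_constantCoeff_eq_one (by simp [X_dvd_iff.1 hQ])

theorem ipoch_zero (Q : A⟦X⟧) : ipoch Q 0 = 1 := by simp [ipoch]

theorem poch_mul_ipoch {Q : A⟦X⟧} (hQ : X ∣ Q) (n : ℕ) : poch Q Q n * ipoch Q n = 1 :=
  Ring.mul_inverse_cancel _ (isUnit_poch hQ Q n)

theorem ipoch_eq {Q : A⟦X⟧} (hQ : X ∣ Q) (n : ℕ) :
    ipoch Q n = (1 - Q ^ (n + 1)) * ipoch Q (n + 1) := by
  have h1 := poch_mul_ipoch hQ n
  have h2 := poch_mul_ipoch hQ (n + 1)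
  rw [poch_succ] at h2
  linear_combination ((1 - Q ^ (n + 1)) * ipoch Q (n + 1)) * h1 - ipoch Q n * h2

variable [TopologicalSpace A] [DiscreteTopology A]

/-- The reciprocal `1 / (Q; Q)_∞`. -/
def ipochInf (Q : A⟦X⟧) : A⟦X⟧ := Ring.inverse (pochInf Q Q)

theorem pochInf_mul_ipochInf {Q : A⟦X⟧} (hQ : X ∣ Q) : pochInf Q Q * ipochInf Q = 1 :=
  Ring.mul_inverse_cancel _ (isUnit_pochInf hQ hQ)

theorem X_pow_dvd_of_tendsto {f : ℕ → A⟦X⟧} {l : A⟦X⟧} (h : Tendsto f atTop (𝓝 l)) {N : ℕ}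
    (hf : ∀ n, (X : A⟦X⟧) ^ N ∣ f n) : (X : A⟦X⟧) ^ N ∣ l := by
  obtain ⟨n, hn⟩ := (tendsto_iff_X_pow_dvd.1 h N).exists
  exact (dvd_sub_right (hf n)).1 hn

theorem X_pow_dvd_pochInf_sub_one {a b : A⟦X⟧} (hb : X ∣ b) {N : ℕ} (ha : X ^ N ∣ a) :
    X ^ N ∣ pochInf a b - 1 := by
  refine X_pow_dvd_of_tendsto ((tendsto_poch a hb).sub_const 1) fun n => ?_
  induction n with
  | zero => simp
  | succ n ih =>
    rw [poch_succ]
    convert ih.sub (ha.mul_left (poch a b n * b ^ n)) using 1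
    ring

theorem X_pow_dvd_ipoch_sub {Q : A⟦X⟧} (hQ : X ∣ Q) (n : ℕ) :
    X ^ n ∣ ipoch Q n - ipochInf Q := by
  have h1 := poch_mul_pochInf Q hQ n
  have h2 := pochInf_mul_ipochInf hQ
  have h3 := poch_mul_ipoch hQ n
  have h4 : ipoch Q n - ipochInf Q = ipochInf Q * (pochInf (Q * Q ^ n) Q - 1) := by
    linear_combination -ipoch Q n * h2 - ipoch Q n * ipochInf Q * h1
      + ipochInf Q * pochInf (Q * Q ^ n) Q * h3
  rw [h4]
  exact (X_pow_dvd_pochInf_sub_one hQ (X_pow_dvd_mul_pow hQ Q n)).mul_left _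

theorem tendsto_ipoch {Q : A⟦X⟧} (hQ : X ∣ Q) :
    Tendsto (ipoch Q) atTop (𝓝 (ipochInf Q)) := by
  rw [tendsto_iff_X_pow_dvd]
  intro N
  filter_upwards [eventually_ge_atTop N] with n hn
  exact (pow_dvd_pow X hn).trans (X_pow_dvd_ipoch_sub hQ n)

/-- The value `s = 2` is the case `z = z⁻¹ = 1`. The products `symPoch` then vanish for positive
index, which is what lets `tsum_symPoch` discard the term `n = 0`. -/
theorem chi_two (r : ℕ) : chi (2 : A⟦X⟧) r = 1 := by
  induction r using Nat.twoStepInduction with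
  | zero => rfl
  | one => simp only [chi]; ring
  | more r h1 h2 => simp only [chi, h1, h2]; ring

theorem symPoch_two_succ (Q : A⟦X⟧) (n : ℕ) : symPoch 2 Q (n + 1) = 0 := by
  rw [symPoch, Finset.prod_range_succ']
  simp only [pow_zero, mul_zero]
  ring

variable [IsDomain A]

theorem isNull_of_X_pow_dvd_X_mul {f : ℕ → A⟦X⟧} (h : ∀ n, X ^ n ∣ X * f n) : IsNull f := by
  intro N
  rw [Nat.cofinite_eq_atTop]
  filter_upwards [eventually_ge_atTop (N + 1)] with m hm
  have h := (pow_dvd_pow (X : A⟦X⟧) hm).trans (h m)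
  rw [pow_succ'] at h
  exact (mul_dvd_mul_iff_left X_ne_zero).1 h

/-- Bailey's transform for the pair with `β_n = (z, z⁻¹; Q)_n / (Q; Q)_{2n}`. -/
theorem tsum_symPoch {Q : A⟦X⟧} (hQ : X ∣ Q) (s : A⟦X⟧) (δ : ℕ → A⟦X⟧)
    (hδ : ∀ n, X ^ n ∣ X * δ n) :
    ∑' n, symPoch s Q (n + 1) * (δ (n + 1) * ipoch Q (2 * (n + 1)))
      = ∑' r, bcoef Q r * (chi s r - 1)
          * ∑' m, δ (r + m) * (ipoch Q m * ipoch Q (m + 2 * r + 1)) := by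
  obtain ⟨f, hf⟩ : ∃ f : ℕ × ℕ → A⟦X⟧, ∀ p, f p = bcoef Q p.1 * (chi s p.1 - 1)
    * (δ (p.1 + p.2) * (ipoch Q p.2 * ipoch Q (p.2 + 2 * p.1 + 1))) := ⟨_, fun _ => rfl⟩
  have hnull : IsNull f := by
    refine isNull_prod_of_dvd 1 fun p => ?_
    convert (hδ (p.1 + p.2)).mul_left (bcoef Q p.1 * (chi s p.1 - 1)
      * (ipoch Q p.2 * ipoch Q (p.2 + 2 * p.1 + 1))) using 1
    simp only [hf]
    ring
  have hδ0 : IsNull δ := isNull_of_X_pow_dvd_X_mul hδ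
  have hrow : ∀ r, IsNull fun m => δ (r + m) * (ipoch Q m * ipoch Q (m + 2 * r + 1)) := by
    intro r
    exact (hδ0.comp_injective (add_right_injective r)).mul_right _
  have hne : ∀ n, 1 - Q ^ (n + 1) ≠ 0 := fun n => (isUnit_one_sub_pow hQ n).ne_zero
  have hexp := fun t => symPoch_expansion hne (ipoch_eq hQ) (ipoch_zero Q) t
  -- Each antidiagonal is the finite expansion at `s` minus the one at `2`. The difference vanishes
  -- for `n = 0`, and for `n ≥ 1` the subtracted part is zero.
  have hdiag : ∀ n, ∑ p ∈ Finset.HasAntidiagonal.antidiagonal n, f p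
      = δ n * ipoch Q (2 * n) * (symPoch s Q n - symPoch 2 Q n) := by
    intro n
    rw [Finset.Nat.sum_antidiagonal_eq_sum_range_succ_mk]
    have h1 := hexp s n
    have h2 := hexp 2 n
    have h3 : δ n * ipoch Q (2 * n) * (symPoch s Q n - symPoch 2 Q n)
        = δ n * (symPoch s Q n * ipoch Q (2 * n) - symPoch 2 Q n * ipoch Q (2 * n)) := by ring
    rw [h3, h1, h2, ← Finset.sum_sub_distrib, Finset.mul_sum]
    refine Finset.sum_congr rfl fun r hr => ?_
    have hr' : r ≤ n := by have := Finset.mem_range.1 hr; omega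
    obtain ⟨m, rfl⟩ := Nat.exists_eq_add_of_le hr'
    simp only [hf, chi_two, Nat.add_sub_cancel_left, show r + m + 1 - r = m + 1 by omega,
      shiftZero, show r + m + r + 1 = m + 2 * r + 1 by omega]
    ring
  have key := tsum_antidiagonal hnull
  simp only [hdiag] at key
  have hs : Summable fun n => δ n * ipoch Q (2 * n) * (symPoch s Q n - symPoch 2 Q n) := by
    exact ((hδ0.mul_right _).mul_right _).summable
  rw [hs.tsum_eq_zero_add] at key
  simp only [symPoch_two_succ, sub_zero] at key
  have hz : symPoch s Q 0 - symPoch 2 Q 0 = 0 := by simp [symPoch]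
  rw [hz, mul_zero, zero_add] at key
  calc _ = ∑' n, δ (n + 1) * ipoch Q (2 * (n + 1)) * symPoch s Q (n + 1) :=
        tsum_congr fun n => by ring
    _ = ∑' r, ∑' m, f (r, m) := key
    _ = _ := tsum_congr fun r => by
        simp only [hf]
        exact (hrow r).summable.tsum_mul_left _

theorem le_choose_two (r : ℕ) : r ≤ r.choose 2 + 1 := by
  induction r with
  | zero => simp
  | succ r ih =>
    rw [choose_succ_two]
    rcases r with _ | r
    · simp
    · omega

theorem isNull_pow_choose_two {Q : A⟦X⟧} (hQ : X ∣ Q) : IsNull fun r : ℕ => Q ^ r.choose 2 :=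
  isNull_of_dvd (fun r => r.choose 2) 1 le_choose_two fun _ => pow_dvd_pow_of_dvd hQ _

/-- The Jacobi triple product. -/
theorem jacobi_triple_product {x y Q : A⟦X⟧} (hQ : X ∣ Q) (hxy : x * y = Q) :
    pochInf x Q * pochInf y Q * pochInf Q Q
      = ∑' j : ℕ, (-1) ^ j * x ^ j * Q ^ j.choose 2
        + ∑' j : ℕ, (-1) ^ (j + 1) * y ^ (j + 1) * Q ^ (j + 1).choose 2 := by
  have hne : ∀ n, 1 - Q ^ (n + 1) ≠ 0 := fun n => (isUnit_one_sub_pow hQ n).ne_zero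
  set I := ipochInf Q with hI
  set c : ℕ → A⟦X⟧ := fun r => powSum x y r * ((-1) ^ r * Q ^ r.choose 2) with hc
  have hcn : IsNull c := by
    have h := (isNull_pow_choose_two hQ).mul_left fun r => powSum x y r * (-1) ^ r
    simpa only [hc, mul_assoc] using h
  have hdvd : ∀ r, X ^ r ∣ X * c r := by
    intro r
    have h1 : (X : A⟦X⟧) ^ (1 + r.choose 2) ∣ X * Q ^ r.choose 2 := by
      rw [pow_add, pow_one]
      exact mul_dvd_mul_left _ (pow_dvd_pow_of_dvd hQ _)
    convert ((pow_dvd_pow (X : A⟦X⟧) (show r ≤ 1 + r.choose 2 by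
      have := le_choose_two r; omega)).trans h1).mul_left (powSum x y r * (-1) ^ r) using 1
    simp only [hc]
    ring
  set B : ℕ → A⟦X⟧ := fun n => poch x Q n * poch y Q n * ipoch Q (2 * n) with hB
  have hBt : Tendsto B atTop (𝓝 (pochInf x Q * pochInf y Q * I)) :=
    ((tendsto_poch x hQ).mul (tendsto_poch y hQ)).mul
      ((tendsto_ipoch hQ).comp (tendsto_id.const_mul_atTop' two_pos))
  -- Uniformity in `r` of the limit `n → ∞`. For `r ≤ n`, `X * c r` contributes `X ^ r` and the
  -- convergence of the reciprocals contributes `X ^ (n - r)`; for `r > n`, `X * c r` suffices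
  -- alone.
  have hterm : ∀ n r, X ^ n ∣ X * (c r * (shiftZero (ipoch Q) (n + 1 - r) * ipoch Q (n + r)
      - I ^ 2)) := by
    intro n r
    rcases le_or_gt r n with hr | hr
    · obtain ⟨m, rfl⟩ := Nat.exists_eq_add_of_le hr
      rw [show r + m + 1 - r = m + 1 by omega, shiftZero, ← mul_assoc, pow_add]
      refine mul_dvd_mul (hdvd r) ?_
      have h1 := X_pow_dvd_ipoch_sub hQ m
      have h2 := (pow_dvd_pow X (show m ≤ r + m + r by omega)).trans
        (X_pow_dvd_ipoch_sub hQ (r + m + r))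
      convert (h1.mul_right (ipoch Q (r + m + r))).add (h2.mul_left I) using 1
      ring
    · rw [← mul_assoc]
      exact ((pow_dvd_pow X hr.le).trans (hdvd r)).mul_right _
  have hBe : ∀ n, B n - ∑' r, c r * I ^ 2
      = ∑' r, c r * (shiftZero (ipoch Q) (n + 1 - r) * ipoch Q (n + r) - I ^ 2) := by
    intro n
    have h1 : B n = ∑' r, c r * (shiftZero (ipoch Q) (n + 1 - r) * ipoch Q (n + r)) := by
      rw [tsum_eq_sum (s := Finset.range (n + 1))]
      · have := poch_mul_poch_expansion hxy hne (ipoch_eq hQ) (ipoch_zero Q) n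
        rw [Finset.prod_mul_distrib] at this
        simp only [hB, poch]
        rw [this]
        simp only [hc, mul_assoc]
      · intro r hr
        rw [Finset.mem_range] at hr
        rw [show n + 1 - r = 0 by omega, shiftZero]
        ring
    rw [h1, ← (hcn.mul_right _).summable.tsum_sub (hcn.mul_right _).summable]
    exact tsum_congr fun r => by ring
  have hlim : Tendsto B atTop (𝓝 (∑' r, c r * I ^ 2)) := by
    rw [tendsto_iff_X_pow_dvd]
    intro N
    filter_upwards [eventually_ge_atTop (N + 1)] with n hn
    rw [hBe]
    refine dvd_tsum (hcn.mul_right _) N fun r => ?_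
    have := (pow_dvd_pow X hn).trans (hterm n r)
    rw [pow_succ'] at this
    exact (mul_dvd_mul_iff_left X_ne_zero).1 this
  have heq := tendsto_nhds_unique hBt hlim
  rw [hcn.summable.tsum_mul_right] at heq
  have hinv := pochInf_mul_ipochInf hQ
  rw [← hI] at hinv
  have hsum : pochInf x Q * pochInf y Q * pochInf Q Q = ∑' r, c r := by
    linear_combination pochInf Q Q ^ 2 * heq
      - (pochInf x Q * pochInf y Q * pochInf Q Q) * hinv
      + (∑' r, c r) * (1 + pochInf Q Q * I) * hinv
  rw [hsum, hcn.summable.tsum_eq_zero_add]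
  have hx : IsNull fun j : ℕ => (-1) ^ j * x ^ j * Q ^ j.choose 2 :=
    (isNull_pow_choose_two hQ).mul_left _
  have hy : IsNull fun j : ℕ => (-1) ^ (j + 1) * y ^ (j + 1) * Q ^ (j + 1).choose 2 :=
    ((isNull_pow_choose_two hQ).comp_injective (add_left_injective 1)).mul_left _
  rw [hx.summable.tsum_eq_zero_add, add_assoc,
    ← (hx.comp_injective (add_left_injective 1)).summable.tsum_add hy.summable]
  congr 1
  · simp [hc, powSum]
  · refine tsum_congr fun r => ?_
    simp only [hc, powSum]
    ring

/-- Euler's identity `∑ a ^ m / (Q; Q)_m = 1 / (a; Q)_∞`. -/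
theorem pochInf_mul_tsum_pow_mul_ipoch {a Q : A⟦X⟧} (ha : X ∣ a) (hQ : X ∣ Q) :
    pochInf a Q * ∑' m, a ^ m * ipoch Q m = 1 := by
  have hnull : ∀ b : A⟦X⟧, X ∣ b → IsNull fun m => b ^ m * ipoch Q m := fun b hb =>
    (isNull_of_dvd (f := fun m => b ^ m) id 0 (fun _ => le_rfl)
      fun m => pow_dvd_pow_of_dvd hb m).mul_right _
  -- Write `F(b)` for the series. Since `(1 - Q^(m+1)) / (Q; Q)_{m+1} = 1 / (Q; Q)_m`, it satisfies
  -- `F(b) - F(bQ) = b F(b)`. Iteration moves the argument to `0`, where `F = 1`.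
  have hstep : ∀ b : A⟦X⟧, X ∣ b →
      (1 - b) * ∑' m, b ^ m * ipoch Q m = ∑' m, (b * Q) ^ m * ipoch Q m := by
    intro b hb
    have h1 := (hnull b hb).summable.tsum_eq_zero_add
    have h2 := (hnull (b * Q) (hb.mul_right Q)).summable.tsum_eq_zero_add
    have h3 : ∑' m, b ^ (m + 1) * ipoch Q (m + 1) - ∑' m, (b * Q) ^ (m + 1) * ipoch Q (m + 1)
        = b * ∑' m, b ^ m * ipoch Q m := by
      rw [← ((hnull b hb).comp_injective (add_left_injective 1)).summable.tsum_sub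
        ((hnull (b * Q) (hb.mul_right Q)).comp_injective (add_left_injective 1)).summable,
        ← (hnull b hb).summable.tsum_mul_left]
      refine tsum_congr fun m => ?_
      rw [ipoch_eq hQ m]
      ring
    linear_combination h1 - h2 + h3
  have hiter : ∀ n, poch a Q n * ∑' m, a ^ m * ipoch Q m
      = ∑' m, (a * Q ^ n) ^ m * ipoch Q m := by
    intro n
    induction n with
    | zero => simp
    | succ n ih =>
      rw [poch_succ, mul_right_comm, ih, mul_comm, hstep _ (ha.mul_right _)]
      simp only [pow_succ, mul_assoc]
  have h1 : Tendsto (fun n => poch a Q n * ∑' m, a ^ m * ipoch Q m) atTop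
      (𝓝 (pochInf a Q * ∑' m, a ^ m * ipoch Q m)) := (tendsto_poch a hQ).mul_const _
  refine tendsto_nhds_unique h1 ?_
  rw [tendsto_iff_X_pow_dvd]
  intro N
  filter_upwards [eventually_ge_atTop N] with n hn
  have hb : X ∣ a * Q ^ n := ha.mul_right _
  rw [hiter, (hnull _ hb).summable.tsum_eq_zero_add]
  simp only [pow_zero, ipoch_zero, mul_one, add_sub_cancel_left]
  refine dvd_tsum ((hnull _ hb).comp_injective (add_left_injective 1)) N fun m => ?_
  have : X ^ N ∣ a * Q ^ n := (pow_dvd_pow X hn).trans (X_pow_dvd_mul_pow hQ a n)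
  exact (this.trans (dvd_pow_self _ (Nat.succ_ne_zero m))).mul_right _

end InfiniteIdentities

/-! ### Residue classes of exponents. -/

section Support

variable {A : Type*} [CommRing A] {t : ℕ}

/-- The exponents of the nonzero terms of `f` lie in the residue classes `S` modulo `t`. -/
def ResSupp (S : Finset (ZMod t)) (f : A⟦X⟧) : Prop :=
  ∀ n : ℕ, (n : ZMod t) ∉ S → coeff n f = 0

theorem ResSupp.mono {S T : Finset (ZMod t)} {f : A⟦X⟧} (hf : ResSupp S f) (h : S ⊆ T) :
    ResSupp T f := fun n hn => hf n fun hS => hn (h hS)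

theorem ResSupp.add {S : Finset (ZMod t)} {f g : A⟦X⟧} (hf : ResSupp S f) (hg : ResSupp S g) :
    ResSupp S (f + g) := fun n hn => by rw [map_add, hf n hn, hg n hn, add_zero]

theorem ResSupp.sub {S : Finset (ZMod t)} {f g : A⟦X⟧} (hf : ResSupp S f) (hg : ResSupp S g) :
    ResSupp S (f - g) := fun n hn => by rw [map_sub, hf n hn, hg n hn, sub_zero]

theorem resSupp_zero (S : Finset (ZMod t)) : ResSupp S (0 : A⟦X⟧) := fun _ _ => map_zero _

theorem resSupp_X_pow {S : Finset (ZMod t)} {e : ℕ} (he : (e : ZMod t) ∈ S) :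
    ResSupp S (X ^ e : A⟦X⟧) := by
  intro n hn
  rw [coeff_X_pow, if_neg]
  rintro rfl
  exact hn he

theorem ResSupp.C_mul {S : Finset (ZMod t)} {f : A⟦X⟧} (hf : ResSupp S f) (a : A) :
    ResSupp S (C a * f) := fun n hn => by rw [coeff_C_mul, hf n hn, mul_zero]

theorem ResSupp.neg_one_pow_mul {S : Finset (ZMod t)} {f : A⟦X⟧} (hf : ResSupp S f) (r : ℕ) :
    ResSupp S ((-1) ^ r * f) := by
  have := hf.C_mul ((-1) ^ r)
  simpa using this

theorem ResSupp.mul {S T U : Finset (ZMod t)} {f g : A⟦X⟧} (hf : ResSupp S f) (hg : ResSupp T g)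
    (h : ∀ a ∈ S, ∀ b ∈ T, a + b ∈ U) : ResSupp U (f * g) := by
  intro n hn
  rw [coeff_mul]
  refine Finset.sum_eq_zero fun p hp => ?_
  rw [Finset.HasAntidiagonal.mem_antidiagonal] at hp
  by_cases h1 : (p.1 : ZMod t) ∈ S
  · by_cases h2 : (p.2 : ZMod t) ∈ T
    · exact absurd (by rw [← hp, Nat.cast_add]; exact h _ h1 _ h2) hn
    · rw [hg _ h2, mul_zero]
  · rw [hf _ h1, zero_mul]

/-- Division by a unit series in `q ^ t` does not mix residue classes: solving for the `n`-th
coefficient of `f` involves only earlier coefficients in the same class. -/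
theorem ResSupp.of_mul_eq {S : Finset (ZMod t)} {f g h : A⟦X⟧} (hfg : f * g = h)
    (hg : ResSupp ({0} : Finset (ZMod t)) g) (hg1 : constantCoeff g = 1) (hh : ResSupp S h) :
    ResSupp S f := by
  intro n
  induction n using Nat.strong_induction_on with
  | _ n ih =>
    intro hn
    have h1 := hh n hn
    rw [← hfg, coeff_mul, Finset.sum_eq_single (n, 0)] at h1
    · simpa [hg1] using h1
    · rintro ⟨i, j⟩ hp hne
      rw [Finset.HasAntidiagonal.mem_antidiagonal] at hp
      simp only at hp ⊢
      by_cases hj : (j : ZMod t) = 0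
      · have hij : (i : ZMod t) = n := by rw [← hp, Nat.cast_add, hj, add_zero]
        have hj0 : j ≠ 0 := by
          rintro rfl
          exact hne (by simp [← hp])
        rw [ih i (by omega) (hij ▸ hn), zero_mul]
      · rw [hg j (by simpa using hj), mul_zero]
    · simp

variable [TopologicalSpace A] [DiscreteTopology A]

theorem ResSupp.of_tendsto {S : Finset (ZMod t)} {f : ℕ → A⟦X⟧} {l : A⟦X⟧}
    (h : Tendsto f atTop (𝓝 l)) (hf : ∀ n, ResSupp S (f n)) : ResSupp S l := by
  intro n hn
  obtain ⟨k, hk⟩ := (tendsto_iff_X_pow_dvd.1 h (n + 1)).exists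
  have := X_pow_dvd_iff.1 hk n (by omega)
  rw [map_sub, hf k n hn, zero_sub, neg_eq_zero] at this
  exact this

theorem resSupp_tsum {S : Finset (ZMod t)} {ι : Type*} {f : ι → A⟦X⟧} (hn : IsNull f)
    (hf : ∀ i, ResSupp S (f i)) : ResSupp S (∑' i, f i) := by
  intro n h
  rw [coeff_tsum hn.summable]
  simp [fun i => hf i n h]

theorem resSupp_one : ResSupp ({0} : Finset (ZMod t)) (1 : A⟦X⟧) := by
  simpa using resSupp_X_pow (A := A) (S := ({0} : Finset (ZMod t))) (e := 0) (by simp)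

theorem resSupp_pochInf {a b : A⟦X⟧} (hb : X ∣ b) (ha0 : ResSupp ({0} : Finset (ZMod t)) a)
    (hb0 : ResSupp ({0} : Finset (ZMod t)) b) :
    ResSupp ({0} : Finset (ZMod t)) (pochInf a b) := by
  have hmul : ∀ {f g : A⟦X⟧}, ResSupp ({0} : Finset (ZMod t)) f → ResSupp ({0} : Finset (ZMod t)) g →
      ResSupp ({0} : Finset (ZMod t)) (f * g) := fun hf hg => hf.mul hg (by simp)
  have hpow : ∀ j, ResSupp ({0} : Finset (ZMod t)) (b ^ j) := by
    intro j
    induction j with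
    | zero => simpa using resSupp_one
    | succ j ih => rw [pow_succ]; exact hmul ih hb0
  refine ResSupp.of_tendsto (tendsto_poch a hb) fun n => ?_
  induction n with
  | zero => simpa using resSupp_one
  | succ n ih => rw [poch_succ]; exact hmul ih (resSupp_one.sub (hmul ha0 (hpow n)))

theorem resSupp_pochInf_X_pow {a b : ℕ} (hb : b ≠ 0) (hta : t ∣ a) (htb : t ∣ b) :
    ResSupp ({0} : Finset (ZMod t)) (pochInf (X ^ a) (X ^ b) : A⟦X⟧) :=
  resSupp_pochInf (dvd_pow_self X hb)
    (resSupp_X_pow (by simpa using (ZMod.natCast_eq_zero_iff a t).2 hta))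
    (resSupp_X_pow (by simpa using (ZMod.natCast_eq_zero_iff b t).2 htb))

end Support

/-! ### Specialization to third and fifth roots of unity. -/

section RootsOfUnity

variable {A : Type*} [CommRing A]

theorem symPoch_eq {z w : A} (h : z * w = 1) (Q : A⟦X⟧) (n : ℕ) :
    symPoch (C (z + w)) Q n = poch (C z) Q n * poch (C w) Q n := by
  rw [symPoch, poch, poch, ← Finset.prod_mul_distrib]
  refine Finset.prod_congr rfl fun k _ => ?_
  have h' : (C z : A⟦X⟧) * C w = 1 := by rw [← map_mul, h, map_one]
  rw [map_add]
  linear_combination (-Q ^ (2 * k)) * h'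

theorem map_chi {B : Type*} [CommRing B] (φ : A →+* B) (s : A) (r : ℕ) :
    φ (chi s r) = chi (φ s) r := by
  induction r using Nat.twoStepInduction with
  | zero => simp [chi]
  | one => simp [chi]
  | more r h1 h2 => simp only [chi, map_sub, map_mul, h1, h2]

theorem chi_neg_one (m : ℕ) :
    chi (-1 : A) (3 * m) = 1 ∧ chi (-1 : A) (3 * m + 1) = -2 ∧ chi (-1 : A) (3 * m + 2) = 1 := by
  have h2 : ∀ r, chi (-1 : A) r = 1 → chi (-1 : A) (r + 1) = -2 →
      chi (-1 : A) (r + 2) = 1 ∧ chi (-1 : A) (r + 3) = 1 ∧ chi (-1 : A) (r + 4) = -2 := by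
    intro r h0 h1
    have e2 : chi (-1 : A) (r + 2) = 1 := by rw [chi, h0, h1]; ring
    have e3 : chi (-1 : A) (r + 3) = 1 := by
      rw [show r + 3 = r + 1 + 2 from rfl, chi, show r + 1 + 1 = r + 2 from rfl, e2, h1]; ring
    refine ⟨e2, e3, ?_⟩
    rw [show r + 4 = r + 2 + 2 from rfl, chi, show r + 2 + 1 = r + 3 from rfl, e3, e2]; ring
  induction m with
  | zero =>
    have h1 : chi (-1 : A) (0 + 1) = -2 := by simp only [chi]; ring
    exact ⟨rfl, h1, (h2 0 rfl h1).1⟩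
  | succ m ih =>
    obtain ⟨-, a3, a4⟩ := h2 _ ih.1 ih.2.1
    exact ⟨a3, a4, (h2 (3 * m + 3) a3 a4).1⟩

/-- For a primitive cube root of unity `s = -1`, and the recurrence has period `3`. A single class
of `r` survives in the Bailey sum, which is the source of all the congruences modulo `3`. -/
theorem chi_neg_one_sub_one (r : ℕ) : chi (-1 : A) r - 1 = if r % 3 = 1 then -3 else 0 := by
  obtain ⟨h0, h1, h2⟩ := chi_neg_one (A := A) (r / 3)
  have hr := Nat.div_add_mod r 3
  have hlt := Nat.mod_lt r (show 3 > 0 by norm_num)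
  rw [← hr]
  generalize r % 3 = e at *
  generalize r / 3 = m at *
  interval_cases e
  · simp [h0]
  · rw [h1, if_pos (by omega)]; norm_num
  · rw [h2, if_neg (by omega)]; norm_num

/-- The equation `s² + s = 1` holds for `s = ζ + ζ⁻¹` with `ζ` a primitive fifth root of unity. Five
steps of the recurrence return the pair `(1, s - 1)`, hence period `5`. -/
theorem chi_five {s : A} (hs : s ^ 2 + s = 1) (m : ℕ) :
    chi s (5 * m) = 1 ∧ chi s (5 * m + 1) = s - 1 ∧ chi s (5 * m + 2) = -2 * s ∧
      chi s (5 * m + 3) = s - 1 ∧ chi s (5 * m + 4) = 1 := by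
  have h2 : ∀ r, chi s r = 1 → chi s (r + 1) = s - 1 →
      chi s (r + 2) = -2 * s ∧ chi s (r + 3) = s - 1 ∧ chi s (r + 4) = 1 ∧
        chi s (r + 5) = 1 ∧ chi s (r + 6) = s - 1 := by
    intro r h0 h1
    have e2 : chi s (r + 2) = -2 * s := by
      rw [chi, h0, h1]; linear_combination hs
    have e3 : chi s (r + 3) = s - 1 := by
      rw [show r + 3 = r + 1 + 2 from rfl, chi, show r + 1 + 1 = r + 2 from rfl, e2, h1]
      linear_combination (-2) * hs
    have e4 : chi s (r + 4) = 1 := by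
      rw [show r + 4 = r + 2 + 2 from rfl, chi, show r + 2 + 1 = r + 3 from rfl, e3, e2]
      linear_combination hs
    have e5 : chi s (r + 5) = 1 := by
      rw [show r + 5 = r + 3 + 2 from rfl, chi, show r + 3 + 1 = r + 4 from rfl, e4, e3]
      ring
    refine ⟨e2, e3, e4, e5, ?_⟩
    rw [show r + 6 = r + 4 + 2 from rfl, chi, show r + 4 + 1 = r + 5 from rfl, e5, e4]
    ring
  induction m with
  | zero =>
    have := h2 0 rfl rfl
    simp only [zero_add] at this
    exact ⟨rfl, rfl, this.1, this.2.1, this.2.2.1⟩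
  | succ m ih =>
    obtain ⟨-, -, -, a5, a6⟩ := h2 _ ih.1 ih.2.1
    obtain ⟨b2, b3, b4, -, -⟩ := h2 (5 * m + 5) a5 a6
    exact ⟨a5, a6, b2, b3, b4⟩

variable [TopologicalSpace A] [DiscreteTopology A]

theorem pochInf_eq_one_sub_mul (a : A⟦X⟧) {b : A⟦X⟧} (hb : X ∣ b) :
    pochInf a b = (1 - a) * pochInf (a * b) b := by
  rw [← poch_mul_pochInf a hb 1]
  simp [poch]

/-- Factorwise this is `(1 - x)(1 - z x)(1 - w x) = 1 - x³` with `x = Q^(k+1)`; the leading factors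
`1 - z`, `1 - w` are split off first. -/
theorem pochInf_cube {z w : A} (h : z * w = 1) (hs : z + w = -1) {Q : A⟦X⟧} (hQ : X ∣ Q) :
    pochInf (C z) Q * pochInf (C w) Q * pochInf Q Q
      = C ((1 - z) * (1 - w)) * pochInf (Q ^ 3) (Q ^ 3) := by
  have h' : (C z : A⟦X⟧) * C w = 1 := by rw [← map_mul, h, map_one]
  have hs' : (C z : A⟦X⟧) + C w = -1 := by rw [← map_add, hs, map_neg, map_one]
  have key : pochInf (Q ^ 3) (Q ^ 3)
      = pochInf (C z * Q) Q * pochInf (C w * Q) Q * pochInf Q Q := by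
    refine pochInf_eq_of_tendsto (dvd_pow hQ three_ne_zero) ?_
    refine (((tendsto_poch _ hQ).mul (tendsto_poch _ hQ)).mul (tendsto_poch _ hQ)).congr fun n => ?_
    simp only [poch, ← Finset.prod_mul_distrib]
    refine Finset.prod_congr rfl fun k _ => ?_
    linear_combination (Q * Q ^ k) ^ 2 * (1 - Q * Q ^ k) * h'
      - Q * Q ^ k * (1 - Q * Q ^ k) * hs'
  rw [key, pochInf_eq_one_sub_mul (C z) hQ, pochInf_eq_one_sub_mul (C w) hQ]
  simp only [map_mul, map_sub, map_one]
  ring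

/-- Factorwise this is `1 - x⁵ = (1 - x)(1 - z x)(1 - w x)(1 - z² x)(1 - w² x)`. Pairing conjugate
factors expresses everything in `z + w`, which satisfies `s² + s = 1`. -/
theorem pochInf_fifth {z w : A} (h : z * w = 1) (hs : z ^ 2 + w ^ 2 + z + w + 1 = 0) {Q : A⟦X⟧}
    (hQ : X ∣ Q) :
    pochInf (C z) Q * pochInf (C w) Q
        * (pochInf (C (z ^ 2)) Q * pochInf (C (w ^ 2)) Q * pochInf Q Q)
      = C ((1 - z) * (1 - w) * ((1 - z ^ 2) * (1 - w ^ 2))) * pochInf (Q ^ 5) (Q ^ 5) := by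
  have h' : (C z : A⟦X⟧) * C w = 1 := by rw [← map_mul, h, map_one]
  have hs' : (C z : A⟦X⟧) ^ 2 + C w ^ 2 + C z + C w + 1 = 0 := by
    rw [← map_one (C (R := A)), ← map_pow, ← map_pow, ← map_add, ← map_add, ← map_add, ← map_add,
      hs, map_zero]
  have key : pochInf (Q ^ 5) (Q ^ 5)
      = pochInf (C z * Q) Q * pochInf (C w * Q) Q
        * (pochInf (C (z ^ 2) * Q) Q * pochInf (C (w ^ 2) * Q) Q * pochInf Q Q) := by
    refine pochInf_eq_of_tendsto (dvd_pow hQ (by norm_num)) ?_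
    refine (((tendsto_poch _ hQ).mul (tendsto_poch _ hQ)).mul
      (((tendsto_poch _ hQ).mul (tendsto_poch _ hQ)).mul (tendsto_poch _ hQ))).congr fun n => ?_
    simp only [poch, ← Finset.prod_mul_distrib, map_pow]
    refine Finset.prod_congr rfl fun k _ => ?_
    generalize hx : Q * Q ^ k = x
    have e1 : ∀ c : A⟦X⟧, 1 - c * Q * Q ^ k = 1 - c * x := fun c => by rw [← hx]; ring
    have e2 : (Q ^ 5 * (Q ^ 5) ^ k : A⟦X⟧) = x ^ 5 := by rw [← hx]; ring
    rw [e1, e1, e1, e1, e2]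
    have e3 : (1 - C z * x) * (1 - C w * x) = 1 - (C z + C w) * x + x ^ 2 := by
      linear_combination x ^ 2 * h'
    have e4 : (1 - C z ^ 2 * x) * (1 - C w ^ 2 * x) = 1 + (1 + (C z + C w)) * x + x ^ 2 := by
      linear_combination x ^ 2 * (C z * C w + 1) * h' - x * hs'
    have e5 : ((C z + C w) ^ 2 + (C z + C w) : A⟦X⟧) = 1 := by
      linear_combination hs' + 2 * h'
    rw [e3, e4]
    linear_combination (x ^ 3 - x ^ 2) * e5
  rw [key, pochInf_eq_one_sub_mul (C z) hQ, pochInf_eq_one_sub_mul (C w) hQ,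
    pochInf_eq_one_sub_mul (C (z ^ 2)) hQ, pochInf_eq_one_sub_mul (C (w ^ 2)) hQ]
  simp only [map_mul, map_sub, map_one]
  ring

end RootsOfUnity

/-! ### The spt-crank series over a general ring. -/

section SptSeries

variable {A : Type*} [CommRing A] [TopologicalSpace A] [DiscreteTopology A]

/-- The series `u / (z, w; Q)_∞ * ∑_{n ≥ 1} (z, w; Q)_n * ε n`, written without the division by
the factors `1 - z` and `1 - w`. -/
def sptSeries (z w : A) (Q u : A⟦X⟧) (ε : ℕ → A⟦X⟧) : A⟦X⟧ :=
  u * ∑' n, Ring.inverse (pochInf (C z * Q ^ (n + 1)) Q * pochInf (C w * Q ^ (n + 1)) Q)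
    * ε (n + 1)

theorem X_dvd_C_mul_pow {Q : A⟦X⟧} (hQ : X ∣ Q) (z : A) (n : ℕ) : X ∣ C z * Q ^ (n + 1) :=
  (dvd_pow hQ n.succ_ne_zero).mul_left _

theorem isUnit_pochInf_mul {Q : A⟦X⟧} (hQ : X ∣ Q) (z w : A) (n : ℕ) :
    IsUnit (pochInf (C z * Q ^ (n + 1)) Q * pochInf (C w * Q ^ (n + 1)) Q) :=
  (isUnit_pochInf (X_dvd_C_mul_pow hQ z n) hQ).mul (isUnit_pochInf (X_dvd_C_mul_pow hQ w n) hQ)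

theorem pochInf_mul_sptSeries {Q : A⟦X⟧} (hQ : X ∣ Q) (z w : A) (u : A⟦X⟧) {ε : ℕ → A⟦X⟧}
    (hε : IsNull ε) :
    pochInf (C z) Q * pochInf (C w) Q * sptSeries z w Q u ε
      = u * ∑' n, poch (C z) Q (n + 1) * poch (C w) Q (n + 1) * ε (n + 1) := by
  have hε' := hε.comp_injective (add_left_injective 1)
  rw [sptSeries, mul_left_comm, ← (hε'.mul_left _).summable.tsum_mul_left]
  congr 1
  refine tsum_congr fun n => ?_
  have h := Ring.mul_inverse_cancel _ (isUnit_pochInf_mul hQ z w n)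
  rw [← poch_mul_pochInf (C z) hQ (n + 1), ← poch_mul_pochInf (C w) hQ (n + 1)]
  linear_combination (poch (C z) Q (n + 1) * poch (C w) Q (n + 1) * ε (n + 1)) * h

theorem map_sptSeries {B : Type*} [CommRing B] [TopologicalSpace B] [DiscreteTopology B]
    (φ : A →+* B) {Q : A⟦X⟧} (hQ : X ∣ Q) (z w : A) (u : A⟦X⟧) {ε : ℕ → A⟦X⟧} (hε : IsNull ε) :
    PowerSeries.map φ (sptSeries z w Q u ε)
      = sptSeries (φ z) (φ w) (PowerSeries.map φ Q) (PowerSeries.map φ u)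
          fun n => PowerSeries.map φ (ε n) := by
  have hε' := hε.comp_injective (add_left_injective 1)
  rw [sptSeries, map_mul, (hε'.mul_left _).summable.map_tsum (PowerSeries.map φ) (continuous_map φ),
    sptSeries]
  congr 1
  refine tsum_congr fun n => ?_
  rw [map_mul, map_ringInverse _ (isUnit_pochInf_mul hQ z w n), map_mul, map_pochInf φ _ hQ,
    map_pochInf φ _ hQ]
  simp

end SptSeries

/-! ### Telescoping recurrences for the conjugate sequences. -/

section ConjugatePairs

variable {A : Type*} [CommRing A]

theorem IsNull.congr {ι : Type*} {f g : ι → A⟦X⟧} (hf : IsNull f) (h : ∀ i, g i = f i) :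
    IsNull g := by
  rwa [show g = f from funext h]

theorem isNull_X_pow_mul (e : ℕ → ℕ) (c : ℕ) (he : ∀ n, n ≤ e n + c) (g : ℕ → A⟦X⟧) :
    IsNull fun n => X ^ e n * g n :=
  isNull_of_dvd e c he fun _ => dvd_mul_right _ _

theorem choose_add_two (m n : ℕ) : (m + n).choose 2 = m.choose 2 + n.choose 2 + m * n := by
  induction n with
  | zero => simp
  | succ n ih => rw [← add_assoc, choose_succ_two, choose_succ_two, ih]; ring

theorem X_dvd_X_sq : (X : A⟦X⟧) ∣ X ^ 2 := dvd_pow_self X two_ne_zero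

theorem X_dvd_neg_X : (X : A⟦X⟧) ∣ -X := (dvd_neg).2 dvd_rfl

/-- No initial value is needed: each use of the recurrence multiplies the difference of two
solutions by a multiple of `X`, so every power of `X` divides it. -/
theorem eq_of_recurrence {f g c d : ℕ → A⟦X⟧} (hc : ∀ r, X ∣ c r)
    (hf : ∀ r, f r = d r + c r * f (r + 1)) (hg : ∀ r, g r = d r + c r * g (r + 1)) (r : ℕ) :
    f r = g r := by
  refine eq_of_forall_X_pow_dvd fun N => ?_
  induction N generalizing r with
  | zero => simp
  | succ N ih =>
    rw [hf, hg, add_sub_add_left_eq_sub, ← mul_sub, pow_succ']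
    exact mul_dvd_mul (hc r) (ih (r + 1))

variable [TopologicalSpace A] [DiscreteTopology A]

theorem IsNull.tendsto_zero {f : ℕ → A⟦X⟧} (hf : IsNull f) : Tendsto f atTop (𝓝 0) := by
  rw [tendsto_iff_X_pow_dvd]
  intro N
  have := hf N
  rw [Nat.cofinite_eq_atTop] at this
  simpa using this

theorem tendsto_tsum_of_uniform {v : ℕ → ℕ → A⟦X⟧} {V : ℕ → A⟦X⟧} (hv : ∀ r, IsNull (v r))
    (hV : IsNull V) (h : ∀ N : ℕ, ∀ᶠ r in atTop, ∀ m, (X : A⟦X⟧) ^ N ∣ v r m - V m) :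
    Tendsto (fun r => ∑' m, v r m) atTop (𝓝 (∑' m, V m)) := by
  rw [tendsto_iff_X_pow_dvd]
  intro N
  filter_upwards [h N] with r hr
  rw [← (hv r).summable.tsum_sub hV.summable]
  refine dvd_tsum (fun M => ?_) N hr
  filter_upwards [hv r M, hV M] with m h1 h2 using h1.sub h2

/-- Both indices `r + m` and `m + 2 r + c` are at least `r`, so the convergence as `r → ∞` is
uniform in `m`. -/
theorem eventually_forall_dvd {p i : ℕ → A⟦X⟧} {P I : A⟦X⟧} (hp : Tendsto p atTop (𝓝 P))
    (hi : Tendsto i atTop (𝓝 I)) (c N : ℕ) :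
    ∀ᶠ r in atTop, ∀ m, (X : A⟦X⟧) ^ N ∣ p (r + m) * i (m + 2 * r + c) - P * I := by
  obtain ⟨n1, h1⟩ := eventually_atTop.1 (tendsto_iff_X_pow_dvd.1 hp N)
  obtain ⟨n2, h2⟩ := eventually_atTop.1 (tendsto_iff_X_pow_dvd.1 hi N)
  filter_upwards [eventually_ge_atTop (n1 + n2)] with r hr m
  have e1 := h1 (r + m) (by omega)
  have e2 := h2 (m + 2 * r + c) (by omega)
  convert (e1.mul_right (i (m + 2 * r + c))).add (e2.mul_left P) using 1
  ring

/-- The sequence conjugate to `δ`, relative to `Q`. -/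
def conj (Q : A⟦X⟧) (δ : ℕ → A⟦X⟧) (r : ℕ) : A⟦X⟧ :=
  ∑' m, δ (r + m) * (ipoch Q m * ipoch Q (m + 2 * r + 1))

theorem tendsto_ipoch_add {Q : A⟦X⟧} (hQ : X ∣ Q) (c : ℕ) :
    Tendsto (fun m => ipoch Q (m + c)) atTop (𝓝 (ipochInf Q)) :=
  (tendsto_ipoch hQ).comp (tendsto_atTop_mono (fun m => Nat.le_add_right m c) tendsto_id)

theorem tendsto_poch_comp (a : A⟦X⟧) {b : A⟦X⟧} (hb : X ∣ b) {g : ℕ → ℕ} (hg : ∀ m, m ≤ g m) :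
    Tendsto (fun m => poch a b (g m)) atTop (𝓝 (pochInf a b)) :=
  (tendsto_poch a hb).comp (tendsto_atTop_mono hg tendsto_id)

/-- Creative telescoping: term `m + 1` of the sum at `r` is matched with term `m` of the sum at `r +
1`, so both carry the product with index `r + m + 1`. The certificate `H` has no decaying power of
`X`; its limit is the inhomogeneous term. `conj_L9_recurrence` and `conj_L12_recurrence` follow the
same pattern. -/
theorem conj_L7_recurrence (r : ℕ) :
    (1 - X ^ (2 * r + 1)) * ∑' m, X ^ (2 * m) * (poch X X (2 * (r + m))
        * (ipoch (X ^ 2) m * ipoch (X ^ 2) (m + 2 * r + 1)))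
      + -(X ^ (4 * r + 5) * (1 - X ^ (2 * r + 3))) * ∑' m, X ^ (2 * m)
        * (poch X X (2 * (r + 1 + m)) * (ipoch (X ^ 2) m * ipoch (X ^ 2) (m + 2 * (r + 1) + 1)))
      = (1 + X ^ (2 * r + 2)) * (pochInf X X * (ipochInf (X ^ 2 : A⟦X⟧) * ipochInf (X ^ 2))) := by
  have hQ : (X : A⟦X⟧) ∣ X ^ 2 := X_dvd_X_sq
  have hn := fun g : ℕ → A⟦X⟧ => isNull_X_pow_mul (fun m => 2 * m) 0 (fun m => by omega) g
  rw [← (hn _).summable.tsum_mul_left, ← (hn _).summable.tsum_mul_left]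
  refine tsum_add_tsum_of_telescope (H := fun m => (1 + X ^ (2 * r + 2))
    * (poch X X (2 * (r + m) + 2) * (ipoch (X ^ 2) m * ipoch (X ^ 2) (m + (2 * r + 2)))))
    ((hn _).mul_left _) ((hn _).mul_left _) ?_ ?_ ?_
  · simp only [poch_succ, add_zero, zero_add, show 2 * r + 2 = 2 * r + 1 + 1 from rfl,
      ipoch_eq hQ (2 * r + 1)]
    ring
  · intro m
    have e1 := ipoch_eq hQ m
    have e2 := ipoch_eq hQ (m + 2 * r + 2)
    simp only [show 2 * (r + 1 + m) = 2 * (r + m) + 2 by ring,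
      show 2 * (r + (m + 1)) = 2 * (r + m) + 2 by ring, show m + 1 + 2 * r + 1 = m + 2 * r + 2 by ring,
      show m + 2 * (r + 1) + 1 = m + 2 * r + 2 + 1 by ring,
      show m + (2 * r + 2) = m + 2 * r + 2 by ring,
      show m + 1 + (2 * r + 2) = m + 2 * r + 2 + 1 by ring, e1, e2, poch_succ]
    ring
  · exact ((tendsto_poch_comp X dvd_rfl fun m => by omega).mul
      ((tendsto_ipoch hQ).mul (tendsto_ipoch_add hQ _))).const_mul _

theorem conj_L9_recurrence (r : ℕ) :
    ∑' m, X ^ m * (poch (X ^ 2) (X ^ 2) (r + m) * (ipoch X m * ipoch X (m + 2 * r + 1)))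
      + X ^ (2 * r + 3) * ∑' m, X ^ m
        * (poch (X ^ 2) (X ^ 2) (r + 1 + m) * (ipoch X m * ipoch X (m + 2 * (r + 1) + 1)))
      = pochInf (X ^ 2) (X ^ 2) * (ipochInf (X : A⟦X⟧) * ipochInf X) := by
  have hQ : (X : A⟦X⟧) ∣ X := dvd_rfl
  have hn := fun g : ℕ → A⟦X⟧ => isNull_X_pow_mul (fun m => m) 0 (fun m => by omega) g
  rw [← (hn _).summable.tsum_mul_left]
  refine tsum_add_tsum_of_telescope (H := fun m =>
    poch (X ^ 2) (X ^ 2) (r + m + 1) * (ipoch X m * ipoch X (m + (2 * r + 2))))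
    (hn _) ((hn _).mul_left _) ?_ ?_ ?_
  · simp only [poch_succ, add_zero, zero_add, show 2 * r + 2 = 2 * r + 1 + 1 from rfl,
      ipoch_eq hQ (2 * r + 1)]
    ring
  · intro m
    have e1 := ipoch_eq hQ m
    have e2 := ipoch_eq hQ (m + 2 * r + 2)
    simp only [show r + 1 + m = r + m + 1 by ring, show r + (m + 1) = r + m + 1 by ring,
      show m + 1 + 2 * r + 1 = m + 2 * r + 2 by ring,
      show m + 2 * (r + 1) + 1 = m + 2 * r + 2 + 1 by ring,
      show m + (2 * r + 2) = m + 2 * r + 2 by ring,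
      show m + 1 + (2 * r + 2) = m + 2 * r + 2 + 1 by ring, e1, e2, poch_succ]
    ring
  · exact (tendsto_poch_comp _ X_dvd_X_sq fun m => by omega).mul
      ((tendsto_ipoch hQ).mul (tendsto_ipoch_add hQ _))

/-- The reciprocals `1 / (-q; q²)_n`. -/
def inegPoch (n : ℕ) : A⟦X⟧ := Ring.inverse (poch (-X) (X ^ 2) n)

theorem inegPoch_eq (n : ℕ) :
    (inegPoch n : A⟦X⟧) = (1 + X ^ (2 * n + 1)) * inegPoch (n + 1) := by
  have h1 := Ring.mul_inverse_cancel _ (isUnit_poch (X_dvd_neg_X (A := A)) (X ^ 2) n)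
  have h2 := Ring.mul_inverse_cancel _ (isUnit_poch (X_dvd_neg_X (A := A)) (X ^ 2) (n + 1))
  rw [← inegPoch] at h1 h2
  rw [poch_succ] at h2
  linear_combination ((1 + X ^ (2 * n + 1)) * inegPoch (n + 1)) * h1 - inegPoch n * h2

theorem tendsto_inegPoch :
    Tendsto inegPoch atTop (𝓝 (Ring.inverse (pochInf (-X) (X ^ 2 : A⟦X⟧)))) := by
  have hQ : (X : A⟦X⟧) ∣ X ^ 2 := X_dvd_X_sq
  rw [tendsto_iff_X_pow_dvd]
  intro N
  filter_upwards [eventually_ge_atTop N] with n hn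
  have h1 := poch_mul_pochInf (-X) hQ n
  have h2 := Ring.mul_inverse_cancel _ (isUnit_pochInf (X_dvd_neg_X (A := A)) hQ)
  have h3 := Ring.mul_inverse_cancel _ (isUnit_poch (X_dvd_neg_X (A := A)) (X ^ 2) n)
  rw [← inegPoch] at h3
  set J := Ring.inverse (pochInf (-X) (X ^ 2 : A⟦X⟧))
  have h4 : inegPoch n - J = J * (pochInf (-X * (X ^ 2) ^ n) (X ^ 2) - 1) := by
    linear_combination -inegPoch n * h2 - inegPoch n * J * h1
      + J * pochInf (-X * (X ^ 2) ^ n) (X ^ 2) * h3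
  rw [h4]
  refine (X_pow_dvd_pochInf_sub_one hQ ?_).mul_left _
  exact (pow_dvd_pow X hn).trans (X_pow_dvd_mul_pow hQ _ n)

theorem conj_L12_recurrence (r : ℕ) :
    (1 - X ^ (2 * r + 1)) * ∑' m, X ^ (2 * m) * (poch (X ^ 2) (X ^ 2) (2 * (r + m))
        * (inegPoch (r + m) * inegPoch (r + m + 1))
        * (ipoch (X ^ 2) m * ipoch (X ^ 2) (m + 2 * r + 1)))
      + -(X ^ (2 * r + 3) * (1 - X ^ (2 * r + 3))) * ∑' m, X ^ (2 * m)
        * (poch (X ^ 2) (X ^ 2) (2 * (r + 1 + m))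
        * (inegPoch (r + 1 + m) * inegPoch (r + 1 + m + 1))
        * (ipoch (X ^ 2) m * ipoch (X ^ 2) (m + 2 * (r + 1) + 1)))
      = pochInf (X ^ 2) (X ^ 2)
        * (Ring.inverse (pochInf (-X) (X ^ 2)) * Ring.inverse (pochInf (-X) (X ^ 2)))
        * (ipochInf (X ^ 2 : A⟦X⟧) * ipochInf (X ^ 2)) := by
  have hQ : (X : A⟦X⟧) ∣ X ^ 2 := X_dvd_X_sq
  have hn := fun g : ℕ → A⟦X⟧ => isNull_X_pow_mul (fun m => 2 * m) 0 (fun m => by omega) g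
  rw [← (hn _).summable.tsum_mul_left, ← (hn _).summable.tsum_mul_left]
  have ht : Tendsto (fun m => inegPoch (r + m + 1)) atTop
      (𝓝 (Ring.inverse (pochInf (-X) (X ^ 2 : A⟦X⟧)))) :=
    tendsto_inegPoch.comp (tendsto_atTop_mono (fun m => by simp only [id]; omega) tendsto_id)
  refine tsum_add_tsum_of_telescope (H := fun m => poch (X ^ 2) (X ^ 2) (2 * (r + m) + 2)
    * (inegPoch (r + m + 1) * inegPoch (r + m + 1))
    * (ipoch (X ^ 2) m * ipoch (X ^ 2) (m + (2 * r + 2))))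
    ((hn _).mul_left _) ((hn _).mul_left _) ?_ ?_ ?_
  · simp only [poch_succ, add_zero, zero_add, show 2 * r + 2 = 2 * r + 1 + 1 from rfl,
      ipoch_eq hQ (2 * r + 1), inegPoch_eq r]
    ring
  · intro m
    have e1 := ipoch_eq hQ m
    have e2 := ipoch_eq hQ (m + 2 * r + 2)
    have e3 := inegPoch_eq (A := A) (r + m + 1)
    simp only [show r + 1 + m = r + m + 1 by ring, show 2 * (r + m + 1) = 2 * (r + m) + 2 by ring,
      show r + (m + 1) = r + m + 1 by ring, show m + 1 + 2 * r + 1 = m + 2 * r + 2 by ring,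
      show m + 2 * (r + 1) + 1 = m + 2 * r + 2 + 1 by ring,
      show m + (2 * r + 2) = m + 2 * r + 2 by ring,
      show m + 1 + (2 * r + 2) = m + 2 * r + 2 + 1 by ring, e1, e2, e3, poch_succ]
    ring
  · exact ((tendsto_poch_comp _ hQ fun m => by omega).mul (ht.mul ht)).mul
      ((tendsto_ipoch hQ).mul (tendsto_ipoch_add hQ _))

/-- The matching of terms is as for L7, but the certificate contains `X ^ m` and tends to `0`, so
the relation is homogeneous. The same happens for G1, G3 and F1. -/
theorem conj_G2_recurrence (r : ℕ) :
    (1 + X ^ (2 * r + 1)) * ∑' m, X ^ m * (poch (-X) (X ^ 2) (r + m)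
        * (ipoch X m * ipoch X (m + 2 * r + 1)))
      + -(1 + X ^ (2 * r + 3)) * ∑' m, X ^ m * (poch (-X) (X ^ 2) (r + 1 + m)
        * (ipoch X m * ipoch (X : A⟦X⟧) (m + 2 * (r + 1) + 1))) = 0 := by
  have hQ : (X : A⟦X⟧) ∣ X := dvd_rfl
  have hn := fun g : ℕ → A⟦X⟧ => isNull_X_pow_mul (fun m => m) 0 (fun m => by omega) g
  rw [← (hn _).summable.tsum_mul_left, ← (hn _).summable.tsum_mul_left]
  refine tsum_add_tsum_of_telescope (H := fun m => X ^ m * ((1 - X ^ (2 * r + 2))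
    * (poch (-X) (X ^ 2) (r + m + 1) * (ipoch X m * ipoch X (m + (2 * r + 2))))))
    ((hn _).mul_left _) ((hn _).mul_left _) ?_ ?_ (hn _).tendsto_zero
  · simp only [poch_succ, add_zero, zero_add, show 2 * r + 2 = 2 * r + 1 + 1 from rfl,
      ipoch_eq hQ (2 * r + 1)]
    ring
  · intro m
    have e1 := ipoch_eq hQ m
    have e2 := ipoch_eq hQ (m + 2 * r + 2)
    simp only [show r + 1 + m = r + m + 1 by ring, show r + (m + 1) = r + m + 1 by ring,
      show m + 1 + 2 * r + 1 = m + 2 * r + 2 by ring,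
      show m + 2 * (r + 1) + 1 = m + 2 * r + 2 + 1 by ring,
      show m + (2 * r + 2) = m + 2 * r + 2 by ring,
      show m + 1 + (2 * r + 2) = m + 2 * r + 2 + 1 by ring, e1, e2, poch_succ]
    ring

theorem conj_G1_recurrence (r : ℕ) :
    (1 - X ^ (2 * r + 1)) * ∑' m, X ^ m * (poch X X (2 * (r + m))
        * (ipoch (X ^ 2) m * ipoch (X ^ 2) (m + 2 * r + 1)))
      + -(1 - X ^ (2 * r + 3)) * ∑' m, X ^ m * (poch X X (2 * (r + 1 + m))
        * (ipoch (X ^ 2) m * ipoch (X ^ 2 : A⟦X⟧) (m + 2 * (r + 1) + 1))) = 0 := by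
  have hQ : (X : A⟦X⟧) ∣ X ^ 2 := X_dvd_X_sq
  have hn := fun g : ℕ → A⟦X⟧ => isNull_X_pow_mul (fun m => m) 0 (fun m => by omega) g
  rw [← (hn _).summable.tsum_mul_left, ← (hn _).summable.tsum_mul_left]
  refine tsum_add_tsum_of_telescope (H := fun m => X ^ m * ((1 + X ^ (2 * r + 2))
    * (poch X X (2 * (r + m) + 2) * (ipoch (X ^ 2) m * ipoch (X ^ 2) (m + (2 * r + 2))))))
    ((hn _).mul_left _) ((hn _).mul_left _) ?_ ?_ (hn _).tendsto_zero
  · simp only [poch_succ, add_zero, zero_add, show 2 * r + 2 = 2 * r + 1 + 1 from rfl,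
      ipoch_eq hQ (2 * r + 1)]
    ring
  · intro m
    have e1 := ipoch_eq hQ m
    have e2 := ipoch_eq hQ (m + 2 * r + 2)
    simp only [show 2 * (r + 1 + m) = 2 * (r + m) + 2 by ring,
      show 2 * (r + (m + 1)) = 2 * (r + m) + 2 by ring,
      show m + 1 + 2 * r + 1 = m + 2 * r + 2 by ring,
      show m + 2 * (r + 1) + 1 = m + 2 * r + 2 + 1 by ring,
      show m + (2 * r + 2) = m + 2 * r + 2 by ring,
      show m + 1 + (2 * r + 2) = m + 2 * r + 2 + 1 by ring, e1, e2, poch_succ]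
    ring

theorem conj_G3_recurrence (r : ℕ) :
    ∑' m, X ^ ((m + 1).choose 2 + r * m) * ((-1) ^ m * (poch X X (r + m)
        * (ipoch X m * ipoch X (m + 2 * r + 1))))
      + -1 * ∑' m, X ^ ((m + 1).choose 2 + (r + 1) * m) * ((-1) ^ m * (poch X X (r + 1 + m)
        * (ipoch X m * ipoch (X : A⟦X⟧) (m + 2 * (r + 1) + 1)))) = 0 := by
  have hQ : (X : A⟦X⟧) ∣ X := dvd_rfl
  have hn := fun (r : ℕ) (g : ℕ → A⟦X⟧) =>
    isNull_X_pow_mul (fun m => (m + 1).choose 2 + r * m) 0 (fun m => by rw [choose_succ_two]; omega) g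
  rw [← (hn _ _).summable.tsum_mul_left]
  have hH := isNull_X_pow_mul (fun m => (m + 1).choose 2 + m + r * m) 0 (fun m => by omega)
    (fun m => (1 + X ^ (r + 1)) * ((-1) ^ m * (poch X X (r + m + 1)
      * (ipoch X m * ipoch (X : A⟦X⟧) (m + (2 * r + 2))))))
  refine tsum_add_tsum_of_telescope (hn _ _) ((hn _ _).mul_left _) ?_ ?_ hH.tendsto_zero
  · simp only [poch_succ, add_zero, zero_add, show 2 * r + 2 = 2 * r + 1 + 1 from rfl,
      ipoch_eq hQ (2 * r + 1)]
    ring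
  · intro m
    have e1 := ipoch_eq hQ m
    have e2 := ipoch_eq hQ (m + 2 * r + 2)
    simp only [show r + 1 + m = r + m + 1 by ring, show r + (m + 1) = r + m + 1 by ring,
      show m + 1 + 2 * r + 1 = m + 2 * r + 2 by ring,
      show m + 2 * (r + 1) + 1 = m + 2 * r + 2 + 1 by ring,
      show m + (2 * r + 2) = m + 2 * r + 2 by ring,
      show m + 1 + (2 * r + 2) = m + 2 * r + 2 + 1 by ring, e1, e2, poch_succ, choose_succ_two]
    ring

/-- The denominators `(q; q)_{m + 2r}` are those of Bailey's transform relative to `1` rather than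
`q`. This neighbouring sum obeys a two-term relation, and `bcoef_mul_conj_F1` expresses the
conjugate sequence through it. -/
theorem conj_F1_recurrence (r : ℕ) :
    (1 + X ^ (r + 1)) * ∑' m, X ^ (m.choose 2 + r * m) * (poch (-X) X (r + m)
        * (ipoch X m * ipoch X (m + 2 * r)))
      + -(1 + X ^ r) * ∑' m, X ^ (m.choose 2 + (r + 1) * m) * (poch (-X) X (r + 1 + m)
        * (ipoch X m * ipoch (X : A⟦X⟧) (m + 2 * (r + 1)))) = 0 := by
  have hQ : (X : A⟦X⟧) ∣ X := dvd_rfl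
  have hn := fun (r : ℕ) (g : ℕ → A⟦X⟧) =>
    isNull_X_pow_mul (fun m => m.choose 2 + r * m) 1 (fun m => by have := le_choose_two m; omega) g
  rw [← (hn _ _).summable.tsum_mul_left, ← (hn _ _).summable.tsum_mul_left]
  have hH := isNull_X_pow_mul (fun m => m.choose 2 + m + r * m) 0 (fun m => by omega)
    (fun m => (1 - X ^ (2 * r + 1)) * (poch (-X) X (r + m + 1)
      * (ipoch X m * ipoch (X : A⟦X⟧) (m + (2 * r + 1)))))
  refine tsum_add_tsum_of_telescope ((hn _ _).mul_left _) ((hn _ _).mul_left _) ?_ ?_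
    hH.tendsto_zero
  · simp only [poch_succ, add_zero, zero_add, ipoch_eq hQ (2 * r)]
    simp
    ring
  · intro m
    have e1 := ipoch_eq hQ m
    have e2 := ipoch_eq hQ (m + 2 * r + 1)
    simp only [show r + 1 + m = r + m + 1 by ring, show r + (m + 1) = r + m + 1 by ring,
      show m + 1 + 2 * r = m + 2 * r + 1 by ring,
      show m + 2 * (r + 1) = m + 2 * r + 1 + 1 by ring,
      show m + (2 * r + 1) = m + 2 * r + 1 by ring,
      show m + 1 + (2 * r + 1) = m + 2 * r + 1 + 1 by ring, e1, e2, poch_succ, choose_succ_two]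
    ring

end ConjugatePairs

/-! ### Evaluation of the conjugate sequences. -/

section ConjugateEvaluations

variable {A : Type*} [CommRing A] [TopologicalSpace A] [DiscreteTopology A]

theorem isNull_X_pow (e : ℕ → ℕ) (c : ℕ) (he : ∀ n, n ≤ e n + c) :
    IsNull fun n => (X : A⟦X⟧) ^ e n :=
  isNull_of_dvd e c he fun _ => dvd_rfl

theorem sq_eq_two_mul_choose_add (r : ℕ) : r ^ 2 = 2 * r.choose 2 + r := by
  induction r with
  | zero => simp
  | succ r ih => rw [choose_succ_two]; nlinarith

/-- Removing the terms `m = 0` and `m = 1` and shifting by two raises `r` by one, since `C(m+2, 2) =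
C(m, 2) + 2 m + 1`. This is the recurrence of `conj_L7_recurrence`; for L9 and L12 a single term is
removed. -/
theorem partialTheta_L7 (r : ℕ) :
    ∑' m : ℕ, (X : A⟦X⟧) ^ ((2 * r + 2) * m + m.choose 2)
      = (1 + X ^ (2 * r + 2))
        + X ^ (4 * r + 5) * ∑' m : ℕ, X ^ ((2 * (r + 1) + 2) * m + m.choose 2) := by
  have hn : ∀ r, IsNull fun m : ℕ => (X : A⟦X⟧) ^ ((2 * r + 2) * m + m.choose 2) := fun r =>
    isNull_X_pow _ 0 fun m => by nlinarith [Nat.zero_le (r * m), Nat.zero_le (m.choose 2)]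
  have h1 := (hn r).comp_injective (add_left_injective 1)
  rw [(hn r).summable.tsum_eq_zero_add, h1.summable.tsum_eq_zero_add,
    ← (hn (r + 1)).summable.tsum_mul_left, add_assoc]
  refine congrArg₂ (· + ·) (by simp) (congrArg₂ (· + ·) (by simp) (tsum_congr fun m => ?_))
  simp only [choose_succ_two]
  ring

theorem partialTheta_L9 (r : ℕ) :
    ∑' m : ℕ, (-1) ^ m * (X : A⟦X⟧) ^ ((2 * r + 2) * m + m ^ 2)
      = 1 + -X ^ (2 * r + 3) * ∑' m : ℕ, (-1) ^ m * X ^ ((2 * (r + 1) + 2) * m + m ^ 2) := by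
  have hn : ∀ r, IsNull fun m : ℕ => (-1) ^ m * (X : A⟦X⟧) ^ ((2 * r + 2) * m + m ^ 2) := fun r =>
    (isNull_X_pow _ 0 fun m => by
      nlinarith [Nat.zero_le (r * m), Nat.zero_le (m ^ 2)]).mul_left _
  rw [(hn r).summable.tsum_eq_zero_add, ← (hn (r + 1)).summable.tsum_mul_left]
  refine congrArg₂ (· + ·) (by simp) (tsum_congr fun m => ?_)
  ring

theorem partialTheta_L12 (r : ℕ) :
    ∑' m : ℕ, (X : A⟦X⟧) ^ ((2 * r + 2) * m + m ^ 2)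
      = 1 + X ^ (2 * r + 3) * ∑' m : ℕ, X ^ ((2 * (r + 1) + 2) * m + m ^ 2) := by
  have hn : ∀ r, IsNull fun m : ℕ => (X : A⟦X⟧) ^ ((2 * r + 2) * m + m ^ 2) := fun r =>
    isNull_X_pow _ 0 fun m => by nlinarith [Nat.zero_le (r * m), Nat.zero_le (m ^ 2)]
  rw [(hn r).summable.tsum_eq_zero_add, ← (hn (r + 1)).summable.tsum_mul_left]
  refine congrArg₂ (· + ·) (by simp) (tsum_congr fun m => ?_)
  ring

/-- After removal of `X ^ (2 r)` and multiplication by `1 - X ^ (2 r + 1)`, the conjugate sequence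
and the partial theta series solve the same recurrence. With `Q = X²` the factor `1 - Q ^ (2 r + 1)`
of `bcoef` supplies this multiplier and leaves `1 + X ^ (2 r + 1)`. -/
theorem bcoef_mul_conj_L7 (r : ℕ) :
    bcoef (X ^ 2 : A⟦X⟧) r * conj (X ^ 2) (fun n => poch X X (2 * n) * X ^ (2 * n)) r
      = pochInf X X * (ipochInf (X ^ 2) * ipochInf (X ^ 2))
        * ((-1) ^ r * ((1 + X ^ (2 * r + 1)) * X ^ (2 * r.choose 2 + 2 * r)
          * ∑' m : ℕ, X ^ ((2 * r + 2) * m + m.choose 2))) := by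
  set G : ℕ → A⟦X⟧ := fun r => ∑' m, X ^ (2 * m) * (poch X X (2 * (r + m))
        * (ipoch (X ^ 2) m * ipoch (X ^ 2) (m + 2 * r + 1))) with hG
  have h1 : conj (X ^ 2) (fun n => poch X X (2 * n) * X ^ (2 * n)) r = X ^ (2 * r) * G r := by
    have hn := isNull_X_pow_mul (fun m => 2 * m) 0 (fun m => by omega) fun m =>
      (poch X X (2 * (r + m)) * (ipoch (X ^ 2 : A⟦X⟧) m * ipoch (X ^ 2) (m + 2 * r + 1)))
    rw [conj, hG, ← hn.summable.tsum_mul_left]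
    exact tsum_congr fun m => by ring
  have h2 := eq_of_recurrence (f := fun r => (1 - X ^ (2 * r + 1)) * G r)
    (g := fun r => pochInf X X * (ipochInf (X ^ 2) * ipochInf (X ^ 2))
      * ∑' m : ℕ, X ^ ((2 * r + 2) * m + m.choose 2))
    (c := fun r => X ^ (4 * r + 5))
    (d := fun r => (1 + X ^ (2 * r + 2))
      * (pochInf X X * (ipochInf (X ^ 2 : A⟦X⟧) * ipochInf (X ^ 2))))
    (fun r => dvd_pow_self X (by omega)) (fun r => by
      have := conj_L7_recurrence (A := A) r
      simp only [hG]
      linear_combination this) (fun r => by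
      have := partialTheta_L7 (A := A) r
      linear_combination pochInf X X * (ipochInf (X ^ 2) * ipochInf (X ^ 2)) * this) r
  rw [h1, bcoef]
  linear_combination (-1) ^ r * (1 + X ^ (2 * r + 1)) * X ^ (2 * r.choose 2 + 2 * r) * h2

theorem bcoef_mul_conj_L9 (r : ℕ) :
    bcoef (X : A⟦X⟧) r * conj X (fun n => poch (X ^ 2) (X ^ 2) n * X ^ n) r
      = pochInf (X ^ 2) (X ^ 2) * (ipochInf X * ipochInf X)
        * ((-1) ^ r * ((1 - X ^ (2 * r + 1)) * X ^ (r.choose 2 + r)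
          * ∑' m : ℕ, (-1) ^ m * X ^ ((2 * r + 2) * m + m ^ 2))) := by
  set G : ℕ → A⟦X⟧ := fun r => ∑' m, X ^ m * (poch (X ^ 2) (X ^ 2) (r + m)
        * (ipoch X m * ipoch X (m + 2 * r + 1))) with hG
  have h1 : conj X (fun n => poch (X ^ 2) (X ^ 2) n * X ^ n) r = X ^ r * G r := by
    have hn := isNull_X_pow_mul (fun m => m) 0 (fun m => by omega) fun m =>
      (poch (X ^ 2) (X ^ 2) (r + m) * (ipoch (X : A⟦X⟧) m * ipoch X (m + 2 * r + 1)))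
    rw [conj, hG, ← hn.summable.tsum_mul_left]
    exact tsum_congr fun m => by ring
  have h2 := eq_of_recurrence (f := G)
    (g := fun r => pochInf (X ^ 2) (X ^ 2) * (ipochInf X * ipochInf X)
      * ∑' m : ℕ, (-1) ^ m * X ^ ((2 * r + 2) * m + m ^ 2))
    (c := fun r => -X ^ (2 * r + 3))
    (d := fun r => pochInf (X ^ 2) (X ^ 2) * (ipochInf (X : A⟦X⟧) * ipochInf X))
    (fun r => (dvd_neg).2 (dvd_pow_self X (by omega))) (fun r => by
      have := conj_L9_recurrence (A := A) r
      simp only [hG]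
      linear_combination this) (fun r => by
      have := partialTheta_L9 (A := A) r
      linear_combination pochInf (X ^ 2) (X ^ 2) * (ipochInf X * ipochInf X) * this) r
  rw [h1, bcoef]
  linear_combination (-1) ^ r * (1 - X ^ (2 * r + 1)) * X ^ (r.choose 2 + r) * h2

theorem bcoef_mul_conj_L12 (r : ℕ) :
    bcoef (X ^ 2 : A⟦X⟧) r * conj (X ^ 2) (fun n => poch (X ^ 2) (X ^ 2) (2 * n)
        * (inegPoch n * inegPoch (n + 1)) * X ^ (2 * n)) r
      = pochInf (X ^ 2) (X ^ 2)
        * (Ring.inverse (pochInf (-X) (X ^ 2)) * Ring.inverse (pochInf (-X) (X ^ 2)))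
        * (ipochInf (X ^ 2 : A⟦X⟧) * ipochInf (X ^ 2))
        * ((-1) ^ r * ((1 + X ^ (2 * r + 1)) * X ^ (2 * r.choose 2 + 2 * r)
          * ∑' m : ℕ, X ^ ((2 * r + 2) * m + m ^ 2))) := by
  set C0 : A⟦X⟧ := pochInf (X ^ 2) (X ^ 2)
        * (Ring.inverse (pochInf (-X) (X ^ 2)) * Ring.inverse (pochInf (-X) (X ^ 2)))
        * (ipochInf (X ^ 2 : A⟦X⟧) * ipochInf (X ^ 2)) with hC0
  set G : ℕ → A⟦X⟧ := fun r => ∑' m, X ^ (2 * m) * (poch (X ^ 2) (X ^ 2) (2 * (r + m))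
        * (inegPoch (r + m) * inegPoch (r + m + 1))
        * (ipoch (X ^ 2) m * ipoch (X ^ 2) (m + 2 * r + 1))) with hG
  have h1 : conj (X ^ 2) (fun n => poch (X ^ 2) (X ^ 2) (2 * n)
        * (inegPoch n * inegPoch (n + 1)) * X ^ (2 * n)) r = X ^ (2 * r) * G r := by
    have hn := isNull_X_pow_mul (fun m => 2 * m) 0 (fun m => by omega) fun m =>
      (poch (X ^ 2) (X ^ 2) (2 * (r + m)) * (inegPoch (r + m) * inegPoch (r + m + 1))
        * (ipoch (X ^ 2 : A⟦X⟧) m * ipoch (X ^ 2) (m + 2 * r + 1)))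
    rw [conj, hG, ← hn.summable.tsum_mul_left]
    exact tsum_congr fun m => by ring
  have h2 := eq_of_recurrence (f := fun r => (1 - X ^ (2 * r + 1)) * G r)
    (g := fun r => C0 * ∑' m : ℕ, X ^ ((2 * r + 2) * m + m ^ 2))
    (c := fun r => X ^ (2 * r + 3)) (d := fun _ => C0)
    (fun r => dvd_pow_self X (by omega)) (fun r => by
      have := conj_L12_recurrence (A := A) r
      rw [← hC0] at this
      simp only [hG]
      linear_combination this) (fun r => by
      have := partialTheta_L12 (A := A) r
      linear_combination C0 * this) r
  rw [h1, bcoef]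
  linear_combination (-1) ^ r * (1 + X ^ (2 * r + 1)) * X ^ (2 * r.choose 2 + 2 * r) * h2

theorem tendsto_X_pow (c : ℕ) : Tendsto (fun r => (X : A⟦X⟧) ^ (2 * r + c)) atTop (𝓝 0) :=
  (isNull_X_pow (fun r => 2 * r + c) 0 fun r => by omega).tendsto_zero

theorem eq_zero_of_succ_eq {f : ℕ → A⟦X⟧} (h : ∀ r, f r + -f (r + 1) = 0) (r : ℕ) : f r = f 0 := by
  induction r with
  | zero => rfl
  | succ r ih => rw [← ih]; linear_combination -h r

variable [IsDomain A]

/-- The product of `1 + X ^ (2 r + 1)` and the reduced sum is independent of `r`; letting `r → ∞`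
and summing `X ^ m / (X; X)_m` by Euler's identity identifies the constant. The multiplier stays on
the left to avoid an inverse. -/
theorem bcoef_mul_conj_G2 (r : ℕ) :
    (1 + X ^ (2 * r + 1)) * (bcoef (X : A⟦X⟧) r * conj X (fun n => poch (-X) (X ^ 2) n * X ^ n) r)
      = pochInf (-X) (X ^ 2) * (ipochInf X * ipochInf X)
        * ((-1) ^ r * ((1 - X ^ (2 * r + 1)) * X ^ (r.choose 2 + r))) := by
  have hX : (X : A⟦X⟧) ∣ X := dvd_rfl
  set v : ℕ → ℕ → A⟦X⟧ := fun r m => X ^ m * (poch (-X) (X ^ 2) (r + m)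
        * (ipoch X m * ipoch X (m + 2 * r + 1))) with hv
  have hn : ∀ g : ℕ → A⟦X⟧, IsNull fun m => X ^ m * g m := fun g =>
    isNull_X_pow_mul (fun m => m) 0 (fun m => by omega) g
  have h1 : conj X (fun n => poch (-X) (X ^ 2) n * X ^ n) r = X ^ r * ∑' m, v r m := by
    rw [conj, ← (hn _).summable.tsum_mul_left]
    exact tsum_congr fun m => by ring
  have hconst := eq_zero_of_succ_eq (f := fun r => (1 + X ^ (2 * r + 1)) * ∑' m, v r m) fun r => by
    have := conj_G2_recurrence (A := A) r
    simp only [hv]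
    linear_combination this
  set P := pochInf (-X) (X ^ 2 : A⟦X⟧)
  set I := ipochInf (X : A⟦X⟧)
  have hlim : Tendsto (fun r => ∑' m, v r m) atTop
      (𝓝 (∑' m, X ^ m * (P * I * ipoch X m))) := by
    refine tendsto_tsum_of_uniform (fun r => hn _) (hn _) fun N => ?_
    filter_upwards [eventually_forall_dvd (tendsto_poch (-X) X_dvd_X_sq) (tendsto_ipoch hX) 1 N]
      with r hr m
    convert (hr m).mul_left (X ^ m * ipoch X m) using 1
    simp only [hv]
    ring
  have hlim2 := ((tendsto_X_pow (A := A) 1).const_add 1).mul hlim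
  simp only [hconst] at hlim2
  have h0 := tendsto_nhds_unique hlim2 tendsto_const_nhds
  have hE := pochInf_mul_tsum_pow_mul_ipoch hX hX
  have hI := pochInf_mul_ipochInf hX
  have hn2 := hn fun m => ipoch X m
  have h3 : ∑' m, X ^ m * (P * I * ipoch X m) = P * I * ∑' m, X ^ m * ipoch X m := by
    rw [← hn2.summable.tsum_mul_left]
    exact tsum_congr fun m => by ring
  have h4 : (1 + X ^ (2 * r + 1)) * ∑' m, v r m = P * (I * I) := by
    have := hconst r
    rw [this, ← h0, h3]
    linear_combination P * I * I * hE - P * I * (∑' m, X ^ m * ipoch X m) * hI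
  rw [h1, bcoef]
  linear_combination (-1) ^ r * (1 - X ^ (2 * r + 1)) * X ^ (r.choose 2 + r) * h4

/-- As for G2, but the limiting constant collapses to `1` because `(X; X²)_∞ (X²; X²)_∞ = (X; X)_∞`.
-/
theorem bcoef_mul_conj_G1 (r : ℕ) :
    bcoef (X ^ 2 : A⟦X⟧) r * conj (X ^ 2) (fun n => poch X X (2 * n) * X ^ n) r
      = (-1) ^ r * ((1 + X ^ (2 * r + 1)) * X ^ (2 * r.choose 2 + r)) := by
  have hQ : (X : A⟦X⟧) ∣ X ^ 2 := X_dvd_X_sq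
  set v : ℕ → ℕ → A⟦X⟧ := fun r m => X ^ m * (poch X X (2 * (r + m))
        * (ipoch (X ^ 2) m * ipoch (X ^ 2) (m + 2 * r + 1))) with hv
  have hn : ∀ g : ℕ → A⟦X⟧, IsNull fun m => X ^ m * g m := fun g =>
    isNull_X_pow_mul (fun m => m) 0 (fun m => by omega) g
  have h1 : conj (X ^ 2) (fun n => poch X X (2 * n) * X ^ n) r = X ^ r * ∑' m, v r m := by
    rw [conj, ← (hn _).summable.tsum_mul_left]
    exact tsum_congr fun m => by ring
  have hconst := eq_zero_of_succ_eq (f := fun r => (1 - X ^ (2 * r + 1)) * ∑' m, v r m) fun r => by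
    have := conj_G1_recurrence (A := A) r
    simp only [hv]
    linear_combination this
  set I := ipochInf (X ^ 2 : A⟦X⟧)
  have hlim : Tendsto (fun r => ∑' m, v r m) atTop
      (𝓝 (∑' m, X ^ m * (pochInf X X * I * ipoch (X ^ 2) m))) := by
    refine tendsto_tsum_of_uniform (fun r => hn _) (hn _) fun N => ?_
    filter_upwards [eventually_forall_dvd (p := fun n => poch X X (2 * n))
      (tendsto_poch_comp X dvd_rfl fun m => by omega) (tendsto_ipoch hQ) 1 N] with r hr m
    convert (hr m).mul_left (X ^ m * ipoch (X ^ 2) m) using 1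
    simp only [hv]
    ring
  have hlim2 := ((tendsto_X_pow (A := A) 1).const_sub 1).mul hlim
  simp only [hconst] at hlim2
  have h0 := tendsto_nhds_unique hlim2 tendsto_const_nhds
  have hE := pochInf_mul_tsum_pow_mul_ipoch (A := A) dvd_rfl hQ
  have hI := pochInf_mul_ipochInf hQ
  have hP := pochInf_mul_pochInf_mul (X : A⟦X⟧) dvd_rfl
  rw [← pow_two] at hP
  have hn2 := hn fun m => ipoch (X ^ 2) m
  have h3 : ∑' m, X ^ m * (pochInf X X * I * ipoch (X ^ 2) m)
      = pochInf X X * I * ∑' m, X ^ m * ipoch (X ^ 2) m := by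
    rw [← hn2.summable.tsum_mul_left]
    exact tsum_congr fun m => by ring
  have h4 : (1 - X ^ (2 * r + 1)) * ∑' m, v r m = 1 := by
    have := hconst r
    rw [this, ← h0, h3, ← hP]
    linear_combination pochInf (X ^ 2) (X ^ 2) * I * hE + hI
  rw [h1, bcoef]
  linear_combination (-1) ^ r * (1 + X ^ (2 * r + 1)) * X ^ (2 * r.choose 2 + r) * h4

/-- Every term with `m ≥ 1` carries at least `X ^ r`, so only `m = 0` survives as `r → ∞`. -/
theorem tendsto_tsum_X_pow_mul {e : ℕ → ℕ → ℕ} {g : ℕ → ℕ → A⟦X⟧} {l : A⟦X⟧}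
    (he : ∀ r m, m ≤ e r m + 1) (he0 : ∀ r, e r 0 = 0) (he1 : ∀ r m, r ≤ e r (m + 1))
    (hg : Tendsto (fun r => g r 0) atTop (𝓝 l)) :
    Tendsto (fun r => ∑' m, X ^ e r m * g r m) atTop (𝓝 l) := by
  have hn : ∀ r, IsNull fun m => X ^ e r m * g r m := fun r =>
    isNull_X_pow_mul (fun m => e r m) 1 (he r) _
  have hV : IsNull fun m : ℕ => if m = 0 then l else 0 := by
    intro N
    rw [Nat.cofinite_eq_atTop]
    filter_upwards [eventually_ge_atTop 1] with m hm
    rw [if_neg (by omega)]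
    exact dvd_zero _
  have h := tendsto_tsum_of_uniform hn hV fun N => by
    filter_upwards [tendsto_iff_X_pow_dvd.1 hg N, eventually_ge_atTop N] with r hr hN m
    rcases m with _ | m
    · simpa [he0] using hr
    · rw [if_neg (by omega), sub_zero]
      exact (pow_dvd_pow X (hN.trans (he1 r m))).mul_right _
  rwa [tsum_ite_eq] at h

theorem tendsto_ipoch_comp {Q : A⟦X⟧} (hQ : X ∣ Q) {g : ℕ → ℕ} (hg : ∀ m, m ≤ g m) :
    Tendsto (fun m => ipoch Q (g m)) atTop (𝓝 (ipochInf Q)) :=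
  (tendsto_ipoch hQ).comp (tendsto_atTop_mono hg tendsto_id)

theorem bcoef_mul_conj_G3 (r : ℕ) :
    bcoef (X : A⟦X⟧) r * conj X (fun n => poch X X n * ((-1) ^ n * X ^ (n + 1).choose 2)) r
      = (1 - X ^ (2 * r + 1)) * X ^ (r.choose 2 + (r + 1).choose 2) := by
  have hX : (X : A⟦X⟧) ∣ X := dvd_rfl
  set v : ℕ → ℕ → A⟦X⟧ := fun r m => X ^ ((m + 1).choose 2 + r * m) * ((-1) ^ m
    * (poch X X (r + m) * (ipoch X m * ipoch X (m + 2 * r + 1)))) with hv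
  have h1 : conj X (fun n => poch X X n * ((-1) ^ n * X ^ (n + 1).choose 2)) r
      = (-1) ^ r * X ^ (r + 1).choose 2 * ∑' m, v r m := by
    have hn := isNull_X_pow_mul (fun m => (m + 1).choose 2 + r * m) 0
      (fun m => by rw [choose_succ_two]; omega) fun m =>
      (-1) ^ m * (poch X X (r + m) * (ipoch (X : A⟦X⟧) m * ipoch X (m + 2 * r + 1)))
    rw [conj, ← hn.summable.tsum_mul_left]
    refine tsum_congr fun m => ?_
    simp only [show r + m + 1 = r + (m + 1) by ring, choose_add_two r (m + 1),
      choose_succ_two r]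
    ring
  have hconst := eq_zero_of_succ_eq (f := fun r => ∑' m, v r m) fun r => by
    have := conj_G3_recurrence (A := A) r
    simp only [hv]
    linear_combination this
  have hlim : Tendsto (fun r => ∑' m, v r m) atTop (𝓝 (pochInf X X * ipochInf (X : A⟦X⟧))) := by
    refine tendsto_tsum_X_pow_mul (fun r m => by rw [choose_succ_two]; omega) (fun r => by simp)
      (fun r m => by nlinarith [Nat.zero_le (r * m), Nat.zero_le ((m + 1 + 1).choose 2)]) ?_
    simp only [pow_zero, one_mul, add_zero, ipoch_zero, zero_add]
    exact (tendsto_poch X hX).mul (tendsto_ipoch_comp hX fun m => by omega)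
  simp only [hconst] at hlim
  have h0 := tendsto_nhds_unique hlim tendsto_const_nhds
  have h4 : ∑' m, v r m = 1 := by
    rw [show ∑' m, v r m = ∑' m, v 0 m from hconst r, ← h0, pochInf_mul_ipochInf hX]
  rw [h1, h4, bcoef]
  have hs : ((-1 : A⟦X⟧) ^ r) * (-1) ^ r = 1 := by rw [← mul_pow]; simp
  linear_combination (1 - X ^ (2 * r + 1)) * X ^ (r.choose 2 + (r + 1).choose 2) * hs

theorem bcoef_mul_conj_F1 [CharZero A] (r : ℕ) :
    bcoef (X : A⟦X⟧) r * conj X (fun n => poch (-X) X n * X ^ n.choose 2) r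
      = pochInf (-X) X * ipochInf X * ((-1) ^ r * ((1 + X ^ r) * X ^ (2 * r.choose 2)
        - (1 + X ^ (r + 1)) * X ^ (r ^ 2 + 2 * r + 1))) := by
  have hX : (X : A⟦X⟧) ∣ X := dvd_rfl
  set v : ℕ → ℕ → A⟦X⟧ := fun r m => X ^ (m.choose 2 + r * m)
    * (poch (-X) X (r + m) * (ipoch X m * ipoch X (m + 2 * r))) with hv
  have hn : ∀ r (g : ℕ → A⟦X⟧), IsNull fun m => X ^ (m.choose 2 + r * m) * g m := fun r g =>
    isNull_X_pow_mul (fun m => m.choose 2 + r * m) 1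
      (fun m => by have := le_choose_two m; omega) g
  have hrec : ∀ r, (1 + X ^ (r + 1)) * ∑' m, v r m + -(1 + X ^ r) * ∑' m, v (r + 1) m = 0 :=
    fun r => conj_F1_recurrence r
  have hind : ∀ r, 2 * ∑' m, v r m = (1 + X ^ r) * ∑' m, v 0 m := by
    intro r
    induction r with
    | zero => ring
    | succ r ih =>
      -- At `r = 0` the coefficient `1 + X ^ 0 = 2` need not be invertible, but the recurrence is
      -- then already the claim. For larger index `1 + X ^ r` is a unit and cancels.
      rcases r with _ | r
      · have := hrec 0
        simp only [zero_add, pow_zero] at this ⊢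
        linear_combination -this
      · have hu : IsUnit (1 + X ^ (r + 1) : A⟦X⟧) :=
          isUnit_of_constantCoeff_eq_one (by simp)
        apply hu.mul_left_cancel
        linear_combination -2 * hrec (r + 1) + (1 + X ^ (r + 1 + 1)) * ih
  have hlim : Tendsto (fun r => ∑' m, v r m) atTop
      (𝓝 (pochInf (-X) X * ipochInf (X : A⟦X⟧))) := by
    refine tendsto_tsum_X_pow_mul (fun r m => by have := le_choose_two m; omega) (fun r => by simp)
      (fun r m => by nlinarith [Nat.zero_le (r * m), Nat.zero_le ((m + 1).choose 2)]) ?_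
    simp only [add_zero, ipoch_zero, zero_add, one_mul]
    exact (tendsto_poch (-X) hX).mul (tendsto_ipoch_comp hX fun m => by omega)
  have hlim2 := hlim.const_mul 2
  simp only [hind] at hlim2
  have hX0 : Tendsto (fun r => (X : A⟦X⟧) ^ r) atTop (𝓝 0) :=
    (isNull_X_pow (fun r => r) 0 fun r => by omega).tendsto_zero
  have h0 := tendsto_nhds_unique hlim2 ((hX0.const_add 1).mul_const (∑' m, v 0 m))
  have htwo : (2 : A⟦X⟧) ≠ 0 := by
    intro h
    have := congrArg constantCoeff h
    rw [map_ofNat, map_zero] at this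
    exact two_ne_zero this
  have hval : ∀ r, ∑' m, v r m = (1 + X ^ r) * (pochInf (-X) X * ipochInf X) := by
    intro r
    apply mul_left_cancel₀ htwo
    rw [hind]
    linear_combination -(1 + X ^ r) * h0
  -- Passage from the sum relative to `1` to the conjugate sequence relative to `q`, based on `(1 -
  -- X^(m+2r+1)) - (1 - X^(2r+1)) = X^(2r+1) (1 - X^m)`. The factor `1 - X^m` kills `m = 0` and
  -- shifts the rest to index `r + 1`.
  have hsplit : (1 - X ^ (2 * r + 1)) * conj X (fun n => poch (-X) X n * X ^ n.choose 2) r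
      = X ^ r.choose 2 * ∑' m, v r m
        - X ^ (2 * r + 1) * (X ^ (r + 1).choose 2 * ∑' m, v (r + 1) m) := by
    have hδ : ∀ r m, poch (-X) X (r + m) * X ^ (r + m).choose 2
        = X ^ (m.choose 2 + r * m) * (poch (-X) X (r + m) * X ^ r.choose 2 : A⟦X⟧) := by
      intro r m
      rw [choose_add_two]
      ring
    have hc : ∀ g : ℕ → A⟦X⟧, IsNull fun m => poch (-X) X (r + m) * X ^ (r + m).choose 2 * g m :=
      fun g => (hn r fun m => poch (-X) X (r + m) * X ^ r.choose 2 * g m).congr fun m => by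
        rw [hδ]; ring
    have hd : X ^ r.choose 2 * ∑' m, v r m
        - (1 - X ^ (2 * r + 1)) * conj X (fun n => poch (-X) X n * X ^ n.choose 2) r
        = ∑' m, X ^ (2 * r + 1) * (1 - X ^ m) * (poch (-X) X (r + m) * X ^ (r + m).choose 2
          * (ipoch X m * ipoch X (m + 2 * r + 1))) := by
      rw [conj, ← (hn r _).summable.tsum_mul_left, ← (hc _).summable.tsum_mul_left,
        ← ((hn r _).mul_left _).summable.tsum_sub ((hc _).mul_left _).summable]
      refine tsum_congr fun m => ?_
      rw [hδ, ipoch_eq hX (m + 2 * r)]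
      ring
    rw [((hc _).mul_left _).summable.tsum_eq_zero_add, pow_zero, sub_self, mul_zero, zero_mul,
      zero_add] at hd
    have hs : ∑' m, X ^ (2 * r + 1) * (1 - X ^ (m + 1)) * (poch (-X) X (r + (m + 1))
          * X ^ (r + (m + 1)).choose 2 * (ipoch X (m + 1) * ipoch X (m + 1 + 2 * r + 1)))
        = X ^ (2 * r + 1) * (X ^ (r + 1).choose 2 * ∑' m, v (r + 1) m) := by
      rw [← (hn (r + 1) _).summable.tsum_mul_left,
        ← ((hn (r + 1) _).mul_left _).summable.tsum_mul_left]
      refine tsum_congr fun m => ?_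
      rw [show r + (m + 1) = r + 1 + m by ring, hδ, ipoch_eq hX m,
        show m + 1 + 2 * r + 1 = m + 2 * (r + 1) by ring]
      ring
    rw [hs] at hd
    linear_combination -hd
  rw [hval, hval] at hsplit
  rw [choose_succ_two] at hsplit
  rw [bcoef, sq_eq_two_mul_choose_add]
  linear_combination (-1) ^ r * X ^ r.choose 2 * hsplit

end ConjugateEvaluations

/-! ### The seven series in uniform form. -/

section Labels

variable {A : Type*} [CommRing A]

/-- The base of the factors `(z, z⁻¹; Q)_n` in `S_X`. -/
def base : Label → A⟦X⟧
  | .G1 => X ^ 2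
  | .G2 => X
  | .F1 => X
  | .G3 => X
  | .L7 => X ^ 2
  | .L9 => X
  | .L12 => X ^ 2

/-- The factor of the summand of `S_X` that does not depend on `z`. -/
def weight : Label → ℕ → A⟦X⟧
  | .G1, n => poch X (X ^ 2) n * poch (X ^ 2) (X ^ 2) n * X ^ n
      * Ring.inverse (poch (X ^ 2) (X ^ 2) (2 * n))
  | .G2, n => poch (-X) (X ^ 2) n * X ^ n * Ring.inverse (poch X X (2 * n))
  | .F1, n => poch (-X) X n * X ^ (n * (n - 1) / 2) * Ring.inverse (poch X X (2 * n))
  | .G3, n => poch X X n * (-1) ^ n * X ^ (n * (n + 1) / 2) * Ring.inverse (poch X X (2 * n))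
  | .L7, n => X ^ (2 * n) * Ring.inverse (poch (-X) X (2 * n))
  | .L9, n => X ^ n * Ring.inverse (poch X (X ^ 2) n)
  | .L12, n => X ^ (2 * n) * Ring.inverse (poch (-X) (X ^ 2) n * poch (-X) (X ^ 2) (n + 1))

theorem X_dvd_base (l : Label) : (X : A⟦X⟧) ∣ base l := by
  cases l <;> first | exact dvd_rfl | exact X_dvd_X_sq

theorem isNull_weight (l : Label) : IsNull (weight l : ℕ → A⟦X⟧) := by
  have key : ∀ (e : ℕ → ℕ) (g : ℕ → A⟦X⟧), (∀ n, n ≤ e n + 1) →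
      (∀ n, weight l n = X ^ e n * g n) → IsNull (weight l : ℕ → A⟦X⟧) := fun e g he h =>
    (isNull_X_pow_mul e 1 he g).congr h
  cases l
  · exact key (fun n => n) (fun n => poch X (X ^ 2) n * poch (X ^ 2) (X ^ 2) n
      * Ring.inverse (poch (X ^ 2) (X ^ 2) (2 * n))) (fun n => by omega)
      fun n => by simp only [weight]; ring
  · exact key (fun n => n) (fun n => poch (-X) (X ^ 2) n * Ring.inverse (poch X X (2 * n)))
      (fun n => by omega) fun n => by simp only [weight]; ring
  · exact key (fun n => n * (n - 1) / 2) (fun n => poch (-X) X n * Ring.inverse (poch X X (2 * n)))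
      (fun n => by rw [← Nat.choose_two_right]; exact le_choose_two n)
      fun n => by simp only [weight]; ring
  · exact key (fun n => n * (n + 1) / 2)
      (fun n => poch X X n * (-1) ^ n * Ring.inverse (poch X X (2 * n)))
      (fun n => by
        have : n * (n + 1) / 2 = (n + 1).choose 2 := by
          rw [Nat.choose_two_right, Nat.add_sub_cancel, mul_comm]
        rw [this, choose_succ_two]; omega)
      fun n => by simp only [weight]; ring
  · exact key (fun n => 2 * n) (fun n => Ring.inverse (poch (-X) X (2 * n)))
      (fun n => by omega) fun n => by simp only [weight]
  · exact key (fun n => n) (fun n => Ring.inverse (poch X (X ^ 2) n))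
      (fun n => by omega) fun n => by simp only [weight]
  · exact key (fun n => 2 * n)
      (fun n => Ring.inverse (poch (-X) (X ^ 2) n * poch (-X) (X ^ 2) (n + 1)))
      (fun n => by omega) fun n => by simp only [weight]

theorem map_base {B : Type*} [CommRing B] (φ : A →+* B) (l : Label) :
    PowerSeries.map φ (base l) = base l := by
  cases l <;> simp [base]

theorem map_weight {B : Type*} [CommRing B] (φ : A →+* B) (l : Label) (n : ℕ) :
    PowerSeries.map φ (weight l n) = weight l n := by
  have hX : (X : A⟦X⟧) ∣ X := dvd_rfl
  have hX2 := X_dvd_X_sq (A := A)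
  have hXn := X_dvd_neg_X (A := A)
  cases l <;> simp only [weight, map_mul, map_pow, map_neg, map_one, map_X, map_poch,
    map_ringInverse _ (isUnit_poch hX _ _), map_ringInverse _ (isUnit_poch hX2 _ _),
    map_ringInverse _ (isUnit_poch hXn _ _),
    map_ringInverse _ ((isUnit_poch hXn _ _).mul (isUnit_poch hXn _ _))]

variable [TopologicalSpace A] [DiscreteTopology A]

/-- The factor in front of the sum `S_X`, without the factor `1 / (z, z⁻¹; Q)_∞`. -/
def prefactor : Label → A⟦X⟧
  | .G1 => pochInf (X ^ 2) (X ^ 2)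
      * Ring.inverse (pochInf X (X ^ 2) * pochInf (X ^ 2) (X ^ 2))
  | .G2 => pochInf X X * Ring.inverse (pochInf (-X) (X ^ 2))
  | .F1 => pochInf X X * Ring.inverse (pochInf (-X) X)
  | .G3 => pochInf X X * Ring.inverse (pochInf X X)
  | .L7 => pochInf (-X) X
  | .L9 => pochInf X (X ^ 2)
  | .L12 => pochInf (-X) (X ^ 2) ^ 2

theorem map_prefactor {B : Type*} [CommRing B] [TopologicalSpace B] [DiscreteTopology B]
    (φ : A →+* B) (l : Label) : PowerSeries.map φ (prefactor l) = prefactor l := by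
  have hX : (X : A⟦X⟧) ∣ X := dvd_rfl
  have hX2 := X_dvd_X_sq (A := A)
  have hXn := X_dvd_neg_X (A := A)
  cases l <;> simp only [prefactor, map_mul, map_pow, map_neg, map_X, map_pochInf φ _ hX,
    map_pochInf φ _ hX2, map_ringInverse _ (isUnit_pochInf hX hX),
    map_ringInverse _ (isUnit_pochInf hXn hX), map_ringInverse _ (isUnit_pochInf hXn hX2),
    map_ringInverse _ ((isUnit_pochInf hX hX2).mul (isUnit_pochInf hX2 hX2))]

/-- The series `S_X` over an arbitrary ring, with `w` in place of `z⁻¹`. -/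
def genS (l : Label) (z w : A) : A⟦X⟧ := sptSeries z w (base l) (prefactor l) (weight l)

/-- Everything in the series except `z` and `w` has coefficients in the image of `ℤ`, and all
inverses are of units; this naturality is what permits specialization of `z`. -/
theorem map_genS {B : Type*} [CommRing B] [TopologicalSpace B] [DiscreteTopology B]
    (φ : A →+* B) (l : Label) (z w : A) :
    PowerSeries.map φ (genS l z w) = genS l (φ z) (φ w) := by
  rw [genS, map_sptSeries φ (X_dvd_base l) z w _ (isNull_weight l), map_base, map_prefactor, genS]
  simp only [map_weight]

variable [IsDomain A]

/-- The expansion of `S_X` obtained from a conjugate Bailey pair. -/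
theorem pochInf_mul_genS (l : Label) {z w : A} (h : z * w = 1) {δ : ℕ → A⟦X⟧}
    (hδ : ∀ n, X ^ n ∣ X * δ n) (hw : ∀ n, weight l n = δ n * ipoch (base l) (2 * n)) :
    pochInf (C z) (base l) * pochInf (C w) (base l) * genS l z w
      = prefactor l * ∑' r, bcoef (base l) r * conj (base l) δ r * (chi (C (z + w)) r - 1) := by
  rw [genS, pochInf_mul_sptSeries (X_dvd_base l) z w _ (isNull_weight l)]
  have := tsum_symPoch (X_dvd_base l) (C (z + w)) δ hδ
  simp only [← hw, symPoch_eq h] at this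
  rw [this]
  congr 1
  exact tsum_congr fun r => by rw [conj]; ring

end Labels

/-! ### Comparison with the definition over `ℚ(z)`. -/

section RationalFunctions

attribute [local instance] discreteK

instance discreteTopologyK : DiscreteTopology K := ⟨rfl⟩

theorem ringInverse_eq_inv {F : Type*} [Field F] {f : F⟦X⟧} (hf : IsUnit f) :
    Ring.inverse f = f⁻¹ := by
  apply ringInverse_eq_of_mul_eq_one
  apply PowerSeries.mul_inv_cancel
  exact (isUnit_iff_constantCoeff.1 hf).ne_zero

theorem sptSeries_eq {F : Type*} [Field F] [TopologicalSpace F] [DiscreteTopology F] {z w : F}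
    (hz : z ≠ 1) (hw : w ≠ 1) {Q : F⟦X⟧} (hQ : X ∣ Q) (u : F⟦X⟧) {ε : ℕ → F⟦X⟧} (hε : IsNull ε) :
    sptSeries z w Q u ε = u * (pochInf (C z) Q * pochInf (C w) Q)⁻¹
      * ∑' n, poch (C z) Q (n + 1) * poch (C w) Q (n + 1) * ε (n + 1) := by
  have h := pochInf_mul_sptSeries hQ z w u hε
  have hc : constantCoeff (pochInf (C z) Q * pochInf (C w) Q) ≠ 0 := by
    have hQ' : ∀ a : F, X ∣ C a * Q := fun a => hQ.mul_left _
    rw [pochInf_eq_one_sub_mul (C z) hQ, pochInf_eq_one_sub_mul (C w) hQ]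
    simp only [map_mul, map_sub, map_one, constantCoeff_C, constantCoeff_pochInf (hQ' _) hQ,
      mul_one]
    exact mul_ne_zero (sub_ne_zero.2 hz.symm) (sub_ne_zero.2 hw.symm)
  have h2 := PowerSeries.mul_inv_cancel _ hc
  rw [mul_right_comm, ← h]
  linear_combination -sptSeries z w Q u ε * h2

theorem ratFunc_X_ne_one : (RatFunc.X : K) ≠ 1 := by
  intro h
  have h1 : algebraMap (Polynomial ℚ) K Polynomial.X = algebraMap (Polynomial ℚ) K 1 := by
    rw [RatFunc.algebraMap_X, h, map_one]
  simpa using congrArg (Polynomial.eval 0) (RatFunc.algebraMap_injective ℚ h1)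

/-- Over `ℚ(z)` the constant term `(1 - z)(1 - z⁻¹)` of `(z, z⁻¹; Q)_∞` is nonzero, so the inverses
in the original definition are true inverses and the two forms agree. -/
theorem S_eq_genS (l : Label) : S l = genS l (RatFunc.X : K) (RatFunc.X)⁻¹ := by
  have hX : (X : K⟦X⟧) ∣ X := dvd_rfl
  have hX2 := X_dvd_X_sq (A := K)
  have hXn := X_dvd_neg_X (A := K)
  rw [genS, sptSeries_eq ratFunc_X_ne_one (by simpa using ratFunc_X_ne_one) (X_dvd_base l) _
    (isNull_weight l)]
  have e1 : ∀ a b : PowerSeries K, qInf a b = pochInf a b := fun _ _ => rfl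
  have e2 : ∀ (a b : PowerSeries K) (n : ℕ), qFin a b n = poch a b n := fun _ _ _ => rfl
  have e3 : ∀ t : ℕ → PowerSeries K, sumPos t = ∑' n, t (n + 1) := fun _ => rfl
  cases l <;> simp only [S, SG1, SG2, SF1, SG3, SL7, SL9, SL12, base, prefactor, weight, e1, e2, e3,
    z, zinv, q, ringInverse_eq_inv (isUnit_pochInf hX hX),
    ringInverse_eq_inv (isUnit_pochInf hXn hX), ringInverse_eq_inv (isUnit_pochInf hXn hX2),
    ringInverse_eq_inv ((isUnit_pochInf hX hX2).mul (isUnit_pochInf hX2 hX2)),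
    ringInverse_eq_inv (isUnit_poch hX _ _), ringInverse_eq_inv (isUnit_poch hX2 _ _),
    ringInverse_eq_inv (isUnit_poch hXn _ _),
    ringInverse_eq_inv ((isUnit_poch hXn _ _).mul (isUnit_poch hXn _ _)),
    PowerSeries.mul_inv_rev]
  all_goals
    refine congrArg₂ (· * ·) (by ring) (tsum_congr fun n => by ring)

end RationalFunctions

/-! ### The congruences modulo 3. -/

section ModThree

variable {F : Type*} [Field F] [TopologicalSpace F] [DiscreteTopology F]

theorem resSupp_pochInf_base_pow (l : Label) {t : ℕ} (ht : t ≠ 0) :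
    ResSupp ({0} : Finset (ZMod t)) (pochInf (base l ^ t) (base l ^ t) : F⟦X⟧) := by
  cases l <;> simp only [base, ← pow_mul] <;>
    first
    | exact resSupp_pochInf_X_pow ht dvd_rfl dvd_rfl
    | exact resSupp_pochInf_X_pow (by omega) (dvd_mul_left _ _) (dvd_mul_left _ _)

/-- Multiplying the Bailey expansion by `(Q; Q)_∞` makes the left side `3 (Q³; Q³)_∞ S_X`. The right
side is `E` times a sum over `r ≡ 1` modulo `3`, so its residue classes bound those of `S_X`. -/
theorem resSupp_genS_three [CharZero F] (l : Label) {z w : F} (hzw : z * w = 1) (hs : z + w = -1)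
    {δ : ℕ → F⟦X⟧} (hδ : ∀ n, X ^ n ∣ X * δ n)
    (hw : ∀ n, weight l n = δ n * ipoch (base l) (2 * n)) {D E : F⟦X⟧} {T : ℕ → F⟦X⟧}
    (hT : ∀ r, bcoef (base l) r * conj (base l) δ r = D * T r) (hTn : IsNull T)
    (hE : pochInf (base l) (base l) * prefactor l * D = E) {S₁ S₂ U : Finset (ZMod 3)}
    (hE₁ : ResSupp S₁ E) (hT₂ : ∀ r, r % 3 = 1 → ResSupp S₂ (T r))
    (hU : ∀ a ∈ S₁, ∀ b ∈ S₂, a + b ∈ U) : ResSupp U (genS l z w) := by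
  have hQ := X_dvd_base (A := F) l
  have h1 := pochInf_mul_genS l hzw hδ hw
  have h2 := pochInf_cube hzw hs hQ
  have hc : (1 - z) * (1 - w) = 3 := by linear_combination hzw - hs
  rw [hc] at h2
  have h3 : ∑' r, bcoef (base l) r * conj (base l) δ r * (chi (C (z + w)) r - 1)
      = D * ∑' r, T r * (chi (-1) r - 1) := by
    rw [← (hTn.mul_right _).summable.tsum_mul_left]
    refine tsum_congr fun r => ?_
    rw [hT, hs, map_neg, map_one]
    ring
  rw [h3] at h1
  have h4 : genS l z w * pochInf (base l ^ 3) (base l ^ 3)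
      = C (3 : F)⁻¹ * (E * ∑' r, T r * (chi (-1) r - 1)) := by
    have h5 : (C (3 : F)⁻¹ : F⟦X⟧) * C 3 = 1 := by
      rw [← map_mul, inv_mul_cancel₀ three_ne_zero, map_one]
    rw [← hE]
    linear_combination C (3 : F)⁻¹ * pochInf (base l) (base l) * h1
      - C (3 : F)⁻¹ * genS l z w * h2
      - genS l z w * pochInf (base l ^ 3) (base l ^ 3) * h5
  refine ResSupp.of_mul_eq h4 (resSupp_pochInf_base_pow l three_ne_zero)
    (constantCoeff_pochInf (dvd_pow hQ three_ne_zero) (dvd_pow hQ three_ne_zero)) ?_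
  refine (ResSupp.mul hE₁ (resSupp_tsum (hTn.mul_right _) fun r => ?_) hU).C_mul _
  rw [chi_neg_one_sub_one]
  split_ifs with hr
  · have := (hT₂ r hr).C_mul (-3)
    rwa [map_neg, map_ofNat, mul_comm] at this
  · rw [mul_zero]
    exact resSupp_zero _

theorem natCast_choose_two {t : ℕ} (ht : ((t.choose 2 : ℕ) : ZMod t) = 0) (m : ℕ) :
    ((m.choose 2 : ℕ) : ZMod t) = (((m % t).choose 2 : ℕ) : ZMod t) := by
  have h : ∀ k, (((t * k).choose 2 : ℕ) : ZMod t) = 0 := by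
    intro k
    induction k with
    | zero => simp
    | succ k ih => rw [mul_add, mul_one, choose_add_two]; push_cast; rw [ih, ht]; simp
  conv_lhs => rw [← Nat.div_add_mod m t, choose_add_two]
  push_cast
  rw [h]
  simp

theorem natCast_choose_two_three (m : ℕ) :
    ((m : ZMod 3) = 0 ∧ ((m.choose 2 : ℕ) : ZMod 3) = 0) ∨
      ((m : ZMod 3) = 1 ∧ ((m.choose 2 : ℕ) : ZMod 3) = 0) ∨
      ((m : ZMod 3) = 2 ∧ ((m.choose 2 : ℕ) : ZMod 3) = 1) := by
  rw [natCast_choose_two (by decide) m, ← ZMod.natCast_mod m 3]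
  have := Nat.mod_lt m (show 3 > 0 by norm_num)
  generalize m % 3 = e at *
  interval_cases e <;> decide

theorem natCast_of_mod_three {r : ℕ} (hr : r % 3 = 1) :
    (r : ZMod 3) = 1 ∧ ((r.choose 2 : ℕ) : ZMod 3) = 0 := by
  rw [natCast_choose_two (by decide) r, ← ZMod.natCast_mod r 3, hr]
  decide

theorem resSupp_one_add_X_pow {r : ℕ} (hr : r % 3 = 1) :
    ResSupp ({0} : Finset (ZMod 3)) (1 + X ^ (2 * r + 1) : F⟦X⟧) := by
  refine resSupp_one.add (resSupp_X_pow ?_)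
  push_cast
  rw [(natCast_of_mod_three hr).1]
  decide

theorem resSupp_one_sub_X_pow {r : ℕ} (hr : r % 3 = 1) :
    ResSupp ({0} : Finset (ZMod 3)) (1 - X ^ (2 * r + 1) : F⟦X⟧) := by
  refine resSupp_one.sub (resSupp_X_pow ?_)
  push_cast
  rw [(natCast_of_mod_three hr).1]
  decide

theorem X_pow_dvd_X_mul {f g : ℕ → F⟦X⟧} {e : ℕ → ℕ} (he : ∀ n, n ≤ e n + 1)
    (h : ∀ n, f n = X ^ e n * g n) (n : ℕ) : X ^ n ∣ X * f n := by
  refine (pow_dvd_pow X (he n)).trans ?_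
  rw [h, pow_succ']
  exact mul_dvd_mul_left _ (dvd_mul_right _ _)

theorem isNull_X_pow_choose {e : ℕ → ℕ} (he : ∀ r, r ≤ e r + 1) (g : ℕ → F⟦X⟧) :
    IsNull fun r => (-1) ^ r * (g r * X ^ e r) :=
  (isNull_X_pow_mul e 1 he fun r => (-1) ^ r * g r).congr fun r => by ring

theorem ringInverse_poch_neg (n : ℕ) :
    Ring.inverse (poch (-X) X n) = poch X X n * ipoch (X ^ 2 : F⟦X⟧) n := by
  apply ringInverse_eq_of_mul_eq_one
  have h := poch_mul_ipoch (X_dvd_X_sq (A := F)) n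
  have h2 : poch (-X) X n * poch X X n = poch (X ^ 2) (X ^ 2 : F⟦X⟧) n := by
    simp only [poch, ← Finset.prod_mul_distrib]
    exact Finset.prod_congr rfl fun j _ => by ring
  rw [← mul_assoc, h2, h]

theorem poch_two_mul (n : ℕ) :
    poch X (X ^ 2) n * poch (X ^ 2) (X ^ 2) n = poch X (X : F⟦X⟧) (2 * n) := by
  induction n with
  | zero => simp
  | succ n ih =>
    rw [show 2 * (n + 1) = 2 * n + 1 + 1 by ring, poch_succ, poch_succ, poch_succ, poch_succ, ← ih]
    ring

/-- For `r ≡ 1` modulo `3` the prefactor exponents lie in class `2`, and the partial theta exponents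
reduce to `m + C(m, 2)`, which takes only the classes `0, 1`. In L9 and L12 the expression is `m +
m²`, with classes `0, 2`. -/
theorem resSupp_genS_L7 [CharZero F] {z w : F} (hzw : z * w = 1) (hs : z + w = -1) :
    ResSupp ({0, 2} : Finset (ZMod 3)) (genS .L7 z w) := by
  have hX2 := X_dvd_X_sq (A := F)
  have hle : ∀ r : ℕ, r ≤ 2 * r.choose 2 + 2 * r + 1 := fun r => by omega
  refine resSupp_genS_three .L7 hzw hs (δ := fun n => poch X X (2 * n) * X ^ (2 * n))
    (X_pow_dvd_X_mul (e := fun n => 2 * n) (g := fun n => poch X X (2 * n)) (fun n => by omega)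
      fun n => by ring)
    (fun n => by simp only [weight, base, ringInverse_poch_neg]; ring) bcoef_mul_conj_L7
    ((isNull_X_pow_choose hle fun r => (1 + X ^ (2 * r + 1)) *
      ∑' m : ℕ, X ^ ((2 * r + 2) * m + m.choose 2)).congr fun r => by ring)
    (E := 1) ?_ (S₁ := {0}) (S₂ := {0, 2}) resSupp_one (fun r hr => ?_) (by decide)
  · have h1 := pochInf_mul_pochInf_neg (X : F⟦X⟧) dvd_rfl
    have h2 := pochInf_mul_ipochInf hX2
    simp only [base, prefactor]
    linear_combination pochInf (X ^ 2) (X ^ 2) * ipochInf (X ^ 2) ^ 2 * h1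
      + (pochInf (X ^ 2) (X ^ 2) * ipochInf (X ^ 2) + 1) * h2
  · obtain ⟨h1, h2⟩ := natCast_of_mod_three hr
    refine ResSupp.neg_one_pow_mul (ResSupp.mul (ResSupp.mul (resSupp_one_add_X_pow hr)
      (resSupp_X_pow (S := {2}) ?_) (U := {2}) (by decide)) (resSupp_tsum (S := {0, 1}) ?_ fun m =>
        resSupp_X_pow ?_) (by decide)) r
    · push_cast; rw [h1, h2]; decide
    · exact isNull_X_pow _ 0 fun m => by nlinarith [Nat.zero_le (r * m), Nat.zero_le (m.choose 2)]
    · push_cast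
      rw [h1]
      rcases natCast_choose_two_three m with ⟨a, b⟩ | ⟨a, b⟩ | ⟨a, b⟩ <;> rw [a, b] <;> decide

theorem resSupp_genS_L9 [CharZero F] {z w : F} (hzw : z * w = 1) (hs : z + w = -1) :
    ResSupp ({0, 1} : Finset (ZMod 3)) (genS .L9 z w) := by
  have hX : (X : F⟦X⟧) ∣ X := dvd_rfl
  have hX2 := X_dvd_X_sq (A := F)
  have hle : ∀ r : ℕ, r ≤ r.choose 2 + r + 1 := fun r => by omega
  refine resSupp_genS_three .L9 hzw hs (δ := fun n => poch (X ^ 2) (X ^ 2) n * X ^ n)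
    (X_pow_dvd_X_mul (e := fun n => n) (g := fun n => poch (X ^ 2) (X ^ 2) n) (fun n => by omega)
      fun n => by ring)
    (fun n => ?_) bcoef_mul_conj_L9
    ((isNull_X_pow_choose hle fun r => (1 - X ^ (2 * r + 1)) *
      ∑' m : ℕ, (-1) ^ m * X ^ ((2 * r + 2) * m + m ^ 2)).congr fun r => by ring)
    (E := 1) ?_ (S₁ := {0}) (S₂ := {0, 1}) resSupp_one (fun r hr => ?_) (by decide)
  · simp only [weight, base]
    have h1 : Ring.inverse (poch X (X ^ 2) n)
        = poch (X ^ 2) (X ^ 2) n * ipoch (X : F⟦X⟧) (2 * n) := by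
      apply ringInverse_eq_of_mul_eq_one
      rw [← mul_assoc, poch_two_mul, poch_mul_ipoch hX]
    rw [h1]
    ring
  · have h1 := pochInf_mul_pochInf_mul (X : F⟦X⟧) dvd_rfl
    rw [← pow_two] at h1
    have h2 := pochInf_mul_ipochInf hX
    simp only [base, prefactor]
    linear_combination pochInf X X * ipochInf X ^ 2 * h1 + (pochInf X X * ipochInf X + 1) * h2
  · obtain ⟨h1, h2⟩ := natCast_of_mod_three hr
    refine ResSupp.neg_one_pow_mul (ResSupp.mul (ResSupp.mul (resSupp_one_sub_X_pow hr)
      (resSupp_X_pow (S := {1}) ?_) (U := {1}) (by decide)) (resSupp_tsum (S := {0, 2}) ?_ fun m =>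
        ResSupp.neg_one_pow_mul (resSupp_X_pow ?_) m) (by decide)) r
    · push_cast; rw [h1, h2]; decide
    · exact (isNull_X_pow _ 0 fun m => by
        nlinarith [Nat.zero_le (r * m), Nat.zero_le (m ^ 2)]).mul_left _
    · push_cast
      rw [h1]
      rcases natCast_choose_two_three m with ⟨a, b⟩ | ⟨a, b⟩ | ⟨a, b⟩ <;> rw [a] <;> decide

theorem resSupp_genS_L12 [CharZero F] {z w : F} (hzw : z * w = 1) (hs : z + w = -1) :
    ResSupp ({1, 2} : Finset (ZMod 3)) (genS .L12 z w) := by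
  have hX2 := X_dvd_X_sq (A := F)
  have hXn := X_dvd_neg_X (A := F)
  have hle : ∀ r : ℕ, r ≤ 2 * r.choose 2 + 2 * r + 1 := fun r => by omega
  refine resSupp_genS_three .L12 hzw hs (δ := fun n => poch (X ^ 2) (X ^ 2) (2 * n)
        * (inegPoch n * inegPoch (n + 1)) * X ^ (2 * n))
    (X_pow_dvd_X_mul (e := fun n => 2 * n) (g := fun n => poch (X ^ 2) (X ^ 2) (2 * n)
        * (inegPoch n * inegPoch (n + 1))) (fun n => by omega) fun n => by ring)
    (fun n => ?_) bcoef_mul_conj_L12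
    ((isNull_X_pow_choose hle fun r => (1 + X ^ (2 * r + 1)) *
      ∑' m : ℕ, X ^ ((2 * r + 2) * m + m ^ 2)).congr fun r => by ring)
    (E := 1) ?_ (S₁ := {0}) (S₂ := {1, 2}) resSupp_one (fun r hr => ?_) (by decide)
  · simp only [weight, base]
    have h1 : Ring.inverse (poch (-X) (X ^ 2) n * poch (-X) (X ^ 2) (n + 1))
        = (inegPoch n * inegPoch (n + 1) : F⟦X⟧) := by
      apply ringInverse_eq_of_mul_eq_one
      have a := Ring.mul_inverse_cancel _ (isUnit_poch hXn (X ^ 2) n)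
      have b := Ring.mul_inverse_cancel _ (isUnit_poch hXn (X ^ 2) (n + 1))
      rw [← inegPoch] at a b
      rw [mul_mul_mul_comm, a, b, one_mul]
    have h2 := poch_mul_ipoch hX2 (2 * n)
    rw [h1]
    linear_combination -(X ^ (2 * n) * (inegPoch n * inegPoch (n + 1))) * h2
  · have h1 := Ring.mul_inverse_cancel _ (isUnit_pochInf hXn hX2)
    have h2 := pochInf_mul_ipochInf hX2
    simp only [base, prefactor]
    set p := pochInf (-X) (X ^ 2 : F⟦X⟧)
    have h3 : p ^ 2 * (Ring.inverse p * Ring.inverse p) = 1 := by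
      linear_combination (p * Ring.inverse p + 1) * h1
    linear_combination (pochInf (X ^ 2) (X ^ 2) * ipochInf (X ^ 2)) ^ 2 * h3
      + (pochInf (X ^ 2) (X ^ 2) * ipochInf (X ^ 2) + 1) * h2
  · obtain ⟨h1, h2⟩ := natCast_of_mod_three hr
    refine ResSupp.neg_one_pow_mul (ResSupp.mul (ResSupp.mul (resSupp_one_add_X_pow hr)
      (resSupp_X_pow (S := {2}) ?_) (U := {2}) (by decide)) (resSupp_tsum (S := {0, 2}) ?_ fun m =>
        resSupp_X_pow ?_) (by decide)) r
    · push_cast; rw [h1, h2]; decide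
    · exact isNull_X_pow _ 0 fun m => by nlinarith [Nat.zero_le (r * m), Nat.zero_le (m ^ 2)]
    · push_cast
      rw [h1]
      rcases natCast_choose_two_three m with ⟨a, b⟩ | ⟨a, b⟩ | ⟨a, b⟩ <;> rw [a] <;> decide

theorem resSupp_genS_G2 [CharZero F] {z w : F} (hzw : z * w = 1) (hs : z + w = -1) :
    ResSupp ({1} : Finset (ZMod 3)) (genS .G2 z w) := by
  have hX : (X : F⟦X⟧) ∣ X := dvd_rfl
  have hXn := X_dvd_neg_X (A := F)
  have hle : ∀ r : ℕ, r ≤ r.choose 2 + r + 1 := fun r => by omega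
  have hu : ∀ r, (1 + X ^ (2 * r + 1) : F⟦X⟧) * Ring.inverse (1 + X ^ (2 * r + 1)) = 1 := fun r =>
    Ring.mul_inverse_cancel _ (isUnit_of_constantCoeff_eq_one (by simp))
  refine resSupp_genS_three .G2 hzw hs (δ := fun n => poch (-X) (X ^ 2) n * X ^ n)
    (X_pow_dvd_X_mul (e := fun n => n) (g := fun n => poch (-X) (X ^ 2) n) (fun n => by omega)
      fun n => by ring)
    (fun n => rfl) (D := pochInf (-X) (X ^ 2) * (ipochInf X * ipochInf X))
    (T := fun r => (-1) ^ r * (((1 - X ^ (2 * r + 1)) * Ring.inverse (1 + X ^ (2 * r + 1)))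
      * X ^ (r.choose 2 + r))) (fun r => ?_) (isNull_X_pow_choose hle _)
    (E := 1) ?_ (S₁ := {0}) (S₂ := {1}) resSupp_one (fun r hr => ?_) (by decide)
  · have h1 := bcoef_mul_conj_G2 (A := F) r
    simp only [base]
    linear_combination Ring.inverse (1 + X ^ (2 * r + 1)) * h1
      - (bcoef X r * conj X (fun n => poch (-X) (X ^ 2) n * X ^ n) r) * hu r
  · have h1 := Ring.mul_inverse_cancel _ (isUnit_pochInf hXn X_dvd_X_sq)
    have h2 := pochInf_mul_ipochInf hX
    simp only [base, prefactor]
    linear_combination (pochInf X X * ipochInf X) ^ 2 * h1 + (pochInf X X * ipochInf X + 1) * h2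
  · obtain ⟨h1, h2⟩ := natCast_of_mod_three hr
    have h3 : ResSupp ({0} : Finset (ZMod 3)) (Ring.inverse (1 + X ^ (2 * r + 1) : F⟦X⟧)) :=
      ResSupp.of_mul_eq ((mul_comm _ _).trans (hu r)) (resSupp_one_add_X_pow hr) (by simp)
        resSupp_one
    refine ResSupp.neg_one_pow_mul (ResSupp.mul (ResSupp.mul (resSupp_one_sub_X_pow hr) h3
      (U := {0}) (by decide)) (resSupp_X_pow (S := {1}) ?_) (by decide)) r
    push_cast; rw [h1, h2]; decide

/-- The triple product with `x = -1`, `y = -X` equals twice this product and is a sum of powers of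
`X` with triangular exponents, which avoid the class `2` modulo `3`. -/
theorem resSupp_pochInf_div [CharZero F] :
    ResSupp ({0, 1} : Finset (ZMod 3)) (pochInf (-X) X ^ 2 * pochInf X X : F⟦X⟧) := by
  have hX : (X : F⟦X⟧) ∣ X := dvd_rfl
  have h := jacobi_triple_product (x := (-1 : F⟦X⟧)) (y := -X) hX (by ring)
  rw [pochInf_eq_one_sub_mul (-1 : F⟦X⟧) hX, neg_one_mul] at h
  have h2 : pochInf (-X) X ^ 2 * pochInf X X = C (2 : F)⁻¹
      * (∑' j : ℕ, (-1) ^ j * (-1) ^ j * X ^ j.choose 2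
        + ∑' j : ℕ, (-1) ^ (j + 1) * (-X) ^ (j + 1) * X ^ (j + 1).choose 2 : F⟦X⟧) := by
    have h5 : (C (2 : F)⁻¹ : F⟦X⟧) * 2 = 1 := by
      rw [← map_ofNat (C (R := F)) 2, ← map_mul, inv_mul_cancel₀ two_ne_zero, map_one]
    rw [← h]
    linear_combination -(pochInf (-X) X ^ 2 * pochInf X X) * h5
  have hX0 := isNull_pow_choose_two hX
  rw [h2]
  refine (ResSupp.add (resSupp_tsum (hX0.mul_left _) fun j => ?_)
    (resSupp_tsum ((hX0.comp_injective (add_left_injective 1)).mul_left _) fun j => ?_)).C_mul _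
  · rw [mul_assoc]
    refine ResSupp.neg_one_pow_mul (ResSupp.neg_one_pow_mul (resSupp_X_pow ?_) j) j
    rcases natCast_choose_two_three j with ⟨a, b⟩ | ⟨a, b⟩ | ⟨a, b⟩ <;> rw [b] <;> decide
  · rw [neg_pow X, mul_assoc, mul_assoc, ← pow_add]
    refine ResSupp.neg_one_pow_mul (ResSupp.neg_one_pow_mul (resSupp_X_pow ?_) _) _
    rw [Nat.cast_add]
    rcases natCast_choose_two_three (j + 1) with ⟨a, b⟩ | ⟨a, b⟩ | ⟨a, b⟩ <;> rw [a, b] <;> decide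

theorem resSupp_genS_G1 [CharZero F] {z w : F} (hzw : z * w = 1) (hs : z + w = -1) :
    ResSupp ({1, 2} : Finset (ZMod 3)) (genS .G1 z w) := by
  have hX : (X : F⟦X⟧) ∣ X := dvd_rfl
  have hX2 := X_dvd_X_sq (A := F)
  have hle : ∀ r : ℕ, r ≤ 2 * r.choose 2 + r + 1 := fun r => by omega
  refine resSupp_genS_three .G1 hzw hs (δ := fun n => poch X X (2 * n) * X ^ n)
    (X_pow_dvd_X_mul (e := fun n => n) (g := fun n => poch X X (2 * n)) (fun n => by omega)
      fun n => by ring)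
    (fun n => by simp only [weight, base, poch_two_mul]; rfl) (D := 1)
    (fun r => (bcoef_mul_conj_G1 r).trans (one_mul _).symm) (isNull_X_pow_choose hle _)
    (E := pochInf (-X) X ^ 2 * pochInf X X) ?_ (S₁ := {0, 1}) (S₂ := {1})
    resSupp_pochInf_div (fun r hr => ?_) (by decide)
  · have h1 := pochInf_mul_pochInf_neg (X : F⟦X⟧) dvd_rfl
    have h2 := pochInf_mul_pochInf_mul (X : F⟦X⟧) dvd_rfl
    rw [← pow_two] at h2
    have hu : IsUnit (pochInf X (X ^ 2) * pochInf (X ^ 2) (X ^ 2) : F⟦X⟧) :=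
      (isUnit_pochInf hX hX2).mul (isUnit_pochInf hX2 hX2)
    have h3 := Ring.mul_inverse_cancel _ hu
    simp only [base, prefactor, mul_one]
    apply hu.mul_left_cancel
    rw [← h1] at h2 h3 ⊢
    linear_combination (pochInf X X * pochInf (-X) X) ^ 2 * h3
      - pochInf (-X) X ^ 2 * pochInf X X * h2
  · obtain ⟨h1, h2⟩ := natCast_of_mod_three hr
    refine ResSupp.neg_one_pow_mul (ResSupp.mul (resSupp_one_add_X_pow hr)
      (resSupp_X_pow (S := {1}) ?_) (by decide)) r
    push_cast; rw [h1, h2]; decide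

end ModThree

/-! ### Dissection of a theta series modulo 5. -/

section Theta

variable {A : Type*} [CommRing A] [TopologicalSpace A] [DiscreteTopology A]

theorem tsum_ite_mod_five {f : ℕ → A⟦X⟧} {a : ℕ} (ha : a < 5) :
    ∑' r, (if r % 5 = a then f r else 0) = ∑' m, f (5 * m + a) := by
  have hinj : Function.Injective fun m : ℕ => 5 * m + a := fun m n h => by
    simp only at h; omega
  rw [← hinj.tsum_eq (f := fun r => if r % 5 = a then f r else 0)]
  · exact tsum_congr fun m => if_pos (by omega)
  · intro r hr
    have h : r % 5 = a := by
      by_contra h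
      exact hr (if_neg h)
    exact ⟨r / 5, by simp only; omega⟩

theorem tsum_split_mod_five {f : ℕ → A⟦X⟧} (hf : IsNull f) {a b : ℕ} (ha : a < 5) (hb : b < 5)
    (hab : a ≠ b) :
    ∑' r, f r = ∑' m, f (5 * m + a) + ∑' m, f (5 * m + b)
      + ∑' r, (if r % 5 = a ∨ r % 5 = b then 0 else f r) := by
  have hi : ∀ (p : ℕ → Prop) [DecidablePred p], IsNull fun r => if p r then f r else 0 := by
    intro p _ N
    filter_upwards [hf N] with r hr
    split_ifs
    · exact hr
    · exact dvd_zero _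
  have hi' : IsNull fun r => if r % 5 = a ∨ r % 5 = b then 0 else f r := by
    intro N
    filter_upwards [hf N] with r hr
    split_ifs
    · exact dvd_zero _
    · exact hr
  rw [← tsum_ite_mod_five ha, ← tsum_ite_mod_five hb, ← (hi _).summable.tsum_add (hi _).summable,
    ← ((hi fun r => r % 5 = a).summable.add (hi fun r => r % 5 = b).summable).tsum_add hi'.summable]
  refine tsum_congr fun r => ?_
  by_cases h1 : r % 5 = a
  · have h2 : r % 5 ≠ b := fun h => hab (h1.symm.trans h)
    simp [h1, hab]
  · by_cases h2 : r % 5 = b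
    · simp [h2, Ne.symm hab]
    · simp [h1, h2]

theorem natCast_choose_two_five (m : ℕ) :
    ((m.choose 2 : ℕ) : ZMod 5) = (((m % 5).choose 2 : ℕ) : ZMod 5) :=
  natCast_choose_two (by decide) m

theorem choose_two_five_mul (m : ℕ) : (5 * m).choose 2 = 25 * m.choose 2 + 10 * m := by
  induction m with
  | zero => simp
  | succ m ih =>
    rw [mul_add, mul_one, choose_add_two, ih, choose_succ_two m, show Nat.choose 5 2 = 10 by decide]
    ring

variable [IsDomain A]

theorem isNull_pow_choose_succ {Q : A⟦X⟧} (hQ : X ∣ Q) (k : ℕ) :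
    IsNull fun r : ℕ => Q ^ (r + k).choose 2 :=
  (isNull_pow_choose_two hQ).comp_injective (add_left_injective k)

/-- The theta series `(z, w, q; q)_∞`, where `w = z⁻¹`. -/
theorem theta_expansion {z w : A} (hzw : z * w = 1) :
    pochInf (C z) X * pochInf (C w) X * pochInf X X
      = C (1 - w) * (C (1 - z)
        + ∑' j : ℕ, (-1) ^ j * (C (z ^ (j + 2) - w ^ (j + 1)) * X ^ (j + 2).choose 2)) := by
  have hX : (X : A⟦X⟧) ∣ X := dvd_rfl
  have h' : (C z : A⟦X⟧) * C w = 1 := by rw [← map_mul, hzw, map_one]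
  have h := jacobi_triple_product (x := (C z : A⟦X⟧)) (y := C w * X) hX (by rw [← mul_assoc, h', one_mul])
  have hn : IsNull fun j : ℕ => (-1) ^ j * C z ^ j * (X : A⟦X⟧) ^ j.choose 2 :=
    (isNull_pow_choose_two hX).mul_left _
  have hn2 : IsNull fun j : ℕ => (-1) ^ (j + 1) * (C w * X) ^ (j + 1)
      * (X : A⟦X⟧) ^ (j + 1).choose 2 := (isNull_pow_choose_succ hX 1).mul_left _
  have hn1 := hn.comp_injective (add_left_injective 1)
  -- The first two terms give `1 - z`. Afterwards the term `j + 2` of the first series has the same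
  -- exponent as the term `j` of the second, because `C(j+2, 2) = (j + 1) + C(j+1, 2)`.
  rw [hn.summable.tsum_eq_zero_add, hn1.summable.tsum_eq_zero_add, add_assoc, add_assoc,
    ← (hn1.comp_injective (add_left_injective 1)).summable.tsum_add hn2.summable] at h
  have h2 : ∑' j : ℕ, ((-1) ^ (j + 1 + 1) * C z ^ (j + 1 + 1) * (X : A⟦X⟧) ^ (j + 1 + 1).choose 2
      + (-1) ^ (j + 1) * (C w * X) ^ (j + 1) * (X : A⟦X⟧) ^ (j + 1).choose 2)
      = ∑' j : ℕ, (-1) ^ j * (C (z ^ (j + 2) - w ^ (j + 1)) * X ^ (j + 2).choose 2) := by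
    refine tsum_congr fun j => ?_
    simp only [show j + 2 = j + 1 + 1 from rfl, choose_succ_two (j + 1), map_sub, map_pow]
    ring
  rw [h2] at h
  rw [pochInf_eq_one_sub_mul (C w) hX, map_sub, map_sub, map_one]
  simp at h ⊢
  linear_combination (1 - C w) * h

variable {z w : A}

/-- For the indices with exponent divisible by `5`, the relations `z⁵ = w⁵ = 1` and `w⁴ = z` make
the coefficient `± (1 - z)`, so it leaves the sum as a constant. -/
theorem theta_term_five (hzw : z * w = 1) (hz : z ^ 5 = 1) (m : ℕ) :
    (-1 : A⟦X⟧) ^ (5 * m + 3) * (C (z ^ (5 * m + 3 + 2) - w ^ (5 * m + 3 + 1))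
        * X ^ (5 * m + 3 + 2).choose 2)
      = C (1 - z) * ((-1) ^ (m + 1) * X ^ (5 * (m + 1)).choose 2) ∧
    (-1 : A⟦X⟧) ^ (5 * m + 4) * (C (z ^ (5 * m + 4 + 2) - w ^ (5 * m + 4 + 1))
        * X ^ (5 * m + 4 + 2).choose 2)
      = C (1 - z) * ((-1) ^ (m + 1) * X ^ (5 * (m + 1) + 1).choose 2) := by
  have hw : w ^ 5 = 1 := by
    have : (z * w) ^ 5 = 1 := by rw [hzw, one_pow]
    rwa [mul_pow, hz, one_mul] at this
  have hw4 : w ^ 4 = z := by linear_combination z * hw - w ^ 4 * hzw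
  have e1 : ∀ k, z ^ (5 * k) = 1 := fun k => by rw [pow_mul, hz, one_pow]
  have e2 : ∀ k, w ^ (5 * k) = 1 := fun k => by rw [pow_mul, hw, one_pow]
  have e3 : ∀ k, (-1 : A⟦X⟧) ^ (5 * k) = (-1) ^ k := fun k => by rw [pow_mul]; norm_num
  constructor
  · rw [show 5 * m + 3 + 2 = 5 * (m + 1) by ring, e1, show 5 * m + 3 + 1 = 5 * m + 4 by ring,
      pow_add w, e2, hw4, pow_add, e3]
    ring_nf
  · rw [show 5 * m + 4 + 2 = 5 * (m + 1) + 1 by ring, pow_succ z, e1,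
      show 5 * m + 4 + 1 = 5 * (m + 1) by ring, e2, pow_add, e3, map_sub, map_sub, one_mul]
    ring

/-- In the triple product with base `X²⁵`, `C(5m, 2) = 25 C(m, 2) + 10 m`; adding `5 m` gives
`C(5m+1, 2)`, the exponent on the other side. -/
theorem theta_ten_fifteen :
    pochInf (X ^ 10) (X ^ 25) * pochInf (X ^ 15) (X ^ 25) * pochInf (X ^ 25) (X ^ 25 : A⟦X⟧)
      = 1 + (∑' m : ℕ, (-1) ^ (m + 1) * X ^ (5 * (m + 1)).choose 2
        + ∑' m : ℕ, (-1) ^ (m + 1) * X ^ (5 * (m + 1) + 1).choose 2) := by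
  have hQ : (X : A⟦X⟧) ∣ X ^ 25 := dvd_pow_self X (by norm_num)
  rw [jacobi_triple_product hQ (by ring)]
  have hn : IsNull fun j : ℕ => (-1) ^ j * (X ^ 10) ^ j * (X ^ 25 : A⟦X⟧) ^ j.choose 2 :=
    (isNull_pow_choose_two hQ).mul_left _
  rw [hn.summable.tsum_eq_zero_add, add_assoc]
  refine congrArg₂ (· + ·) (by simp) (congrArg₂ (· + ·) (tsum_congr fun m => ?_)
    (tsum_congr fun m => ?_))
  · rw [choose_two_five_mul]; ring
  · rw [choose_succ_two (5 * (m + 1)), choose_two_five_mul]; ring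

/-- The part of `theta_expansion` with exponents divisible by `5`. -/
theorem theta_dissection (hzw : z * w = 1) (hz : z ^ 5 = 1) :
    ∃ J₁ : A⟦X⟧, ResSupp ({1} : Finset (ZMod 5)) J₁ ∧
      pochInf (C z) X * pochInf (C w) X * pochInf X X
        = C ((1 - z) * (1 - w)) * (pochInf (X ^ 10) (X ^ 25) * pochInf (X ^ 15) (X ^ 25)
          * pochInf (X ^ 25) (X ^ 25)) + J₁ := by
  have hX : (X : A⟦X⟧) ∣ X := dvd_rfl
  have hn : IsNull fun j : ℕ => (-1) ^ j * (C (z ^ (j + 2) - w ^ (j + 1))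
      * (X : A⟦X⟧) ^ (j + 2).choose 2) := ((isNull_pow_choose_succ hX 2).mul_left _).mul_left _
  have hn3 : IsNull fun m : ℕ => (-1) ^ (m + 1) * (X : A⟦X⟧) ^ (5 * (m + 1)).choose 2 :=
    ((isNull_pow_choose_two hX).comp_injective (g := fun m => 5 * (m + 1)) fun a b h => by
      simp only at h; omega).mul_left _
  have hn4 : IsNull fun m : ℕ => (-1) ^ (m + 1) * (X : A⟦X⟧) ^ (5 * (m + 1) + 1).choose 2 :=
    ((isNull_pow_choose_two hX).comp_injective (g := fun m => 5 * (m + 1) + 1) fun a b h => by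
      simp only at h; omega).mul_left _
  have hrest : IsNull fun j : ℕ => if j % 5 = 3 ∨ j % 5 = 4 then 0
      else (-1) ^ j * (C (z ^ (j + 2) - w ^ (j + 1)) * (X : A⟦X⟧) ^ (j + 2).choose 2) := by
    intro N
    filter_upwards [hn N] with r hr
    split_ifs
    · exact dvd_zero _
    · exact hr
  refine ⟨C (1 - w) * ∑' j : ℕ, (if j % 5 = 3 ∨ j % 5 = 4 then 0
      else (-1) ^ j * (C (z ^ (j + 2) - w ^ (j + 1)) * (X : A⟦X⟧) ^ (j + 2).choose 2)),
    (resSupp_tsum hrest fun j => ?_).C_mul _, ?_⟩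
  · split_ifs with hj
    · exact resSupp_zero _
    · by_cases h1 : j % 5 = 1
      -- These indices would contribute the class `3`, but their coefficient is `z³ - w² = 0`. The
      -- remaining ones, with `j + 2 ≡ 2, 4`, all have exponent in class `1`.
      · have h0 : z ^ (j + 2) - w ^ (j + 1) = 0 := by
          obtain ⟨k, rfl⟩ : ∃ k, j = 5 * k + 1 := ⟨j / 5, by omega⟩
          have hw : w ^ 5 = 1 := by
            have : (z * w) ^ 5 = 1 := by rw [hzw, one_pow]
            rwa [mul_pow, hz, one_mul] at this
          rw [show 5 * k + 1 + 2 = 5 * k + 3 by ring, show 5 * k + 1 + 1 = 5 * k + 2 by ring,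
            pow_add, pow_add, pow_mul, pow_mul, hz, hw]
          simp only [one_pow, one_mul]
          linear_combination w ^ 2 * hz - z ^ 3 * (z * w + 1) * hzw
        rw [h0, map_zero, zero_mul, mul_zero]
        exact resSupp_zero _
      · refine ((resSupp_X_pow ?_).C_mul _).neg_one_pow_mul j
        rw [natCast_choose_two_five]
        have : (j + 2) % 5 = 2 ∨ (j + 2) % 5 = 4 := by omega
        rcases this with h | h <;> rw [h] <;> decide
  · rw [theta_expansion hzw, tsum_split_mod_five hn (a := 3) (b := 4) (by norm_num) (by norm_num)
      (by norm_num), theta_ten_fifteen]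
    simp only [(theta_term_five hzw hz _).1, (theta_term_five hzw hz _).2]
    rw [hn3.summable.tsum_mul_left, hn4.summable.tsum_mul_left, map_mul]
    ring

end Theta

/-! ### The congruences modulo 5. -/

section ModFive

variable {F : Type*} [Field F] [TopologicalSpace F] [DiscreteTopology F]

/-- Multiplication by `(z², w², q; q)_∞` completes the denominator `(z, w; q)_∞` to a multiple of
`(q⁵; q⁵)_∞`, at the cost of a theta factor on the right, which `theta_dissection` controls. -/
theorem genS_mul_five (l : Label) (hb : base l = (X : F⟦X⟧)) {z w : F} (hzw : z * w = 1)
    (hs : z ^ 2 + w ^ 2 + z + w + 1 = 0)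
    {δ : ℕ → F⟦X⟧} (hδ : ∀ n, X ^ n ∣ X * δ n)
    (hw : ∀ n, weight l n = δ n * ipoch X (2 * n)) {D : F⟦X⟧} {T : ℕ → F⟦X⟧}
    (hT : ∀ r, bcoef X r * conj X δ r = D * T r) (hTn : IsNull T)
    (hE : prefactor l * D = 1) :
    C ((1 - z) * (1 - w) * ((1 - z ^ 2) * (1 - w ^ 2))) * (genS l z w * pochInf (X ^ 5) (X ^ 5))
      = (pochInf (C (z ^ 2)) X * pochInf (C (w ^ 2)) X * pochInf X X)
        * ∑' r, T r * C (chi (z + w) r - 1) := by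
  have h1 := pochInf_mul_genS l hzw hδ (by rwa [hb])
  rw [hb] at h1
  have h2 := pochInf_fifth hzw hs (Q := (X : F⟦X⟧)) dvd_rfl
  have h3 : ∑' r, bcoef X r * conj X δ r * (chi (C (z + w)) r - 1)
      = D * ∑' r, T r * C (chi (z + w) r - 1) := by
    rw [← (hTn.mul_right _).summable.tsum_mul_left]
    refine tsum_congr fun r => ?_
    rw [hT, map_sub, map_one, map_chi]
    ring
  rw [h3] at h1
  linear_combination -genS l z w * h2
    + (pochInf (C (z ^ 2)) X * pochInf (C (w ^ 2)) X * pochInf X X) * h1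
    + (pochInf (C (z ^ 2)) X * pochInf (C (w ^ 2)) X * pochInf X X)
      * (∑' r, T r * C (chi (z + w) r - 1)) * hE

theorem sq_mod_five (r : ℕ) : ((r ^ 2 : ℕ) : ZMod 5) ∈ ({0, 1, 4} : Finset (ZMod 5)) := by
  push_cast
  generalize (r : ZMod 5) = x
  revert x
  decide

theorem pow_five_eq_one {z w : F} (hzw : z * w = 1) (hs : z ^ 2 + w ^ 2 + z + w + 1 = 0) :
    z ^ 5 = 1 := by
  linear_combination (z ^ 3 - z ^ 2) * hs
    - (z - 1) * (z * w + 1 + z) * hzw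

theorem const_ne_zero_of_ne_one {z w : F} (hzw : z * w = 1)
    (hs : z ^ 2 + w ^ 2 + z + w + 1 = 0) [CharZero F] :
    (1 - z) * (1 - w) * ((1 - z ^ 2) * (1 - w ^ 2)) ≠ 0 := by
  have h : (1 - z) * (1 - w) * ((1 - z ^ 2) * (1 - w ^ 2)) = 5 := by
    have e1 : (1 - z) * (1 - w) = 2 - (z + w) := by linear_combination hzw
    have e2 : (1 - z ^ 2) * (1 - w ^ 2) = 3 + (z + w) := by
      linear_combination (z * w + 1) * hzw - hs
    have e3 : (z + w) ^ 2 + (z + w) = 1 := by linear_combination hs + 2 * hzw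
    rw [e1, e2]
    linear_combination -e3
  rw [h]
  norm_num

theorem resSupp_pochInf_five : ResSupp ({0} : Finset (ZMod 5)) (pochInf (X ^ 5) (X ^ 5) : F⟦X⟧) :=
  resSupp_pochInf_X_pow (by norm_num) dvd_rfl dvd_rfl

theorem constantCoeff_pochInf_five : constantCoeff (pochInf (X ^ 5) (X ^ 5) : F⟦X⟧) = 1 :=
  constantCoeff_pochInf (dvd_pow_self X (by norm_num)) (dvd_pow_self X (by norm_num))

theorem resSupp_theta_products :
    ResSupp ({0} : Finset (ZMod 5)) (pochInf (X ^ 10) (X ^ 25) * pochInf (X ^ 15) (X ^ 25)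
      * pochInf (X ^ 25) (X ^ 25) : F⟦X⟧) :=
  ((resSupp_pochInf_X_pow (by norm_num) (by norm_num) (by norm_num)).mul
    (resSupp_pochInf_X_pow (by norm_num) (by norm_num) (by norm_num)) (U := {0}) (by decide)).mul
    (resSupp_pochInf_X_pow (by norm_num) (by norm_num) (by norm_num)) (by decide)

/-- Since `2 C(r, 2) + r = r²`, the Bailey sum has only square exponents, in classes `0, 1, 4`.
Adding the theta classes `0, 1` never produces `3`. -/
theorem resSupp_genS_G3 [CharZero F] {z w : F} (hzw : z * w = 1)
    (hs : z ^ 2 + w ^ 2 + z + w + 1 = 0) :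
    ResSupp ({0, 1, 2, 4} : Finset (ZMod 5)) (genS .G3 z w) := by
  have hX : (X : F⟦X⟧) ∣ X := dvd_rfl
  have hle : ∀ r : ℕ, r ≤ r.choose 2 + (r + 1).choose 2 + 1 := fun r => by
    rw [choose_succ_two]; omega
  have hTn : IsNull fun r : ℕ => (1 - X ^ (2 * r + 1) : F⟦X⟧)
      * X ^ (r.choose 2 + (r + 1).choose 2) :=
    (isNull_X_pow_mul _ 1 hle _).congr fun r => mul_comm _ _
  have hch : ∀ n : ℕ, n * (n + 1) / 2 = (n + 1).choose 2 := fun n => by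
    rw [Nat.choose_two_right, Nat.add_sub_cancel, mul_comm]
  have h := genS_mul_five .G3 rfl hzw hs
    (δ := fun n => poch X X n * ((-1) ^ n * X ^ (n + 1).choose 2))
    (X_pow_dvd_X_mul (e := fun n => (n + 1).choose 2) (g := fun n => poch X X n * (-1) ^ n)
      (fun n => by rw [choose_succ_two]; omega) fun n => by ring)
    (fun n => by simp only [weight, hch, ipoch]; ring) (D := 1)
    (fun r => (bcoef_mul_conj_G3 r).trans (one_mul _).symm) hTn
    (by simpa [prefactor] using Ring.mul_inverse_cancel _ (isUnit_pochInf hX hX))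
  obtain ⟨J₁, hJ₁, hJ⟩ := theta_dissection (z := z ^ 2) (w := w ^ 2)
    (by rw [← mul_pow, hzw, one_pow])
    (by rw [← pow_mul, mul_comm, pow_mul, pow_five_eq_one hzw hs, one_pow])
  have hJs : ResSupp ({0, 1} : Finset (ZMod 5))
      (pochInf (C (z ^ 2)) X * pochInf (C (w ^ 2)) X * pochInf X X) := by
    rw [hJ]
    exact ((resSupp_theta_products.C_mul _).mono (by decide)).add (hJ₁.mono (by decide))
  have hW : ResSupp ({0, 1, 4} : Finset (ZMod 5)) (∑' r, (1 - X ^ (2 * r + 1) : F⟦X⟧)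
      * X ^ (r.choose 2 + (r + 1).choose 2) * C (chi (z + w) r - 1)) := by
    refine resSupp_tsum (hTn.mul_right _) fun r => ?_
    rw [mul_comm]
    refine ResSupp.C_mul ?_ _
    have e : r.choose 2 + (r + 1).choose 2 = r ^ 2 := by
      rw [choose_succ_two, sq_eq_two_mul_choose_add]; ring
    rw [e, sub_mul, one_mul, ← pow_add, show 2 * r + 1 + r ^ 2 = (r + 1) ^ 2 by ring]
    exact (resSupp_X_pow (sq_mod_five r)).sub (resSupp_X_pow (sq_mod_five (r + 1)))
  set c := (1 - z) * (1 - w) * ((1 - z ^ 2) * (1 - w ^ 2)) with hc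
  have hc0 : c ≠ 0 := const_ne_zero_of_ne_one hzw hs
  have hcc : (C c⁻¹ : F⟦X⟧) * C c = 1 := by rw [← map_mul, inv_mul_cancel₀ hc0, map_one]
  refine ResSupp.of_mul_eq (h := C c⁻¹ * _) ?_ resSupp_pochInf_five constantCoeff_pochInf_five
    ((hJs.mul hW (U := {0, 1, 2, 4}) (by decide)).C_mul _)
  linear_combination C c⁻¹ * h - (genS .G3 z w * pochInf (X ^ 5) (X ^ 5)) * hcc

/-- The equality of these two sums makes all squares in class `4` occur with one common coefficient
up to sign, so that they assemble into a theta function. -/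
theorem chi_sub_one_add {s : F} (hs : s ^ 2 + s = 1) (m : ℕ) :
    (chi s (5 * m + 1 + 1) - 1) + (chi s (5 * m + 1) - 1) = -(s + 3) ∧
    (chi s (5 * m + 2 + 1) - 1) + (chi s (5 * m + 2) - 1) = -(s + 3) := by
  obtain ⟨-, h1, h2, h3, -⟩ := chi_five hs m
  rw [show 5 * m + 1 + 1 = 5 * m + 2 from rfl, show 5 * m + 2 + 1 = 5 * m + 3 from rfl, h1, h2, h3]
  constructor <;> ring

/-- The triple product with base `X⁵⁰` has exponents `50 C(m, 2) + 45 m` and `50 C(m+1, 2) + 5 (m +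
1)`; adding `4` completes the squares. -/
theorem theta_five_fortyfive :
    X ^ 4 * (pochInf (X ^ 45) (X ^ 50) * pochInf (X ^ 5) (X ^ 50) * pochInf (X ^ 50) (X ^ 50))
      = ∑' m : ℕ, (-1) ^ m * X ^ (5 * m + 2) ^ 2
        + ∑' m : ℕ, (-1) ^ (m + 1) * (X : F⟦X⟧) ^ (5 * m + 3) ^ 2 := by
  have hQ : (X : F⟦X⟧) ∣ X ^ 50 := dvd_pow_self X (by norm_num)
  rw [jacobi_triple_product hQ (by ring), mul_add,
    ← ((isNull_pow_choose_two hQ).mul_left _).summable.tsum_mul_left,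
    ← ((isNull_pow_choose_succ hQ 1).mul_left _).summable.tsum_mul_left]
  refine congrArg₂ (· + ·) (tsum_congr fun m => ?_) (tsum_congr fun m => ?_)
  · have e : (5 * m + 2) ^ 2 = 50 * m.choose 2 + 45 * m + 4 := by
      have := sq_eq_two_mul_choose_add m
      nlinarith
    rw [e]
    ring
  · have e : (5 * m + 3) ^ 2 = 50 * (m + 1).choose 2 + 5 * (m + 1) + 4 := by
      have := sq_eq_two_mul_choose_add (m + 1)
      nlinarith
    rw [e]
    ring

theorem pochInf_five_factors {b : F⟦X⟧} (hb : X ∣ b) :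
    pochInf b b = pochInf b (b ^ 5) * pochInf (b ^ 2) (b ^ 5) * pochInf (b ^ 3) (b ^ 5)
      * pochInf (b ^ 4) (b ^ 5) * pochInf (b ^ 5) (b ^ 5) := by
  have hb5 : X ∣ b ^ 5 := dvd_pow hb (by norm_num)
  have h1 := ((((tendsto_poch b hb5).mul (tendsto_poch (b ^ 2) hb5)).mul
    (tendsto_poch (b ^ 3) hb5)).mul (tendsto_poch (b ^ 4) hb5)).mul (tendsto_poch (b ^ 5) hb5)
  refine tendsto_nhds_unique (tendsto_poch_comp b hb (g := fun m => 5 * m) fun m => by omega)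
    (h1.congr fun n => ?_)
  induction n with
  | zero => simp
  | succ n ih =>
    rw [show 5 * (n + 1) = 5 * n + 1 + 1 + 1 + 1 + 1 by ring]
    simp only [poch_succ, ← ih]
    ring

/-- The quotient of the two theta series and `(q⁵; q⁵)_∞` in which every exponent is divisible
by `10`. -/
theorem theta_quotient : ∃ E : F⟦X⟧, ResSupp ({0} : Finset (ZMod 10)) E ∧
    (pochInf (X ^ 45) (X ^ 50) * pochInf (X ^ 5) (X ^ 50) * pochInf (X ^ 50) (X ^ 50))
      * (pochInf (X ^ 10) (X ^ 25) * pochInf (X ^ 15) (X ^ 25) * pochInf (X ^ 25) (X ^ 25))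
      = E * pochInf (X ^ 5) (X ^ 5) := by
  have hd : ∀ k, k ≠ 0 → (X : F⟦X⟧) ∣ X ^ k := fun k hk => dvd_pow_self X hk
  have hu : IsUnit (pochInf (X ^ 20) (X ^ 50) * pochInf (X ^ 30) (X ^ 50) : F⟦X⟧) :=
    (isUnit_pochInf (hd _ (by norm_num)) (hd _ (by norm_num))).mul
      (isUnit_pochInf (hd _ (by norm_num)) (hd _ (by norm_num)))
  have hinv := Ring.mul_inverse_cancel _ hu
  have hs : ∀ k, 10 ∣ k →
      ResSupp ({0} : Finset (ZMod 10)) (pochInf (X ^ k) (X ^ 50) : F⟦X⟧) := fun k hk =>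
    resSupp_pochInf_X_pow (by norm_num) hk (by norm_num)
  refine ⟨pochInf (X ^ 50) (X ^ 50)
    * Ring.inverse (pochInf (X ^ 20) (X ^ 50) * pochInf (X ^ 30) (X ^ 50)),
    (hs 50 (by norm_num)).mul (ResSupp.of_mul_eq (S := {0}) ((mul_comm _ _).trans hinv)
      ((hs 20 (by norm_num)).mul (hs 30 (by norm_num)) (by decide)) ?_ resSupp_one) (by decide), ?_⟩
  · rw [map_mul, constantCoeff_pochInf (hd _ (by norm_num)) (hd _ (by norm_num)),
      constantCoeff_pochInf (hd _ (by norm_num)) (hd _ (by norm_num)), one_mul]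
  -- Split `(q⁵; q⁵)_∞` into five products of base `q²⁵`, then split those starting at `q⁵` and
  -- `q²⁰` into base `q⁵⁰`. The theta factors cancel, leaving `(q²⁰, q³⁰; q⁵⁰)_∞` in the denominator
  -- and `(q⁵⁰; q⁵⁰)_∞` above.
  · have h5 := pochInf_five_factors (hd 5 (by norm_num) : (X : F⟦X⟧) ∣ X ^ 5)
    have h1 := pochInf_mul_pochInf_mul (X ^ 5 : F⟦X⟧) (hd 25 (by norm_num))
    have h2 := pochInf_mul_pochInf_mul (X ^ 20 : F⟦X⟧) (hd 25 (by norm_num))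
    simp only [← pow_mul, ← pow_add] at h5 h1 h2
    norm_num at h5 h1 h2
    rw [h5, ← h1, ← h2]
    linear_combination -(pochInf (X ^ 45) (X ^ 50) * pochInf (X ^ 5) (X ^ 50)
      * pochInf (X ^ 50) (X ^ 50) * (pochInf (X ^ 10) (X ^ 25) * pochInf (X ^ 15) (X ^ 25)
      * pochInf (X ^ 25) (X ^ 25))) * hinv

/-- The summand splits into four monomials. Two have exponents of the form `2 C(k, 2)`, in classes
`0, 1, 2`; the other two are the squares `r²` and `(r + 1)²`, whose class `4` occurs only at roots
congruent to `±2` modulo `5`. -/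
theorem series_dissection_F1 {s : F} (hs : s ^ 2 + s = 1) :
    ∃ W : F⟦X⟧, ResSupp ({0, 1, 2} : Finset (ZMod 5)) W ∧
      ∑' r : ℕ, (-1) ^ r * ((1 + X ^ r) * X ^ (2 * r.choose 2)
        - (1 + X ^ (r + 1)) * X ^ (r ^ 2 + 2 * r + 1)) * C (chi s r - 1)
      = C (-(s + 3)) * (X ^ 4 * (pochInf (X ^ 45) (X ^ 50) * pochInf (X ^ 5) (X ^ 50)
          * pochInf (X ^ 50) (X ^ 50))) + W := by
  have hle : ∀ r : ℕ, r ≤ 2 * r.choose 2 + 1 := fun r => by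
    have := le_choose_two r; omega
  have n1 : IsNull fun r : ℕ => C (chi s r - 1) * ((-1) ^ r * (X : F⟦X⟧) ^ (2 * r.choose 2)) :=
    ((isNull_X_pow _ 1 hle).mul_left _).mul_left _
  have n2 : IsNull fun r : ℕ => C (chi s r - 1) * ((-1) ^ r * (X : F⟦X⟧) ^ (r ^ 2)) :=
    ((isNull_X_pow (fun r => r ^ 2) 0 fun r => by nlinarith).mul_left _).mul_left _
  have n3 : IsNull fun r : ℕ => C (chi s r - 1) * ((-1) ^ r * (X : F⟦X⟧) ^ ((r + 1) ^ 2)) :=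
    ((isNull_X_pow (fun r => (r + 1) ^ 2) 0 fun r => by nlinarith).mul_left _).mul_left _
  have n4 : IsNull fun r : ℕ => C (chi s r - 1) * ((-1) ^ r * (X : F⟦X⟧) ^ (2 * (r + 2).choose 2)) :=
    ((isNull_X_pow (fun r => 2 * (r + 2).choose 2) 0 fun r => by
      rw [choose_succ_two, choose_succ_two]; omega).mul_left _).mul_left _
  have nh : IsNull fun r : ℕ => C ((chi s (r + 1) - 1) + (chi s r - 1))
      * ((-1) ^ (r + 1) * (X : F⟦X⟧) ^ ((r + 1) ^ 2)) :=
    ((isNull_X_pow (fun r => (r + 1) ^ 2) 0 fun r => by nlinarith).mul_left _).mul_left _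
  have hsum : ∑' r : ℕ, (-1) ^ r * ((1 + X ^ r) * X ^ (2 * r.choose 2)
        - (1 + X ^ (r + 1)) * X ^ (r ^ 2 + 2 * r + 1)) * C (chi s r - 1)
      = ∑' r : ℕ, C (chi s r - 1) * ((-1) ^ r * (X : F⟦X⟧) ^ (2 * r.choose 2))
        - ∑' r : ℕ, C (chi s r - 1) * ((-1) ^ r * (X : F⟦X⟧) ^ (2 * (r + 2).choose 2))
        + ∑' r : ℕ, C ((chi s (r + 1) - 1) + (chi s r - 1))
          * ((-1) ^ (r + 1) * (X : F⟦X⟧) ^ ((r + 1) ^ 2)) := by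
    -- Shifting the `r²` series by one aligns it with the `(r + 1)²` series; its first term is lost
    -- because `chi s 0 = 1`.
    have e1 : ∑' r : ℕ, C ((chi s (r + 1) - 1) + (chi s r - 1))
          * ((-1) ^ (r + 1) * (X : F⟦X⟧) ^ ((r + 1) ^ 2))
        = ∑' r : ℕ, C (chi s r - 1) * ((-1) ^ r * (X : F⟦X⟧) ^ (r ^ 2))
          - ∑' r : ℕ, C (chi s r - 1) * ((-1) ^ r * (X : F⟦X⟧) ^ ((r + 1) ^ 2)) := by
      rw [n2.summable.tsum_eq_zero_add, add_sub_assoc,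
        ← (n2.comp_injective (add_left_injective 1)).summable.tsum_sub n3.summable]
      have h0 : chi s 0 - 1 = 0 := by simp [chi]
      rw [h0, map_zero, zero_mul, zero_add]
      refine tsum_congr fun r => ?_
      rw [map_add]
      ring
    rw [e1, ← n1.summable.tsum_sub n4.summable, ← n2.summable.tsum_sub n3.summable,
      ← (n1.summable.sub n4.summable).tsum_add (n2.summable.sub n3.summable)]
    refine tsum_congr fun r => ?_
    have e2 : (r + 2).choose 2 = r.choose 2 + 2 * r + 1 := by
      rw [choose_succ_two, choose_succ_two]; ring
    rw [e2, show (r + 1) ^ 2 = r ^ 2 + 2 * r + 1 by ring, sq_eq_two_mul_choose_add]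
    ring
  have hrest : IsNull fun r : ℕ => if r % 5 = 1 ∨ r % 5 = 2 then 0
      else C ((chi s (r + 1) - 1) + (chi s r - 1))
        * ((-1) ^ (r + 1) * (X : F⟦X⟧) ^ ((r + 1) ^ 2)) := by
    intro N
    filter_upwards [nh N] with r hr
    split_ifs
    · exact dvd_zero _
    · exact hr
  have hch : ∀ r : ℕ, ((2 * r.choose 2 : ℕ) : ZMod 5) ∈ ({0, 1, 2} : Finset (ZMod 5)) := by
    intro r
    rw [Nat.cast_mul, natCast_choose_two_five]
    have := Nat.mod_lt r (show 5 > 0 by norm_num)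
    generalize r % 5 = e at *
    interval_cases e <;> decide
  refine ⟨∑' r : ℕ, C (chi s r - 1) * ((-1) ^ r * (X : F⟦X⟧) ^ (2 * r.choose 2))
        - ∑' r : ℕ, C (chi s r - 1) * ((-1) ^ r * (X : F⟦X⟧) ^ (2 * (r + 2).choose 2))
        + ∑' r : ℕ, (if r % 5 = 1 ∨ r % 5 = 2 then 0
          else C ((chi s (r + 1) - 1) + (chi s r - 1))
            * ((-1) ^ (r + 1) * (X : F⟦X⟧) ^ ((r + 1) ^ 2))), ?_, ?_⟩
  · refine ((resSupp_tsum n1 fun r => ?_).sub (resSupp_tsum n4 fun r => ?_)).add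
      (resSupp_tsum hrest fun r => ?_)
    · exact ((resSupp_X_pow (hch r)).neg_one_pow_mul r).C_mul _
    · exact ((resSupp_X_pow (hch (r + 2))).neg_one_pow_mul r).C_mul _
    · split_ifs with h
      · exact resSupp_zero _
      · refine ((resSupp_X_pow ?_).neg_one_pow_mul _).C_mul _
        push_cast
        rw [← ZMod.natCast_mod r 5]
        have := Nat.mod_lt r (show 5 > 0 by norm_num)
        generalize r % 5 = e at *
        interval_cases e <;> first | decide | (exfalso; omega)
  · have k1 : IsNull fun m : ℕ => (-1) ^ m * (X : F⟦X⟧) ^ (5 * m + 2) ^ 2 :=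
      (isNull_X_pow (fun m => (5 * m + 2) ^ 2) 0 fun m => by nlinarith).mul_left _
    have k2 : IsNull fun m : ℕ => (-1) ^ (m + 1) * (X : F⟦X⟧) ^ (5 * m + 3) ^ 2 :=
      (isNull_X_pow (fun m => (5 * m + 3) ^ 2) 0 fun m => by nlinarith).mul_left _
    rw [hsum, tsum_split_mod_five nh (a := 1) (b := 2) (by norm_num) (by norm_num) (by norm_num),
      theta_five_fortyfive, mul_add, ← k1.summable.tsum_mul_left, ← k2.summable.tsum_mul_left]
    have e3 : ∀ k, (-1 : F⟦X⟧) ^ (5 * k) = (-1) ^ k := fun k => by rw [pow_mul]; norm_num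
    have t1 : ∀ m, C ((chi s (5 * m + 1 + 1) - 1) + (chi s (5 * m + 1) - 1))
          * ((-1) ^ (5 * m + 1 + 1) * (X : F⟦X⟧) ^ ((5 * m + 1 + 1) ^ 2))
        = C (-(s + 3)) * ((-1) ^ m * X ^ (5 * m + 2) ^ 2) := fun m => by
      rw [(chi_sub_one_add hs m).1, show 5 * m + 1 + 1 = 5 * m + 2 from rfl, pow_add, e3]
      ring
    have t2 : ∀ m, C ((chi s (5 * m + 2 + 1) - 1) + (chi s (5 * m + 2) - 1))
          * ((-1) ^ (5 * m + 2 + 1) * (X : F⟦X⟧) ^ ((5 * m + 2 + 1) ^ 2))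
        = C (-(s + 3)) * ((-1) ^ (m + 1) * X ^ (5 * m + 3) ^ 2) := fun m => by
      rw [(chi_sub_one_add hs m).2, show 5 * m + 2 + 1 = 5 * m + 3 from rfl, pow_add, e3]
      ring
    simp only [t1, t2]
    ring

theorem coeff_genS_F1 [CharZero F] {z w : F} (hzw : z * w = 1)
    (hs : z ^ 2 + w ^ 2 + z + w + 1 = 0) (n : ℕ) : coeff (10 * n + 9) (genS .F1 z w) = 0 := by
  have hX : (X : F⟦X⟧) ∣ X := dvd_rfl
  have hXn := X_dvd_neg_X (A := F)
  have hTn : IsNull fun r : ℕ => (-1) ^ r * ((1 + X ^ r) * X ^ (2 * r.choose 2)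
        - (1 + X ^ (r + 1)) * X ^ (r ^ 2 + 2 * r + 1) : F⟦X⟧) := by
    refine (isNull_X_pow_mul (fun r => 2 * r.choose 2) 1 (fun r => by
      have := le_choose_two r; omega) fun r => (-1) ^ r * ((1 + X ^ r)
        - (1 + X ^ (r + 1)) * X ^ (r + 2 * r + 1))).congr fun r => ?_
    rw [sq_eq_two_mul_choose_add]
    ring
  have h := genS_mul_five .F1 rfl hzw hs (δ := fun n => poch (-X) X n * X ^ n.choose 2)
    (X_pow_dvd_X_mul (e := fun n => n.choose 2) (g := fun n => poch (-X) X n)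
      le_choose_two fun n => by ring)
    (fun n => by simp only [weight, Nat.choose_two_right, ipoch])
    (D := pochInf (-X) X * ipochInf X) (fun r => bcoef_mul_conj_F1 r) hTn
    (by
      have h1 := Ring.mul_inverse_cancel _ (isUnit_pochInf hXn hX)
      have h2 := pochInf_mul_ipochInf hX
      simp only [prefactor]
      linear_combination (pochInf X X * ipochInf X) * h1 + h2)
  obtain ⟨J₁, hJ₁, hJ⟩ := theta_dissection (z := z ^ 2) (w := w ^ 2)
    (by rw [← mul_pow, hzw, one_pow])
    (by rw [← pow_mul, mul_comm, pow_mul, pow_five_eq_one hzw hs, one_pow])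
  obtain ⟨W, hW, hWe⟩ := series_dissection_F1 (s := z + w)
    (by linear_combination hs + 2 * hzw)
  obtain ⟨E, hE, hEe⟩ := theta_quotient (F := F)
  rw [hJ, hWe] at h
  set c := (1 - z) * (1 - w) * ((1 - z ^ 2) * (1 - w ^ 2)) with hc
  have hc0 : c ≠ 0 := const_ne_zero_of_ne_one hzw hs
  have hcc : (C c⁻¹ : F⟦X⟧) * C c = 1 := by rw [← map_mul, inv_mul_cancel₀ hc0, map_one]
  set Θ₁ := pochInf (X ^ 45) (X ^ 50) * pochInf (X ^ 5) (X ^ 50) * pochInf (X ^ 50) (X ^ 50 : F⟦X⟧)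
  have hX4 : ResSupp ({4} : Finset (ZMod 5)) (X ^ 4 * Θ₁) :=
    (resSupp_X_pow (S := {4}) (by decide)).mul (((resSupp_pochInf_X_pow (by norm_num) (by norm_num)
      (by norm_num)).mul (resSupp_pochInf_X_pow (by norm_num) (by norm_num) (by norm_num))
      (U := {0}) (by decide)).mul (resSupp_pochInf_X_pow (by norm_num) (by norm_num) (by norm_num))
      (U := {0}) (by decide)) (by decide)
  set Θ₂ := pochInf (X ^ 10) (X ^ 25) * pochInf (X ^ 15) (X ^ 25)
    * pochInf (X ^ 25) (X ^ 25 : F⟦X⟧) with hΘ₂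
  have hΘ : ResSupp ({0} : Finset (ZMod 5)) Θ₂ := resSupp_theta_products
  set a := (1 - z ^ 2) * (1 - w ^ 2)
  set b := -(z + w + 3)
  -- Of the four products of theta parts and series parts, these three miss the class `4`: their
  -- classes are `{0, 1, 2}`, `{0}` and `{1, 2, 3}`.
  have hrest : ResSupp ({0, 1, 2, 3} : Finset (ZMod 5))
      (C c⁻¹ * (C a * Θ₂ * W + J₁ * (C b * (X ^ 4 * Θ₁)) + J₁ * W)) :=
    (((((hΘ.C_mul a).mul hW (by decide)).add (hJ₁.mul (hX4.C_mul b) (by decide))).add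
      (hJ₁.mul hW (by decide)))).C_mul _
  -- Division by `(q⁵; q⁵)_∞` turns the fourth product into a multiple of `X ^ 4 * E`, the only
  -- possible contribution to class `4` modulo `5`. As `E` is a series in `q¹⁰`, it misses the class
  -- `9` modulo `10`.
  have hrem : ResSupp ({0, 1, 2, 3} : Finset (ZMod 5))
      (genS .F1 z w - C c⁻¹ * (C a * C b) * (X ^ 4 * E)) := by
    refine ResSupp.of_mul_eq ?_ resSupp_pochInf_five constantCoeff_pochInf_five hrest
    linear_combination C c⁻¹ * h - (genS .F1 z w * pochInf (X ^ 5) (X ^ 5)) * hcc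
      + C c⁻¹ * (C a * C b) * X ^ 4 * hEe
  have hmain : ResSupp ({4} : Finset (ZMod 10)) (C c⁻¹ * (C a * C b) * (X ^ 4 * E)) := by
    rw [← map_mul, ← map_mul]
    exact ((resSupp_X_pow (S := {4}) (by decide)).mul hE (by decide)).C_mul _
  have h1 := hrem (10 * n + 9) (by
    push_cast
    rw [show (10 : ZMod 5) = 0 by decide, zero_mul]
    decide)
  have h2 := hmain (10 * n + 9) (by
    push_cast
    rw [show (10 : ZMod 10) = 0 by decide, zero_mul]
    decide)
  rw [map_sub, h2, sub_zero] at h1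
  exact h1

end ModFive

/-! ### From roots of unity to equidistribution. -/

section Transfer

open LaurentPolynomial

/-- A Laurent polynomial evaluated at a unit is the sum of its terms. -/
theorem eval₂_eq_sum_support {E : Type*} [Field E] (x : Eˣ) (p : LaurentPolynomial ℤ) :
    LaurentPolynomial.eval₂ (Int.castRingHom E) x p
      = ∑ m ∈ p.coeff.support, (p.coeff m : E) * (x : E) ^ m := by
  change _ = p.coeff.sum fun m c => (c : E) * (x : E) ^ m
  induction p using LaurentPolynomial.induction_on' with
  | add p r hp hr =>
    rw [map_add, hp, hr, AddMonoidAlgebra.coeff_add, Finsupp.sum_add_index']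
    · simp
    · intros; push_cast; ring
  | C_mul_T m a =>
    rw [LaurentPolynomial.eval₂_C_mul_T, ← LaurentPolynomial.single_eq_C_mul_T,
      AddMonoidAlgebra.coeff_single, Finsupp.sum_single_index (by simp)]
    simp

/-- Clearing a power of `z` reduces the claim to integer polynomials, which embed in `ℚ(z)`. This
gives the uniqueness of the numbers `M_X(m, n)`. -/
theorem eval₂_X_injective : Function.Injective
    (LaurentPolynomial.eval₂ (Int.castRingHom K) (Units.mk0 RatFunc.X RatFunc.X_ne_zero)) := by
  rw [injective_iff_map_eq_zero]
  intro p hp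
  obtain ⟨n, f, hf⟩ := p.exists_T_pow
  have h1 : Polynomial.eval₂ (Int.castRingHom K) (RatFunc.X : K) f = 0 := by
    have := congrArg
      (LaurentPolynomial.eval₂ (Int.castRingHom K) (Units.mk0 RatFunc.X RatFunc.X_ne_zero)) hf
    rw [map_mul, hp, zero_mul, LaurentPolynomial.eval₂_toLaurent] at this
    exact this
  have h2 : algebraMap (Polynomial ℚ) K (f.map (Int.castRingHom ℚ)) = 0 := by
    rw [← h1, Polynomial.map, Polynomial.hom_eval₂, RatFunc.algebraMap_X]
    congr 1
    exact RingHom.ext_int _ _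
  have h3 : f = 0 := by
    have := (map_eq_zero_iff (algebraMap (Polynomial ℚ) K) (RatFunc.algebraMap_injective ℚ)).1 h2
    exact (Polynomial.map_eq_zero_iff (RingHom.injective_int (Int.castRingHom ℚ))).1 this
  rw [h3, map_zero] at hf
  exact (LaurentPolynomial.isUnit_T n).mul_left_eq_zero.1 hf.symm

/-- A vanishing rational combination of the first `t` powers of a primitive `t`-th root of unity,
`t` prime, has equal coefficients. -/
theorem eq_of_sum_mul_pow_eq_zero {E : Type*} [Field E] [CharZero E] {t : ℕ} (ht : t.Prime) {ζ : E}
    (hζ : IsPrimitiveRoot ζ t) (c : ℕ → ℚ)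
    (h : ∑ r ∈ Finset.range t, (algebraMap ℚ E (c r)) * ζ ^ r = 0) {r s : ℕ} (hr : r < t)
    (hs : s < t) : c r = c s := by
  have : Fact t.Prime := ⟨ht⟩
  obtain ⟨d, rfl⟩ : ∃ d, t = d + 1 := ⟨t - 1, by have := ht.pos; omega⟩
  -- Subtracting `c d` times `1 + ζ + ⋯ + ζ^d = 0` removes the top term. The result has degree below
  -- that of the cyclotomic polynomial, which divides it, so it is zero.
  set Q : Polynomial ℚ := ∑ i ∈ Finset.range d, Polynomial.C (c i - c d) * Polynomial.X ^ i with hQ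
  have hgeom : ∑ i ∈ Finset.range (d + 1), ζ ^ i = 0 := hζ.geom_sum_eq_zero ht.one_lt
  have hroot : Polynomial.aeval ζ Q = 0 := by
    have h1 : Polynomial.aeval ζ Q
        = ∑ i ∈ Finset.range (d + 1), (algebraMap ℚ E (c i) - algebraMap ℚ E (c d)) * ζ ^ i := by
      rw [Finset.sum_range_succ, sub_self, zero_mul, add_zero, hQ, map_sum]
      simp
    rw [h1]
    simp_rw [sub_mul]
    rw [Finset.sum_sub_distrib, h, ← Finset.mul_sum, hgeom]
    simp
  have hdvd : Polynomial.cyclotomic (d + 1) ℚ ∣ Q := by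
    rw [Polynomial.cyclotomic_eq_minpoly_rat hζ ht.pos]
    exact minpoly.dvd ℚ ζ hroot
  have hdeg : Q.degree < (Polynomial.cyclotomic (d + 1) ℚ).degree := by
    rw [Polynomial.degree_cyclotomic, Nat.totient_prime ht, Nat.add_sub_cancel]
    refine (Polynomial.degree_sum_le _ _).trans_lt ?_
    refine (Finset.sup_lt_iff (WithBot.bot_lt_coe d)).2 fun i hi => ?_
    refine (Polynomial.degree_C_mul_X_pow_le _ _).trans_lt ?_
    exact Nat.cast_lt.2 (Finset.mem_range.1 hi)
  have hQ0 : Q = 0 := Polynomial.eq_zero_of_dvd_of_degree_lt hdvd hdeg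
  have key : ∀ i < d + 1, c i = c d := by
    intro i hi
    rcases Nat.lt_succ_iff_lt_or_eq.1 hi with hi | rfl
    · have := congrArg (fun P : Polynomial ℚ => P.coeff i) hQ0
      simp only [hQ, Polynomial.finsetSum_coeff, Polynomial.coeff_C_mul_X_pow,
        Polynomial.coeff_zero, Finset.sum_ite_eq, Finset.mem_range, hi, if_true] at this
      linarith
    · rfl
  rw [key r hr, key s hs]

theorem residueSum_eq_sum {M : ℤ → ℕ → ℤ} {n : ℕ} {s : Finset ℤ}
    (hs : (Function.support fun m => M m n) ⊆ s) (k : ℤ) (t : ℕ) :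
    residueSum M k t n = ∑ m ∈ s with m ≡ k [ZMOD t], M m n := by
  rw [residueSum, Finset.sum_filter, finsum_eq_sum_of_support_subset (s := s)]
  · refine Finset.sum_congr rfl fun m _ => ?_
    rw [finsum_eq_if]
  · intro m hm
    refine hs fun h0 => hm ?_
    simp only at h0
    simp [h0]

/-- Equidistribution modulo a prime is a vanishing at a primitive root of unity. -/
theorem equidistributed_of_eval_eq_zero {E : Type*} [Field E] [CharZero E] {t : ℕ} (ht : t.Prime)
    {ζ : E} (hζ : IsPrimitiveRoot ζ t) {M : ℤ → ℕ → ℤ} {n : ℕ} {s : Finset ℤ}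
    (hs : (Function.support fun m => M m n) ⊆ s) (h : ∑ m ∈ s, (M m n : E) * ζ ^ m = 0) :
    Equidistributed M t n := by
  have ht0 : (t : ℤ) ≠ 0 := by exact_mod_cast ht.ne_zero
  have htpos : (0 : ℤ) < t := by exact_mod_cast ht.pos
  have hmod (k : ℤ) : (((k % t).toNat : ℕ) : ℤ) = k % t := Int.toNat_of_nonneg (Int.emod_nonneg k ht0)
  have hlt (k : ℤ) : (k % t).toNat < t := by
    have := Int.emod_lt_of_pos k htpos
    have := hmod k
    omega
  have hred (k : ℤ) : residueSum M k t n = residueSum M ((k % t).toNat : ℕ) t n := by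
    rw [residueSum_eq_sum hs, residueSum_eq_sum hs]
    refine Finset.sum_congr (Finset.filter_congr fun m _ => ?_) fun _ _ => rfl
    rw [hmod, Int.ModEq, Int.ModEq, Int.emod_emod_of_dvd _ dvd_rfl]
  -- As `ζ ^ t = 1`, the value at `ζ` depends only on the exponents modulo `t`; grouping them leaves
  -- the residue sums as coefficients.
  have hsum : ∑ r ∈ Finset.range t, algebraMap ℚ E (residueSum M (r : ℕ) t n : ℤ) * ζ ^ r = 0 := by
    rw [← h, ← Finset.sum_fiberwise_of_maps_to (s := s) (t := Finset.range t)
      (g := fun m => (m % t).toNat) fun m _ => Finset.mem_range.2 (hlt m)]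
    refine Finset.sum_congr rfl fun r hr => ?_
    rw [residueSum_eq_sum hs, map_intCast, Int.cast_sum, Finset.sum_mul]
    have hrt := Finset.mem_range.1 hr
    refine Finset.sum_congr (Finset.filter_congr fun m _ => ?_) fun m hm => ?_
    · rw [Int.ModEq, Int.emod_eq_of_lt (a := (r : ℤ)) (by positivity) (by exact_mod_cast hrt)]
      have := hmod m
      omega
    · have hm2 := (Finset.mem_filter.1 hm).2
      have hm3 : m = t * (m / t) + (r : ℤ) := by
        rw [← hm2, hmod, Int.mul_ediv_add_emod]
      have hζ0 : ζ ≠ 0 := hζ.ne_zero ht.ne_zero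
      congr 1
      conv_rhs => rw [hm3]
      rw [zpow_add₀ hζ0, zpow_mul, zpow_natCast, hζ.pow_eq_one, one_zpow, one_mul, zpow_natCast]
  intro k l
  rw [hred k, hred l]
  exact_mod_cast eq_of_sum_mul_pow_eq_zero ht hζ
    (fun r => ((residueSum M (r : ℕ) t n : ℤ) : ℚ)) hsum (hlt k) (hlt l)

/-- The discrete topology on the integral Laurent polynomials. -/
@[reducible] def discreteLaurent : TopologicalSpace (LaurentPolynomial ℤ) := ⊥

attribute [local instance] discreteLaurent

instance discreteTopologyLaurent : DiscreteTopology (LaurentPolynomial ℤ) := ⟨rfl⟩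

/-- The series `S_X` over the integral Laurent polynomials in `z`. -/
def laurentS (l : Label) : PowerSeries (LaurentPolynomial ℤ) :=
  genS l (LaurentPolynomial.T 1) (LaurentPolynomial.T (-1))

/-- The spt-crank numbers `M_X(m,n)`. -/
def crank (l : Label) (m : ℤ) (n : ℕ) : ℤ := (coeff n (laurentS l)).coeff m

theorem support_crank (l : Label) (n : ℕ) :
    (Function.support fun m => crank l m n) ⊆ ((coeff n (laurentS l)).coeff.support : Set ℤ) :=
  fun m hm => by simpa [crank] using hm

/-- One Laurent polynomial serves every specialization: `x = z` in `ℚ(z)` recovers the given series,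
and `x = ζ` tests equidistribution of the same coefficients. -/
theorem coeff_genS_eq_sum {E : Type*} [Field E] [TopologicalSpace E] [DiscreteTopology E]
    (l : Label) (x : E) (hx : x ≠ 0) (n : ℕ) :
    coeff n (genS l x x⁻¹)
      = LaurentPolynomial.eval₂ (Int.castRingHom E) (Units.mk0 x hx) (coeff n (laurentS l)) := by
  have h := map_genS (LaurentPolynomial.eval₂ (Int.castRingHom E) (Units.mk0 x hx)) l
    (LaurentPolynomial.T 1) (LaurentPolynomial.T (-1))
  rw [LaurentPolynomial.eval₂_T, LaurentPolynomial.eval₂_T, zpow_one, zpow_neg_one,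
    Units.val_inv_eq_inv_val, Units.val_mk0] at h
  rw [← h, coeff_map]
  rfl

section

attribute [local instance] discreteK

theorem coeff_S (l : Label) (n : ℕ) : coeff n (S l) = LaurentPolynomial.eval₂ (Int.castRingHom K)
    (Units.mk0 RatFunc.X RatFunc.X_ne_zero) (coeff n (laurentS l)) := by
  rw [S_eq_genS, coeff_genS_eq_sum l _ RatFunc.X_ne_zero]

end

theorem isExpansion_crank (l : Label) : IsExpansion (S l) (crank l) := by
  intro n
  refine ⟨(Finset.finite_toSet _).subset (support_crank l n), ?_⟩
  rw [coeff_S, eval₂_eq_sum_support, finsum_eq_sum_of_support_subset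
    (s := (coeff n (laurentS l)).coeff.support)]
  · rfl
  · intro m hm
    refine support_crank l n fun h0 => hm ?_
    simp only at h0
    simp [h0]

theorem eq_crank_of_isExpansion (l : Label) {M : ℤ → ℕ → ℤ} (h : IsExpansion (S l) M) :
    M = crank l := by
  funext m n
  obtain ⟨hfin, hn⟩ := h n
  set p : LaurentPolynomial ℤ := .ofCoeff (Finsupp.ofSupportFinite (fun m => M m n) hfin) with hp
  have hpc (m : ℤ) : p.coeff m = M m n := rfl
  have : p = coeff n (laurentS l) := by
    apply eval₂_X_injective
    rw [← coeff_S, hn, eval₂_eq_sum_support, finsum_eq_sum_of_support_subset (s := p.coeff.support)]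
    · rfl
    · intro m hm
      simp only [Finset.mem_coe, Finsupp.mem_support_iff, hpc]
      intro h0
      exact hm (by simp [h0])
  rw [crank, ← this, hpc]

theorem equidistributed_crank {E : Type*} [Field E] [CharZero E] [TopologicalSpace E]
    [DiscreteTopology E] {t : ℕ} (ht : t.Prime) {ζ : E} (hζ : IsPrimitiveRoot ζ t) {l : Label}
    {n : ℕ} (h : coeff n (genS l ζ ζ⁻¹) = 0) : Equidistributed (crank l) t n := by
  rw [coeff_genS_eq_sum l ζ (hζ.ne_zero ht.ne_zero), eval₂_eq_sum_support] at h
  exact equidistributed_of_eval_eq_zero ht hζ (support_crank l n) h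

theorem equidistributed_crank_three (n : ℕ) :
    Equidistributed (crank .L7) 3 (3 * n + 1) ∧ Equidistributed (crank .L9) 3 (3 * n + 2) ∧
      Equidistributed (crank .L12) 3 (3 * n) ∧ Equidistributed (crank .G1) 3 (3 * n) ∧
      Equidistributed (crank .G2) 3 (3 * n) ∧ Equidistributed (crank .G2) 3 (3 * n + 2) := by
  let _ : TopologicalSpace (AlgebraicClosure ℚ) := ⊥
  have : DiscreteTopology (AlgebraicClosure ℚ) := ⟨rfl⟩
  obtain ⟨ζ, hζ⟩ := HasEnoughRootsOfUnity.exists_primitiveRoot (AlgebraicClosure ℚ) 3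
  have h0 : ζ ≠ 0 := hζ.ne_zero (by norm_num)
  have hzw : ζ * ζ⁻¹ = 1 := mul_inv_cancel₀ h0
  have hs : ζ + ζ⁻¹ = -1 := by
    have := hζ.geom_sum_eq_zero (by norm_num)
    simp only [Finset.sum_range_succ, Finset.sum_range_zero, zero_add, pow_zero, pow_one] at this
    linear_combination ζ⁻¹ * this - (1 + ζ) * hzw
  have h3 : (3 : ZMod 3) = 0 := by decide
  refine ⟨?_, ?_, ?_, ?_, ?_, ?_⟩ <;> refine equidistributed_crank Nat.prime_three hζ ?_
  · exact resSupp_genS_L7 hzw hs _ (by push_cast; rw [h3, zero_mul]; decide)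
  · exact resSupp_genS_L9 hzw hs _ (by push_cast; rw [h3, zero_mul]; decide)
  · exact resSupp_genS_L12 hzw hs _ (by push_cast; rw [h3, zero_mul]; decide)
  · exact resSupp_genS_G1 hzw hs _ (by push_cast; rw [h3, zero_mul]; decide)
  · exact resSupp_genS_G2 hzw hs _ (by push_cast; rw [h3, zero_mul]; decide)
  · exact resSupp_genS_G2 hzw hs _ (by push_cast; rw [h3, zero_mul]; decide)

theorem equidistributed_crank_five (n : ℕ) :
    Equidistributed (crank .F1) 5 (10 * n + 9) ∧ Equidistributed (crank .G3) 5 (5 * n + 3) := by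
  let _ : TopologicalSpace (AlgebraicClosure ℚ) := ⊥
  have : DiscreteTopology (AlgebraicClosure ℚ) := ⟨rfl⟩
  obtain ⟨ζ, hζ⟩ := HasEnoughRootsOfUnity.exists_primitiveRoot (AlgebraicClosure ℚ) 5
  have h0 : ζ ≠ 0 := hζ.ne_zero (by norm_num)
  have hzw : ζ * ζ⁻¹ = 1 := mul_inv_cancel₀ h0
  have hs : ζ ^ 2 + ζ⁻¹ ^ 2 + ζ + ζ⁻¹ + 1 = 0 := by
    have := hζ.geom_sum_eq_zero (by norm_num)
    simp only [Finset.sum_range_succ, Finset.sum_range_zero, zero_add, pow_zero, pow_one] at this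
    field_simp
    linear_combination this
  refine ⟨?_, ?_⟩ <;> refine equidistributed_crank Nat.prime_five hζ ?_
  · exact coeff_genS_F1 hzw hs n
  · exact resSupp_genS_G3 hzw hs _ (by
      push_cast
      rw [show (5 : ZMod 5) = 0 by decide, zero_mul]
      decide)

end Transfer

end
end SptCrank

theorem mainTheorem2 :
    ∃ M : SptCrank.Label → ℤ → ℕ → ℤ,
      (∀ X, SptCrank.IsExpansion (SptCrank.S X) (M X) ∧
        ∀ M' : ℤ → ℕ → ℤ, SptCrank.IsExpansion (SptCrank.S X) M' → M' = M X) ∧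
      ∀ n : ℕ,
        SptCrank.Equidistributed (M .L7) 3 (3 * n + 1) ∧
        SptCrank.Equidistributed (M .L9) 3 (3 * n + 2) ∧
        SptCrank.Equidistributed (M .L12) 3 (3 * n) ∧
        SptCrank.Equidistributed (M .G1) 3 (3 * n) ∧
        SptCrank.Equidistributed (M .G2) 3 (3 * n) ∧
        SptCrank.Equidistributed (M .G2) 3 (3 * n + 2) ∧
        SptCrank.Equidistributed (M .F1) 5 (10 * n + 9) ∧
        SptCrank.Equidistributed (M .G3) 5 (5 * n + 3) :=
  ⟨SptCrank.crank, fun X => ⟨SptCrank.isExpansion_crank X,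
    fun _ h => SptCrank.eq_crank_of_isExpansion X h⟩, fun n => by
    obtain ⟨h1, h2, h3, h4, h5, h6⟩ := SptCrank.equidistributed_crank_three n
    exact ⟨h1, h2, h3, h4, h5, h6, SptCrank.equidistributed_crank_five n⟩⟩
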